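/- Let $B=[0,1]^2$ be the unit square. Let $G$ be a finite connected planar graph embedded in the plane (edges are simple rectifiable arcs meeting at most in common end vertices), let $E$ be the set of points covered by its edges, and let $L<\infty$ be the total Euclidean length of its edges. Let $\mathcal D$ be a finite set of pairwise disjoint closed disks of equal radius $\delta>0$, each of which intersects $E$, and suppose that $E$ and all disks of $\mathcal D$ are contained in $B$. Definitions. A window $W$ is a closed axis-aligned rectangle contained in $B$. A cut of $W$ is an axis-parallel line $\ell$ that meets the interior of $W$; it splits $W$ into two windows. Let $m$ be a positive integer and $F\subseteq\mathbb R^2$. (a) Suppose that $\ell\cap F\cap\mathrm{int}(W)$ consists of finitely many disjoint subsegments of $\ell$, possibly single points, and let $p_1,\dots,p_\xi$ be the endpoints of these subsegments in order along $\ell$ (a single point counts as one endpoint). The $m$-span of $\ell$ with respect to $F$ and $W$ is empty if $\xi\le 2(m-1)$, and is the (possibly zero-length) segment $p_mp_{\xi-m+1}$ otherwise. (b) Let $D_1,\dots,D_k$ be the disks of $\mathcal D$ that intersect $\ell\cap W$, in order along $\ell$. The $m$-disk-span of $\ell$ with respect to $W$ is empty if $k\le 2m$; otherwise it is the segment joining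 the last point of $\ell\cap D_m$ to the first point of $\ell\cap D_{k-m+1}$ in that order. (c) A cut $\ell$ is $m$-good for $F$ with respect to $W$ if $\ell\cap F\cap\mathrm{int}(W)$ consists of finitely many subsegments and $F$ contains both the $m$-span and the $m$-disk-span of $\ell$. (d) $F$ satisfies the $m$-guillotine property with respect to $W$ if either $W$ fully contains no disk of $\mathcal D$, or there is a cut $\ell$, $m$-good for $F$ with respect to $W$, that splits $W$ into $W_1$ and $W_2$ such that, recursively (with finite recursion), $F$ satisfies the $m$-guillotine property with respect to both $W_1$ and $W_2$. Theorem. For every positive integer $m$ there is an embedded planar graph $G'$ whose edges cover exactly a set $E'\supseteq E$ obtained from $E$ by adding finitely many horizontal and vertical segments, such that $E'$ satisfies the $m$-guillotine property with respect to $B$ and the total length $L'$ of the edges of $G'$ satisfies $$L'\le\Bigl(1+\frac{\sqrt2+16/\pi}{m}\Bigr)L+\frac{16\,\delta}{m}.$$ -/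

import Mathlib

open Set Metric
open scoped ENNReal NNReal

noncomputable section

/-- The Euclidean plane. -/
abbrev Plane : Type := EuclideanSpace ℝ (Fin 2)

/-- A finite planar graph embedded in the plane. Its edges are simple arcs, any two of which meet
at most in common end vertices; no vertex lies in the relative interior of an edge. -/
structure PlaneGraph where
  vertices : Finset Plane
  numEdges : ℕ
  edge : Fin numEdges → C(unitInterval, Plane)
  edge_injective : ∀ e, Function.Injective (edge e)
  source_mem : ∀ e, edge e 0 ∈ vertices
  target_mem : ∀ e, edge e 1 ∈ vertices
  vertex_on_edge : ∀ e t, edge e t ∈ vertices → t = 0 ∨ t = 1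
  edge_inter : ∀ e f, e ≠ f → range (edge e) ∩ range (edge f) ⊆ vertices

namespace PlaneGraph

/-- The set of points of the plane covered by the edges. -/
def edgeSet (G : PlaneGraph) : Set Plane := ⋃ e, range (G.edge e)

/-- The total Euclidean length of the edges; the length of an arc is the supremum of the lengths
of its inscribed polygonal chains. -/
def length (G : PlaneGraph) : ℝ≥0∞ := ∑ e, eVariationOn (G.edge e) univ

/-- The underlying abstract (simple) graph on the vertices. -/
def toSimpleGraph (G : PlaneGraph) : SimpleGraph G.vertices where
  Adj u v := u ≠ v ∧ ∃ e, s(G.edge e 0, G.edge e 1) = s((u : Plane), (v : Plane))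
  symm := ⟨fun _ _ h => ⟨h.1.symm, h.2.imp fun _ he => he.trans Sym2.eq_swap⟩⟩
  loopless := ⟨fun _ h => h.1 rfl⟩

end PlaneGraph

/-- The closed axis-aligned rectangle `[lo 0, hi 0] × [lo 1, hi 1]`. -/
def window (lo hi : Fin 2 → ℝ) : Set Plane := {p | ∀ k, lo k ≤ p k ∧ p k ≤ hi k}

/-- The unit square. -/
def unitSquare : Set Plane := window 0 1

/-- The point with parameter `t` on the axis-parallel line `{p | p i = s}`: its `i`-th coordinate
is `s` and its other coordinate is `t`. -/
def linePoint (i : Fin 2) (s t : ℝ) : Plane := WithLp.toLp 2 fun k => if k = i then s else t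

/-- The intersection of a set with the line `{p | p i = s}`, in the coordinate along the line. -/
def slice (i : Fin 2) (s : ℝ) (A : Set Plane) : Set ℝ := {t | linePoint i s t ∈ A}

/-- The endpoints of the subsegments (possibly single points) that make up the intersection of
the cut `{p | p i = s}` with `E ∩ int W`, where `W = window lo hi`. A subset of the line that is a
finite disjoint union of separated intervals and points has as its frontier in the line exactly
the set of endpoints of these intervals, a single point being its own only endpoint. -/
def cutEndpoints (E : Set Plane) (lo hi : Fin 2 → ℝ) (i : Fin 2) (s : ℝ) : Set ℝ :=
  frontier (slice i s (E ∩ interior (window lo hi)))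

/-- The `m`-span determined by a finite set `P` of endpoints on a line: empty if `P` has at most
`2 (m - 1)` elements, and otherwise the segment from the `m`-th element `a` of `P` from above to
the `m`-th element `b` of `P` from below. -/
def spanOf (m : ℕ) (P : Set ℝ) : Set ℝ :=
  {t | 2 * (m - 1) < P.ncard ∧ ∃ a ∈ P, ∃ b ∈ P,
    (P ∩ Ici a).ncard = m ∧ (P ∩ Iic b).ncard = m ∧ t ∈ Icc b a}

/-- The `m`-span of the cut `{p | p i = s}` with respect to `E` and the window. -/
def mSpan (m : ℕ) (E : Set Plane) (lo hi : Fin 2 → ℝ) (i : Fin 2) (s : ℝ) : Set ℝ :=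
  spanOf m (cutEndpoints E lo hi i s)

/-- The disks (given by their centers) that are met by the cut `{p | p i = s}` in the window. -/
def disksHit (D : Finset Plane) (δ : ℝ) (lo hi : Fin 2 → ℝ) (i : Fin 2) (s : ℝ) : Set Plane :=
  {c | c ∈ D ∧ (slice i s (closedBall c δ ∩ window lo hi)).Nonempty}

/-- The lower endpoint of the chord cut out of the disk with center `c` and radius `δ`. -/
def chordBot (δ : ℝ) (i : Fin 2) (s : ℝ) (c : Plane) : ℝ := sInf (slice i s (closedBall c δ))

/-- The upper endpoint of the chord cut out of the disk with center `c` and radius `δ`. -/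
def chordTop (δ : ℝ) (i : Fin 2) (s : ℝ) (c : Plane) : ℝ := sSup (slice i s (closedBall c δ))

/-- The `m`-disk-span of the cut `{p | p i = s}` with respect to the disks and the window: empty if
the cut meets at most `2 m` of the disks in the window, and otherwise the segment from the lower
endpoint of the chord of the `m`-th disk `a` from above to the upper endpoint of the chord of the
`m`-th disk `b` from below. -/
def mDiskSpan (m : ℕ) (D : Finset Plane) (δ : ℝ) (lo hi : Fin 2 → ℝ) (i : Fin 2) (s : ℝ) :
    Set ℝ :=
  {t | 2 * m < (disksHit D δ lo hi i s).ncard ∧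
    ∃ a ∈ disksHit D δ lo hi i s, ∃ b ∈ disksHit D δ lo hi i s,
      {c ∈ disksHit D δ lo hi i s | chordBot δ i s a ≤ chordBot δ i s c}.ncard = m ∧
      {c ∈ disksHit D δ lo hi i s | chordTop δ i s c ≤ chordTop δ i s b}.ncard = m ∧
      t ∈ Icc (chordTop δ i s b) (chordBot δ i s a)}

/-- The line `{p | p i = s}` is an `m`-good cut with respect to the window: it meets `E` inside the
window in finitely many subsegments, and `E` contains its `m`-span and its `m`-disk-span. -/
def IsGoodCut (m : ℕ) (E : Set Plane) (D : Finset Plane) (δ : ℝ) (lo hi : Fin 2 → ℝ)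
    (i : Fin 2) (s : ℝ) : Prop :=
  (cutEndpoints E lo hi i s).Finite ∧
    linePoint i s '' mSpan m E lo hi i s ⊆ E ∧
    linePoint i s '' mDiskSpan m D δ lo hi i s ⊆ E

/-- `E` satisfies the `m`-guillotine property with respect to `window lo hi` and the disks of
radius `δ` centered at the points of `D`: either the window fully contains no disk, or some
`m`-good cut splits it into two windows for both of which the property holds recursively. -/
inductive IsGuillotine (m : ℕ) (E : Set Plane) (D : Finset Plane) (δ : ℝ) :
    (Fin 2 → ℝ) → (Fin 2 → ℝ) → Prop
  | noDisk (lo hi : Fin 2 → ℝ) (h : ∀ c ∈ D, ¬ closedBall c δ ⊆ window lo hi) :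
      IsGuillotine m E D δ lo hi
  | split (lo hi : Fin 2 → ℝ) (i : Fin 2) (s : ℝ) (hlo : lo i < s) (hhi : s < hi i)
      (hgood : IsGoodCut m E D δ lo hi i s)
      (h₁ : IsGuillotine m E D δ lo (Function.update hi i s))
      (h₂ : IsGuillotine m E D δ (Function.update lo i s) hi) :
      IsGuillotine m E D δ lo hi

end

/-! A point of a cut is dense if, in both directions along the cut, at least `m` points of `E` lie
ahead of it or, when the cut hits more than `2m` disks, at least `m` chords do. The dense points of
a generic cut form a segment (`denseSet_eq_empty_or_Icc`), and adding that segment as a bridge makes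
the cut `m`-good (`exists_bridge`). Everything thus reduces to choosing cuts whose dense parts have
small total length.

The cost of a cut is the length of its dense part; its gain is the length of the set of its points
that are dense on the perpendicular line through them. By Tonelli, the integral of the cost over one
direction equals the integral of the gain over the other (`lintegral_volume_lineDense`). So the cost
cannot exceed the gain for almost all cuts of both directions, and some cut has cost essentially at
most its gain (`exists_cut`).

Gains are paid for by a potential. A line carrying `n` points of `E` and `k` chords gets `n + k - m
- [k > 0]`, truncated at zero. Cutting it at a dense point lowers the total by at least `m`
(`linePotential_cut`), where the term `[k > 0]` makes up for a disk that is hit on both sides of the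
cut. Integrated over all lines, the potential of a window drops by `m` times the gain of the cut
(`windowPotential_cut`), so the bridges cost at most the initial potential divided by `m`, up to an
error discussed below.

The initial potential is at most `√2 L + 4δN - 4δ` for a nonempty family of `N` disks. The first
term bounds the integrated numbers of intersections of `E` with vertical and horizontal lines,
through the variation of the coordinates along the edges (`sum_lintegral_encard_slice_le`). The
second comes from the shadows of length `2δ` of the disks in both directions. The saving `4δ` is the
term `[k > 0]` on the lines through one fixed disk. Since the disks lie in the `2δ`-neighborhood of
the connected set `E`, whose area is at most `4πδ² + 4δL`, `4δN ≤ 16 L / π + 16 δ`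
(`card_disks_le`).

For the recursion to be finite, cuts are chosen more than `η` away from the sides of the window. The
price is that the cost may exceed the gain by a constant when the cut lies in the middle half of the
window. This excess is covered by the drop of `ε` times the squared area (`windowArea_sq_cut`). Its
total is at most `ε = 4δ / m`, which is exactly what the saving `4δ` pays for.

All potentials refer to the original `E`: bridges lie on cuts, hence never in the interior of a
later window, and cuts avoid the null set of lines that meet `E` in infinitely many points. -/

noncomputable section

/-! ### Surgery on plane graphs: subdividing edges and adding segments. -/

namespace PlaneGraph

/-- A plane graph with edges indexed by an arbitrary finite type. -/
theorem exists_ofFintype {ι : Type} [Fintype ι] (V : Finset Plane) (γ : ι → C(unitInterval, Plane))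
    (hinj : ∀ e, Function.Injective (γ e)) (h0 : ∀ e, γ e 0 ∈ V) (h1 : ∀ e, γ e 1 ∈ V)
    (hv : ∀ e t, γ e t ∈ V → t = 0 ∨ t = 1)
    (hi : ∀ e f, e ≠ f → range (γ e) ∩ range (γ f) ⊆ V) :
    ∃ G : PlaneGraph, G.vertices = V ∧ G.edgeSet = ⋃ e, range (γ e) ∧
      G.length = ∑ e, eVariationOn (γ e) univ := by
  let φ := (Fintype.equivFin ι).symm
  refine ⟨⟨V, Fintype.card ι, fun k => γ (φ k), fun k => hinj _, fun k => h0 _, fun k => h1 _,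
    fun k => hv _, fun k l hkl => hi _ _ (fun h => hkl (φ.injective h))⟩, rfl, ?_, ?_⟩
  · exact φ.surjective.iUnion_comp (fun e => range (γ e))
  · exact Equiv.sum_comp φ (fun e => eVariationOn (γ e) univ)

/-- Adding an isolated vertex. -/
theorem exists_insert_isolated (G : PlaneGraph) (x : Plane) (hx : x ∉ G.edgeSet) :
    ∃ G' : PlaneGraph, G'.vertices = insert x G.vertices ∧ G'.edgeSet = G.edgeSet ∧
      G'.length = G.length := by
  classical
  have hne : ∀ e t, G.edge e t ≠ x := fun e t h => hx (mem_iUnion.2 ⟨e, t, h⟩)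
  obtain ⟨G', h1, h2, h3⟩ := exists_ofFintype (insert x G.vertices) G.edge G.edge_injective
    (fun e => Finset.mem_insert_of_mem (G.source_mem e))
    (fun e => Finset.mem_insert_of_mem (G.target_mem e))
    (fun e t h => G.vertex_on_edge e t ((Finset.mem_insert.1 h).resolve_left (hne e t)))
    (fun e f hef => (G.edge_inter e f hef).trans (by simp))
  exact ⟨G', h1, h2, h3⟩

/-- Lower part of an arc. -/
def lowerArc (γ : C(unitInterval, Plane)) (t : unitInterval) : C(unitInterval, Plane) :=
  ⟨fun u => γ (u * t), by fun_prop⟩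

/-- Upper part of an arc. -/
def upperArc (γ : C(unitInterval, Plane)) (t : unitInterval) : C(unitInterval, Plane) :=
  ⟨fun u => γ (unitInterval.symm (unitInterval.symm u * unitInterval.symm t)), by fun_prop⟩

theorem range_lowerArc (γ : C(unitInterval, Plane)) (t : unitInterval) (ht : 0 < t) :
    range (lowerArc γ t) = γ '' Iic t := by
  have ht' : (0 : ℝ) < t := ht
  ext x
  constructor
  · rintro ⟨u, rfl⟩
    exact ⟨u * t, unitInterval.mul_le_right, rfl⟩
  · rintro ⟨v, hv, rfl⟩
    have hv' : (v : ℝ) ≤ t := hv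
    refine ⟨⟨v / t, div_nonneg v.2.1 ht'.le, (div_le_one ht').2 hv'⟩, ?_⟩
    change γ _ = γ v
    congr 1
    ext
    simp [ht'.ne']

theorem range_upperArc (γ : C(unitInterval, Plane)) (t : unitInterval) (ht : t < 1) :
    range (upperArc γ t) = γ '' Ici t := by
  have ht' : (0 : ℝ) < 1 - t := sub_pos.2 ht
  ext x
  constructor
  · rintro ⟨u, rfl⟩
    refine ⟨_, ?_, rfl⟩
    change (t : ℝ) ≤ 1 - (1 - u) * (1 - t)
    nlinarith [u.2.1, ht']
  · rintro ⟨v, hv, rfl⟩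
    have hv' : (t : ℝ) ≤ v := hv
    refine ⟨unitInterval.symm ⟨(1 - v) / (1 - t), div_nonneg (by linarith [v.2.2]) ht'.le,
      (div_le_one ht').2 (by linarith)⟩, ?_⟩
    change γ _ = γ v
    congr 1
    ext
    simp [ht'.ne']

theorem eVariationOn_lowerArc_add_upperArc (γ : C(unitInterval, Plane)) (t : unitInterval) :
    eVariationOn (lowerArc γ t) univ + eVariationOn (upperArc γ t) univ ≤ eVariationOn γ univ := by
  have h1 : eVariationOn (lowerArc γ t) univ ≤ eVariationOn γ (Iic t) := by
    refine eVariationOn.comp_le_of_monotoneOn γ (fun u => u * t) ?_ ?_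
    · intro u _ v _ huv
      exact mul_le_mul_left huv t
    · exact fun u _ => unitInterval.mul_le_right
  have h2 : eVariationOn (upperArc γ t) univ ≤ eVariationOn γ (Ici t) := by
    refine eVariationOn.comp_le_of_monotoneOn γ
      (fun u => unitInterval.symm (unitInterval.symm u * unitInterval.symm t)) ?_ ?_
    · intro u _ v _ huv
      have huv' : (u : ℝ) ≤ v := huv
      change (1 - (1 - u) * (1 - t) : ℝ) ≤ 1 - (1 - v) * (1 - t)
      nlinarith [t.2.2]
    · intro u _
      change (t : ℝ) ≤ 1 - (1 - u) * (1 - t)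
      nlinarith [u.2.1, t.2.2]
  calc _ ≤ eVariationOn γ (Iic t) + eVariationOn γ (Ici t) := add_le_add h1 h2
    _ ≤ eVariationOn γ (Iic t ∪ Ici t) := eVariationOn.add_le_union _ fun x hx y hy => hx.trans hy
    _ ≤ _ := eVariationOn.mono _ (subset_univ _)

theorem lowerArc_injective {γ : C(unitInterval, Plane)} (hγ : Function.Injective γ)
    {t : unitInterval} (ht : 0 < t) : Function.Injective (lowerArc γ t) := by
  intro u v huv
  have h : u * t = v * t := hγ huv
  have h' : (u : ℝ) * t = v * t := congrArg Subtype.val h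
  have ht' : (0 : ℝ) < t := ht
  exact Subtype.ext (mul_right_cancel₀ ht'.ne' h')

theorem upperArc_injective {γ : C(unitInterval, Plane)} (hγ : Function.Injective γ)
    {t : unitInterval} (ht : t < 1) : Function.Injective (upperArc γ t) := by
  intro u v huv
  have h := hγ huv
  have h' : (1 : ℝ) - (1 - u) * (1 - t) = 1 - (1 - v) * (1 - t) := congrArg Subtype.val h
  have ht' : (0 : ℝ) < 1 - t := sub_pos.2 ht
  have h3 : (1 - u : ℝ) = 1 - v := mul_right_cancel₀ ht'.ne' (sub_right_injective h')
  exact Subtype.ext (sub_right_injective h3)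

/-- Subdividing an edge. -/
theorem exists_subdivide (G : PlaneGraph) (x : Plane) (hx : x ∈ G.edgeSet) :
    ∃ G' : PlaneGraph, G'.vertices = insert x G.vertices ∧ G'.edgeSet = G.edgeSet ∧
      G'.length ≤ G.length := by
  classical
  by_cases hxv : x ∈ G.vertices
  · exact ⟨G, (Finset.insert_eq_of_mem hxv).symm, rfl, le_rfl⟩
  obtain ⟨e, t, rfl⟩ := mem_iUnion.1 hx
  have ht0 : 0 < t := by
    refine lt_of_le_of_ne unitInterval.nonneg' fun h => hxv ?_
    rw [← h]; exact G.source_mem e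
  have ht1 : t < 1 := by
    refine lt_of_le_of_ne unitInterval.le_one' fun h => hxv ?_
    rw [h]; exact G.target_mem e
  set x := G.edge e t with hxdef
  have hother : ∀ f u, G.edge f u = x → f = e := by
    intro f u hu
    by_contra hfe
    exact hxv (G.edge_inter f e hfe ⟨⟨u, hu⟩, ⟨t, rfl⟩⟩)
  let γ : Option (Fin G.numEdges) → C(unitInterval, Plane) := fun o =>
    o.elim (upperArc (G.edge e) t) (fun f => if f = e then lowerArc (G.edge e) t else G.edge f)
  have hγe : γ (some e) = lowerArc (G.edge e) t := if_pos rfl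
  have hγf : ∀ f, f ≠ e → γ (some f) = G.edge f := fun f hf => if_neg hf
  have hγn : γ none = upperArc (G.edge e) t := rfl
  have hrl := range_lowerArc (G.edge e) t ht0
  have hru := range_upperArc (G.edge e) t ht1
  have hl0 : lowerArc (G.edge e) t 0 = G.edge e 0 := by simp [lowerArc]
  have hl1 : lowerArc (G.edge e) t 1 = x := by simp [lowerArc, hxdef]
  have hu0 : upperArc (G.edge e) t 0 = x := by simp [upperArc, hxdef]
  have hu1 : upperArc (G.edge e) t 1 = G.edge e 1 := by simp [upperArc]
  have hmem : ∀ {y}, y ∈ G.vertices → y ∈ insert x G.vertices := Finset.mem_insert_of_mem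
  have hsub : ∀ o, ∃ f, range (γ o) ⊆ range (G.edge f) ∧ (o = none → f = e) ∧
      (∀ g, o = some g → f = g) := by
    rintro (_ | f)
    · refine ⟨e, ?_, fun _ => rfl, fun g hg => by simp at hg⟩
      rw [hγn, hru]; exact image_subset_range _ _
    · refine ⟨f, ?_, fun h => by simp at h, fun g hg => by simpa using hg⟩
      by_cases hf : f = e
      · subst hf
        rw [hγe, hrl]; exact image_subset_range _ _
      · rw [hγf f hf]
  obtain ⟨G', h1, h2, h3⟩ := exists_ofFintype (insert x G.vertices) γ
    (by
      rintro (_ | f)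
      · exact upperArc_injective (G.edge_injective e) ht1
      · by_cases hf : f = e
        · subst hf; rw [hγe]; exact lowerArc_injective (G.edge_injective _) ht0
        · rw [hγf f hf]; exact G.edge_injective f)
    (by
      rintro (_ | f)
      · rw [hγn, hu0]; exact Finset.mem_insert_self _ _
      · by_cases hf : f = e
        · subst hf; rw [hγe, hl0]; exact hmem (G.source_mem _)
        · rw [hγf f hf]; exact hmem (G.source_mem f))
    (by
      rintro (_ | f)
      · rw [hγn, hu1]; exact hmem (G.target_mem _)
      · by_cases hf : f = e
        · subst hf; rw [hγe, hl1]; exact Finset.mem_insert_self _ _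
        · rw [hγf f hf]; exact hmem (G.target_mem f))
    (by
      rintro (_ | f) u hu
      · rw [hγn] at hu
        rcases Finset.mem_insert.1 hu with h | h
        · exact Or.inl (upperArc_injective (G.edge_injective e) ht1 (h.trans hu0.symm))
        · rcases G.vertex_on_edge e _ h with h' | h'
          · exfalso
            have h'' : (1 : ℝ) - (1 - u) * (1 - t) = 0 := congrArg Subtype.val h'
            have : (0 : ℝ) < t := ht0
            nlinarith [u.2.1, t.2.2]
          · right
            exact upperArc_injective (G.edge_injective e) ht1
              (hu1.symm ▸ congrArg (G.edge e) h')
      · by_cases hf : f = e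
        · subst hf
          rw [hγe] at hu
          rcases Finset.mem_insert.1 hu with h | h
          · exact Or.inr (lowerArc_injective (G.edge_injective _) ht0 (h.trans hl1.symm))
          · rcases G.vertex_on_edge _ _ h with h' | h'
            · left
              exact lowerArc_injective (G.edge_injective _) ht0
                (hl0.symm ▸ congrArg (G.edge _) h')
            · exfalso
              have h'' : (u : ℝ) * t = 1 := congrArg Subtype.val h'
              have : (t : ℝ) < 1 := ht1
              nlinarith [u.2.1, u.2.2, t.2.1]
        · rw [hγf f hf] at hu
          rcases Finset.mem_insert.1 hu with h | h
          · exact absurd (hother f u h) hf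
          · exact G.vertex_on_edge f u h)
    (by
      have key : ∀ z, z ∈ range (upperArc (G.edge e) t) → z ∈ range (lowerArc (G.edge e) t) →
          z ∈ insert x G.vertices := by
        intro z hz1 hz2
        rw [hru] at hz1
        rw [hrl] at hz2
        obtain ⟨u, hu, rfl⟩ := hz1
        obtain ⟨v, hv, hvu⟩ := hz2
        have : v = u := G.edge_injective e hvu
        subst this
        have : v = t := le_antisymm hv hu
        subst this
        exact Finset.mem_insert_self _ _
      rintro (_ | f) (_ | g) hne z ⟨hz1, hz2⟩
      · exact absurd rfl hne
      · by_cases hg : g = e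
        · subst hg; rw [hγe] at hz2; exact key z hz1 hz2
        · obtain ⟨f', hf', hf'', -⟩ := hsub none
          rw [hf'' rfl] at hf'
          rw [hγf g hg] at hz2
          exact hmem (G.edge_inter e g (Ne.symm hg) ⟨hf' hz1, hz2⟩)
      · by_cases hg : f = e
        · subst hg; rw [hγe] at hz1; exact key z hz2 hz1
        · obtain ⟨f', hf', hf'', -⟩ := hsub none
          rw [hf'' rfl] at hf'
          rw [hγf f hg] at hz1
          exact hmem (G.edge_inter e f (Ne.symm hg) ⟨hf' hz2, hz1⟩)
      · have hfg : f ≠ g := fun h => hne (by rw [h])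
        obtain ⟨f', hf', -, hf''⟩ := hsub (some f)
        obtain ⟨g', hg', -, hg''⟩ := hsub (some g)
        rw [hf'' f rfl] at hf'
        rw [hg'' g rfl] at hg'
        exact hmem (G.edge_inter f g hfg ⟨hf' hz1, hg' hz2⟩))
  refine ⟨G', h1, ?_, ?_⟩
  · rw [h2]
    apply subset_antisymm
    · refine iUnion_subset fun o => ?_
      obtain ⟨f, hf, -⟩ := hsub o
      exact hf.trans (subset_iUnion (fun f => range (G.edge f)) f)
    · refine iUnion_subset fun f => ?_
      by_cases hf : f = e
      · subst hf
        rintro _ ⟨u, rfl⟩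
        rcases le_total u t with h | h
        · refine mem_iUnion.2 ⟨some f, ?_⟩
          rw [hγe, hrl]; exact ⟨u, h, rfl⟩
        · refine mem_iUnion.2 ⟨none, ?_⟩
          rw [hγn, hru]; exact ⟨u, h, rfl⟩
      · rw [← hγf f hf]
        exact subset_iUnion (fun o => range (γ o)) (some f)
  · rw [h3, Fintype.sum_option, hγn, length, ← Finset.add_sum_erase _ _ (Finset.mem_univ e),
      ← Finset.add_sum_erase _ _ (Finset.mem_univ e), hγe, ← add_assoc]
    refine add_le_add ?_ (le_of_eq ?_)
    · rw [add_comm]; exact eVariationOn_lowerArc_add_upperArc _ _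
    · refine Finset.sum_congr rfl fun f hf => ?_
      rw [hγf f (Finset.ne_of_mem_erase hf)]

/-- Any point can be made a vertex. -/
theorem exists_insert_vertex (G : PlaneGraph) (x : Plane) :
    ∃ G' : PlaneGraph, G'.vertices = insert x G.vertices ∧ G'.edgeSet = G.edgeSet ∧
      G'.length ≤ G.length := by
  by_cases hx : x ∈ G.edgeSet
  · exact G.exists_subdivide x hx
  · obtain ⟨G', h1, h2, h3⟩ := G.exists_insert_isolated x hx
    exact ⟨G', h1, h2, h3.le⟩

/-- The segment from `p` to `q` as an arc. -/
def segmentArc (p q : Plane) : C(unitInterval, Plane) :=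
  ⟨fun u => AffineMap.lineMap p q (u : ℝ), by fun_prop⟩

theorem range_segmentArc (p q : Plane) : range (segmentArc p q) = segment ℝ p q := by
  rw [segment_eq_image_lineMap]
  ext x
  constructor
  · rintro ⟨u, rfl⟩; exact ⟨u, u.2, rfl⟩
  · rintro ⟨u, hu, rfl⟩; exact ⟨⟨u, hu⟩, rfl⟩

theorem segmentArc_injective {p q : Plane} (h : p ≠ q) : Function.Injective (segmentArc p q) :=
  fun _ _ huv => Subtype.ext (AffineMap.lineMap_injective ℝ h huv)

theorem eVariationOn_segmentArc_le (p q : Plane) :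
    eVariationOn (segmentArc p q) univ ≤ edist p q := by
  have hL : LipschitzWith (nndist p q) (fun u : ℝ => AffineMap.lineMap p q u) :=
    (lipschitzWith_lineMap p q)
  have h1 : eVariationOn (segmentArc p q) univ ≤
      eVariationOn (fun u : ℝ => (AffineMap.lineMap p q u : Plane)) (Icc 0 1) := by
    refine eVariationOn.comp_le_of_monotoneOn (fun u : ℝ => (AffineMap.lineMap p q u : Plane))
      (fun u : unitInterval => (u : ℝ)) ?_ ?_
    · exact fun u _ v _ h => h
    · exact fun u _ => u.2
  refine h1.trans ?_
  have h2 := LipschitzOnWith.comp_eVariationOn_le (f := fun u : ℝ => (AffineMap.lineMap p q u : Plane))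
    (t := univ) (C := nndist p q) hL.lipschitzOnWith (g := id) (s := Icc (0 : ℝ) 1)
    (fun _ _ => mem_univ _)
  refine h2.trans ?_
  have h3 : eVariationOn (id : ℝ → ℝ) (Icc 0 1) ≤ 1 := by
    have h := (monotone_id.monotoneOn (univ : Set ℝ)).eVariationOn_eq (mem_univ 0) (mem_univ 1)
    rw [univ_inter] at h
    rw [h]; simp
  calc _ ≤ (nndist p q : ℝ≥0∞) * 1 := by gcongr
    _ = edist p q := by rw [mul_one, edist_nndist]

theorem openSegment_eq_segmentArc_image (p q : Plane) :
    openSegment ℝ p q = segmentArc p q '' Ioo 0 1 := by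
  rw [openSegment_eq_image_lineMap]
  ext x
  constructor
  · rintro ⟨u, hu, rfl⟩; exact ⟨⟨u, hu.1.le, hu.2.le⟩, ⟨hu.1, hu.2⟩, rfl⟩
  · rintro ⟨u, hu, rfl⟩; exact ⟨u, ⟨hu.1, hu.2⟩, rfl⟩

/-- Adding a segment between two vertices as an edge. -/
theorem exists_addEdge (G : PlaneGraph) {p q : Plane} (hpq : p ≠ q) (hp : p ∈ G.vertices)
    (hq : q ∈ G.vertices) (hd : Disjoint (openSegment ℝ p q) (G.edgeSet ∪ G.vertices)) :
    ∃ G' : PlaneGraph, G'.vertices = G.vertices ∧ G'.edgeSet = G.edgeSet ∪ segment ℝ p q ∧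
      G'.length ≤ G.length + edist p q := by
  have hs0 : segmentArc p q 0 = p := by simp [segmentArc]
  have hs1 : segmentArc p q 1 = q := by simp [segmentArc]
  have hmid : ∀ u, segmentArc p q u ∈ G.edgeSet ∪ (G.vertices : Set Plane) → u = 0 ∨ u = 1 := by
    intro u hu
    by_contra! h
    refine disjoint_left.1 hd ?_ hu
    rw [openSegment_eq_segmentArc_image]
    exact ⟨u, ⟨unitInterval.pos_iff_ne_zero.2 h.1, unitInterval.lt_one_iff_ne_one.2 h.2⟩, rfl⟩
  have hcross : ∀ f z, z ∈ range (segmentArc p q) → z ∈ range (G.edge f) → z ∈ G.vertices := by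
    rintro f _ ⟨u, rfl⟩ hz
    rcases hmid u (Or.inl (mem_iUnion.2 ⟨f, hz⟩)) with rfl | rfl
    · rwa [hs0]
    · rwa [hs1]
  let γ : Option (Fin G.numEdges) → C(unitInterval, Plane) := fun o =>
    o.elim (segmentArc p q) G.edge
  obtain ⟨G', h1, h2, h3⟩ := exists_ofFintype G.vertices γ
    (by
      rintro (_ | f)
      · exact segmentArc_injective hpq
      · exact G.edge_injective f)
    (by
      rintro (_ | f)
      · change segmentArc p q 0 ∈ _; rwa [hs0]
      · exact G.source_mem f)
    (by
      rintro (_ | f)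
      · change segmentArc p q 1 ∈ _; rwa [hs1]
      · exact G.target_mem f)
    (by
      rintro (_ | f) u hu
      · exact hmid u (Or.inr hu)
      · exact G.vertex_on_edge f u hu)
    (by
      rintro (_ | f) (_ | g) hne z ⟨hz1, hz2⟩
      · exact absurd rfl hne
      · exact hcross g z hz1 hz2
      · exact hcross f z hz2 hz1
      · exact G.edge_inter f g (fun h => hne (by rw [h])) ⟨hz1, hz2⟩)
  refine ⟨G', h1, ?_, ?_⟩
  · rw [h2, iUnion_option, union_comm]
    change _ ∪ range (segmentArc p q) = _
    rw [range_segmentArc]; rfl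
  · rw [h3, Fintype.sum_option, add_comm]
    exact add_le_add le_rfl (eVariationOn_segmentArc_le p q)

/-- Induction on the number of points in which the open segment meets edges or vertices: the segment
is split at one such point and its two parts are added in turn. The control of the new vertices
ensures that adding the first part creates no new obstruction on the second. -/
theorem exists_addSegment_aux (n : ℕ) : ∀ (G : PlaneGraph) (p q : Plane), p ≠ q →
    (openSegment ℝ p q ∩ (G.edgeSet ∪ G.vertices)).Finite →
    (openSegment ℝ p q ∩ (G.edgeSet ∪ G.vertices)).ncard ≤ n →
    ∃ G' : PlaneGraph, (G'.vertices : Set Plane) ⊆ G.vertices ∪ segment ℝ p q ∧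
      G'.edgeSet = G.edgeSet ∪ segment ℝ p q ∧ G'.length ≤ G.length + edist p q := by
  classical
  induction n with
  | zero =>
    intro G p q hpq hfin hcard
    have hemp := (ncard_eq_zero hfin).1 (Nat.le_zero.1 hcard)
    obtain ⟨G₁, hv₁, he₁, hl₁⟩ := G.exists_insert_vertex p
    obtain ⟨G₂, hv₂, he₂, hl₂⟩ := G₁.exists_insert_vertex q
    have hpo : p ∉ openSegment ℝ p q := fun h => hpq (left_mem_openSegment_iff.1 h)
    have hqo : q ∉ openSegment ℝ p q := fun h => hpq (right_mem_openSegment_iff.1 h)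
    obtain ⟨G₃, hv₃, he₃, hl₃⟩ := G₂.exists_addEdge hpq (by simp [hv₂, hv₁]) (by simp [hv₂])
      (by
        rw [disjoint_left]
        intro z hz hz'
        rw [he₂, he₁, hv₂, hv₁] at hz'
        rcases hz' with h | h
        · exact (hemp.subset ⟨hz, Or.inl h⟩).elim
        · simp only [Finset.coe_insert, mem_insert_iff, Finset.mem_coe] at h
          rcases h with rfl | rfl | h
          · exact hqo hz
          · exact hpo hz
          · exact (hemp.subset ⟨hz, Or.inr h⟩).elim)
    refine ⟨G₃, ?_, by rw [he₃, he₂, he₁], hl₃.trans (by gcongr; exact hl₂.trans hl₁)⟩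
    rw [hv₃, hv₂, hv₁]
    intro z hz
    simp only [Finset.coe_insert, mem_insert_iff, Finset.mem_coe] at hz
    rcases hz with rfl | rfl | h
    · exact Or.inr (right_mem_segment ℝ _ _)
    · exact Or.inr (left_mem_segment ℝ _ _)
    · exact Or.inl h
  | succ n ih =>
    intro G p q hpq hfin hcard
    by_cases hemp : (openSegment ℝ p q ∩ (G.edgeSet ∪ G.vertices)).ncard ≤ n
    · exact ih G p q hpq hfin hemp
    obtain ⟨r, hr, hrX⟩ : (openSegment ℝ p q ∩ (G.edgeSet ∪ G.vertices)).Nonempty := by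
      apply nonempty_of_ncard_ne_zero; omega
    have hr' := openSegment_subset_segment ℝ p q hr
    have hrp : p ≠ r := by
      rintro rfl; exact hpq (left_mem_openSegment_iff.1 hr)
    have hrq : r ≠ q := by
      rintro rfl; exact hpq (right_mem_openSegment_iff.1 hr)
    have hc : openSegment ℝ p r ⊆ openSegment ℝ p q ∧ openSegment ℝ r q ⊆ openSegment ℝ p q ∧
        segment ℝ p r ∪ segment ℝ r q = segment ℝ p q ∧
        Disjoint (openSegment ℝ r q) (segment ℝ p r) ∧ edist p r + edist r q = edist p q := by
      obtain ⟨t, ht, rfl⟩ := (openSegment_eq_image_lineMap ℝ p q).subset hr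
      have ht1 : (0 : ℝ) < 1 - t := sub_pos.2 ht.2
      have e1 : ∀ s : ℝ, AffineMap.lineMap p (AffineMap.lineMap p q t : Plane) s
          = (AffineMap.lineMap p q (s * t) : Plane) := by
        intro s; simp [AffineMap.lineMap_apply, smul_smul]
      have e2 : ∀ s : ℝ, AffineMap.lineMap (AffineMap.lineMap p q t : Plane) q s
          = (AffineMap.lineMap p q (t + s * (1 - t)) : Plane) := by
        intro s
        simp only [AffineMap.lineMap_apply_module]
        module
      have hinj := AffineMap.lineMap_injective ℝ hpq
      refine ⟨?_, ?_, ?_, ?_, ?_⟩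
      · rw [openSegment_eq_image_lineMap, openSegment_eq_image_lineMap]
        rintro _ ⟨s, hs, rfl⟩
        exact ⟨s * t, ⟨mul_pos hs.1 ht.1, by nlinarith [hs.1, hs.2, ht.1, ht.2]⟩, (e1 s).symm⟩
      · rw [openSegment_eq_image_lineMap, openSegment_eq_image_lineMap]
        rintro _ ⟨s, hs, rfl⟩
        exact ⟨_, ⟨by nlinarith [hs.1, hs.2, ht.1, ht.2], by nlinarith [hs.1, hs.2, ht.1, ht.2]⟩,
          (e2 s).symm⟩
      · apply subset_antisymm
        · exact union_subset ((convex_segment p q).segment_subset (left_mem_segment ℝ _ _) hr')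
            ((convex_segment p q).segment_subset hr' (right_mem_segment ℝ _ _))
        · rw [segment_eq_image_lineMap, segment_eq_image_lineMap, segment_eq_image_lineMap]
          rintro _ ⟨s, hs, rfl⟩
          rcases le_total s t with h | h
          · left
            refine ⟨s / t, ⟨div_nonneg hs.1 ht.1.le, (div_le_one ht.1).2 h⟩, ?_⟩
            rw [e1, div_mul_cancel₀ _ ht.1.ne']
          · right
            refine ⟨(s - t) / (1 - t), ⟨div_nonneg (by linarith) ht1.le,
              (div_le_one ht1).2 (by linarith [hs.2])⟩, ?_⟩
            rw [e2, div_mul_cancel₀ _ ht1.ne']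
            congr 1; ring
      · rw [disjoint_left, segment_eq_image_lineMap, openSegment_eq_image_lineMap]
        rintro _ ⟨s, hs, rfl⟩ ⟨s', hs', h⟩
        rw [e1, e2] at h
        have := hinj h
        nlinarith [hs.1, hs'.2, ht.1]
      · simp only [edist_dist]
        rw [← ENNReal.ofReal_add dist_nonneg dist_nonneg]
        congr 1
        rw [dist_left_lineMap, dist_lineMap_right, Real.norm_of_nonneg ht.1.le,
          Real.norm_of_nonneg ht1.le]
        ring
    obtain ⟨ho1, ho2, hun, hdj, hlen⟩ := hc
    -- The splitting point `r` lies in neither open half, so each half has fewer obstructions.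
    have hcnt : ∀ T ⊆ openSegment ℝ p q ∩ (G.edgeSet ∪ G.vertices), r ∉ T → T.ncard ≤ n := by
      intro T hT hrT
      have : T.ncard < (openSegment ℝ p q ∩ (G.edgeSet ∪ G.vertices)).ncard :=
        ncard_lt_ncard ⟨hT, fun h => hrT (h ⟨hr, hrX⟩)⟩ hfin
      omega
    obtain ⟨G₁, hv₁, he₁, hl₁⟩ := ih G p r hrp (hfin.subset (inter_subset_inter_left _ ho1))
      (hcnt _ (inter_subset_inter_left _ ho1)
        fun h => hrp (right_mem_openSegment_iff.1 h.1))
    have hX : openSegment ℝ r q ∩ (G₁.edgeSet ∪ G₁.vertices) ⊆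
        openSegment ℝ r q ∩ (G.edgeSet ∪ G.vertices) := by
      rintro z ⟨hz, hz'⟩
      have hzs := disjoint_left.1 hdj hz
      refine ⟨hz, ?_⟩
      rcases hz' with h | h
      · rw [he₁] at h
        exact Or.inl (h.resolve_right hzs)
      · exact Or.inr ((hv₁ h).resolve_right hzs)
    have hX' := hX.trans (inter_subset_inter_left _ ho2)
    obtain ⟨G₂, hv₂, he₂, hl₂⟩ := ih G₁ r q hrq (hfin.subset hX')
      (hcnt _ hX' fun h => hrq (left_mem_openSegment_iff.1 h.1))
    refine ⟨G₂, ?_, ?_, ?_⟩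
    · rw [← hun, ← union_assoc]
      exact hv₂.trans (union_subset_union_left _ hv₁)
    · rw [he₂, he₁, union_assoc, hun]
    · rw [← hlen, ← add_assoc]
      exact hl₂.trans (by gcongr)

/-- Adding a segment that meets the edges in finitely many points. -/
theorem exists_addSegment (G : PlaneGraph) {p q : Plane} (hpq : p ≠ q)
    (hfin : (segment ℝ p q ∩ G.edgeSet).Finite) :
    ∃ G' : PlaneGraph, G'.edgeSet = G.edgeSet ∪ segment ℝ p q ∧
      G'.length ≤ G.length + edist p q := by
  have hfin' : (openSegment ℝ p q ∩ (G.edgeSet ∪ G.vertices)).Finite := by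
    rw [inter_union_distrib_left]
    exact (hfin.subset (inter_subset_inter_left _ (openSegment_subset_segment ℝ p q))).union
      (G.vertices.finite_toSet.subset inter_subset_right)
  obtain ⟨G', -, h2, h3⟩ := exists_addSegment_aux _ G p q hpq hfin' le_rfl
  exact ⟨G', h2, h3⟩

theorem exists_addSegments (G : PlaneGraph) (S : List (Plane × Plane))
    (hne : ∀ e ∈ S, e.1 ≠ e.2) (hfin : ∀ e ∈ S, (segment ℝ e.1 e.2 ∩ G.edgeSet).Finite)
    (hpw : S.Pairwise fun e f => Disjoint (segment ℝ e.1 e.2) (segment ℝ f.1 f.2)) :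
    ∃ G' : PlaneGraph, G'.edgeSet = G.edgeSet ∪ ⋃ e ∈ S, segment ℝ e.1 e.2 ∧
      G'.length ≤ G.length + (S.map fun e => edist e.1 e.2).sum := by
  induction S with
  | nil => exact ⟨G, by simp, by simp⟩
  | cons e S ih =>
    rw [List.pairwise_cons] at hpw
    obtain ⟨G₁, he₁, hl₁⟩ := ih (fun f hf => hne f (List.mem_cons_of_mem _ hf))
      (fun f hf => hfin f (List.mem_cons_of_mem _ hf)) hpw.2
    obtain ⟨G₂, he₂, hl₂⟩ := G₁.exists_addSegment (hne e List.mem_cons_self) (by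
      refine (hfin e List.mem_cons_self).subset ?_
      rintro z ⟨hz, hz'⟩
      rw [he₁] at hz'
      refine ⟨hz, hz'.resolve_right fun h => ?_⟩
      simp only [mem_iUnion] at h
      obtain ⟨f, hf, hzf⟩ := h
      exact disjoint_left.1 (hpw.1 f hf) hz hzf)
    refine ⟨G₂, ?_, ?_⟩
    · rw [he₂, he₁]
      ext z
      simp only [mem_union, mem_iUnion, List.mem_cons, exists_prop]
      constructor
      · rintro ((h | ⟨f, hf, h⟩) | h)
        · exact Or.inl h
        · exact Or.inr ⟨f, Or.inr hf, h⟩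
        · exact Or.inr ⟨e, Or.inl rfl, h⟩
      · rintro (h | ⟨f, rfl | hf, h⟩)
        · exact Or.inl (Or.inl h)
        · exact Or.inr h
        · exact Or.inl (Or.inr ⟨f, hf, h⟩)
    · rw [List.map_cons, List.sum_cons, add_comm (edist e.1 e.2), ← add_assoc]
      exact hl₂.trans (by gcongr)

end PlaneGraph

/-! ### Counting intersections with axis-parallel lines. -/

open MeasureTheory Filter Topology

/-- The dyadic floor of order `n`. -/
def dyadicFloor (n : ℕ) (t : ℝ) : ℤ := ⌊(2 : ℝ) ^ n * t⌋

theorem dyadicFloor_eq_iff (n : ℕ) (t : ℝ) (k : ℤ) :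
    dyadicFloor n t = k ↔ (k : ℝ) / 2 ^ n ≤ t ∧ t < (k + 1) / 2 ^ n := by
  have h : (0 : ℝ) < 2 ^ n := by positivity
  rw [dyadicFloor, Int.floor_eq_iff, div_le_iff₀ h, lt_div_iff₀ h, mul_comm t]

theorem eventually_injOn_dyadicFloor {T : Set ℝ} (hT : T.Finite) :
    ∀ᶠ n in atTop, InjOn (dyadicFloor n) T := by
  have h : ∀ᶠ n : ℕ in atTop, ∀ x ∈ T, ∀ y ∈ T, x ≠ y → 1 ≤ (2 : ℝ) ^ n * |x - y| := by
    rw [eventually_all_finite hT]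
    intro x _
    rw [eventually_all_finite hT]
    intro y _
    by_cases hxy : x = y
    · exact Eventually.of_forall fun n h => absurd hxy h
    · have hpos : 0 < |x - y| := abs_pos.2 (sub_ne_zero.2 hxy)
      have := (tendsto_pow_atTop_atTop_of_one_lt (one_lt_two : (1 : ℝ) < 2)).atTop_mul_const hpos
      filter_upwards [this.eventually_ge_atTop 1] with n hn _ using hn
  filter_upwards [h] with n hn x hx y hy hxy
  by_contra hne
  have h1 := hn x hx y hy hne
  have h2 := Int.abs_sub_lt_one_of_floor_eq_floor hxy
  rw [← mul_sub, abs_mul, abs_of_pos (by positivity)] at h2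
  linarith

/-- Fine dyadic cells separate any finite subset. This expresses a cardinality through the events
that a given cell is met, which is how measurability of counting functions is obtained. -/
theorem encard_eq_iSup_dyadicFloor (S : Set ℝ) :
    S.encard = ⨆ n, (dyadicFloor n '' S).encard := by
  apply le_antisymm
  · refine ENat.forall_natCast_le_iff_le.1 fun j hj => ?_
    obtain ⟨T, hTS, hTj⟩ := exists_subset_encard_eq hj
    have hT : T.Finite := finite_of_encard_eq_coe hTj
    obtain ⟨n, hn⟩ := (eventually_injOn_dyadicFloor hT).exists
    refine le_iSup_of_le n ?_
    rw [← hTj, ← hn.encard_image]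
    exact encard_le_encard (image_mono hTS)
  · exact iSup_le fun n => encard_image_le _ _

/-- One half of Banach's indicatrix theorem. The number of dyadic cells whose image contains `s`
eventually bounds any finite part of the fiber from above. Its integral is the total length of the
images of the cells, each at most the variation on the cell. Fatou's lemma passes to the limit. -/
theorem lintegral_encard_fiber_le (f : ℝ → ℝ) (hf : ContinuousOn f (Icc 0 1)) :
    ∫⁻ s, ((Icc 0 1 ∩ f ⁻¹' {s}).encard : ℝ≥0∞) ≤ eVariationOn f (Icc 0 1) := by
  let C : ℕ → ℕ → Set ℝ := fun n k => Icc 0 1 ∩ Icc ((k : ℝ) / 2 ^ n) (((k + 1 : ℕ) : ℝ) / 2 ^ n)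
  have hCc : ∀ n k, IsCompact (f '' C n k) := fun n k =>
    (isCompact_Icc.inter isCompact_Icc).image_of_continuousOn (hf.mono inter_subset_left)
  let M : ℕ → ℝ → ℝ≥0∞ := fun n s =>
    ∑ k ∈ Finset.range (2 ^ n + 1), (f '' C n k).indicator 1 s
  have hM : ∀ n, Measurable (M n) := fun n =>
    Finset.measurable_fun_sum _ fun k _ => measurable_one.indicator (hCc n k).measurableSet
  have hle : ∀ s, ((Icc 0 1 ∩ f ⁻¹' {s}).encard : ℝ≥0∞) ≤ liminf (fun n => M n s) atTop := by
    intro s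
    refine ENNReal.le_of_forall_nnreal_lt fun r hr => ?_
    obtain ⟨j, hrj, hj⟩ : ∃ j : ℕ, (r : ℝ≥0∞) ≤ j ∧ (j : ℕ∞) ≤ (Icc 0 1 ∩ f ⁻¹' {s}).encard := by
      rcases h : (Icc 0 1 ∩ f ⁻¹' {s}).encard with _ | N
      · obtain ⟨j, hj⟩ := exists_nat_ge r
        exact ⟨j, by exact_mod_cast hj, le_top⟩
      · refine ⟨N, ?_, le_rfl⟩
        rw [h] at hr
        exact hr.le
    refine hrj.trans ?_
    obtain ⟨T, hTS, hTj⟩ := exists_subset_encard_eq hj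
    have hT : T.Finite := finite_of_encard_eq_coe hTj
    refine le_liminf_of_le (by isBoundedDefault) ?_
    classical
    filter_upwards [eventually_injOn_dyadicFloor hT] with n hn
    have hpow : (0 : ℝ) < 2 ^ n := by positivity
    have h1 : M n s = (((Finset.range (2 ^ n + 1)).filter fun k => s ∈ f '' C n k).card : ℝ≥0∞) := by
      simp only [M, Set.indicator_apply, Pi.one_apply, Finset.sum_boole]
    rw [h1]
    have h2 : (dyadicFloor n '' T).encard ≤
        (((Finset.range (2 ^ n + 1)).filter fun k => s ∈ f '' C n k).card : ℕ∞) := by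
      rw [← encard_coe_eq_coe_finsetCard, ← (Nat.cast_injective (R := ℤ)).injOn.encard_image]
      refine encard_le_encard ?_
      rintro _ ⟨t, ht, rfl⟩
      obtain ⟨ht01, hts⟩ := hTS ht
      have hk0 : 0 ≤ dyadicFloor n t := Int.floor_nonneg.2 (mul_nonneg hpow.le ht01.1)
      obtain ⟨k, hk⟩ := Int.eq_ofNat_of_zero_le hk0
      obtain ⟨e1, e2⟩ := (dyadicFloor_eq_iff n t k).1 hk
      refine ⟨k, ?_, hk.symm⟩
      simp only [Finset.coe_filter, Finset.mem_range, mem_ofPred_eq]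
      refine ⟨?_, t, ⟨ht01, by push_cast at e1; exact e1, by push_cast at e2 ⊢; exact e2.le⟩, hts⟩
      have : (k : ℝ) ≤ 2 ^ n := by
        have := (div_le_iff₀ hpow).1 e1
        push_cast at this
        nlinarith [ht01.2]
      have : k ≤ 2 ^ n := by exact_mod_cast this
      omega
    rw [hn.encard_image, hTj] at h2
    exact_mod_cast h2
  have hMint : ∀ n, ∫⁻ s, M n s ≤ eVariationOn f (Icc 0 1) := by
    intro n
    rw [lintegral_finsetSum _ fun k _ => measurable_one.indicator (hCc n k).measurableSet]
    have hE : Monotone fun k : ℕ => (k : ℝ) / 2 ^ n := fun a b hab => by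
      dsimp only
      gcongr
    have hpow : (0 : ℝ) < 2 ^ n := by positivity
    calc ∑ k ∈ Finset.range (2 ^ n + 1), ∫⁻ s, (f '' C n k).indicator 1 s
        ≤ ∑ k ∈ Finset.range (2 ^ n + 1), eVariationOn f (C n k) := by
          refine Finset.sum_le_sum fun k _ => ?_
          rw [lintegral_indicator_one (hCc n k).measurableSet]
          refine (Real.volume_le_diam _).trans (ediam_le ?_)
          rintro _ ⟨x, hx, rfl⟩ _ ⟨y, hy, rfl⟩
          exact eVariationOn.edist_le f hx hy
      _ = eVariationOn f (Icc 0 1) := by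
          rw [Finset.sum_range_succ]
          -- The cell of index `2 ^ n` is present only to catch the parameter `1`, the floor of
          -- which is `2 ^ n`; it meets `[0, 1]` in that single point.
          have h0 : eVariationOn f (C n (2 ^ n)) = 0 := by
            refine eVariationOn.subsingleton f ?_
            rintro x ⟨hx, hx'⟩ y ⟨hy, hy'⟩
            have e : ((2 ^ n : ℕ) : ℝ) / 2 ^ n = 1 := by push_cast; exact div_self hpow.ne'
            have := hx'.1; have := hy'.1
            rw [e] at *
            linarith [hx.2, hy.2]
          rw [h0, add_zero]
          have h3 := eVariationOn.sum f (s := Icc (0 : ℝ) 1) hE (n := 2 ^ n) (by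
            intro i _ hi
            have : (i : ℝ) ≤ 2 ^ n := by exact_mod_cast hi.le
            exact ⟨by positivity, (div_le_one hpow).2 this⟩)
          refine h3.trans ?_
          congr 1
          simp
  calc ∫⁻ s, ((Icc 0 1 ∩ f ⁻¹' {s}).encard : ℝ≥0∞)
      ≤ ∫⁻ s, liminf (fun n => M n s) atTop := lintegral_mono hle
    _ ≤ liminf (fun n => ∫⁻ s, M n s) atTop := lintegral_liminf_le hM
    _ ≤ _ := (liminf_le_liminf (Eventually.of_forall hMint)).trans (by simp)

/-- An open set of reals is a countable union of closed sets, so this set is a countable union of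
projections of compact sets. The form `C ∩ U` accommodates half-open dyadic cells. -/
theorem measurableSet_exists_mem_slice {K : Set (ℝ × ℝ)} (hK : IsCompact K) {C U : Set ℝ}
    (hC : IsClosed C) (hU : IsOpen U) : MeasurableSet {s | ∃ t ∈ C ∩ U, (s, t) ∈ K} := by
  obtain ⟨F, hF, -, rfl, -⟩ := hU.exists_iUnion_isClosed
  have : {s | ∃ t ∈ C ∩ ⋃ n, F n, (s, t) ∈ K} =
      ⋃ n, Prod.fst '' (K ∩ Prod.snd ⁻¹' (C ∩ F n)) := by
    ext s
    simp only [mem_ofPred_eq, mem_inter_iff, mem_iUnion, mem_image, mem_preimage, Prod.exists,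
      exists_and_right, exists_eq_right]
    constructor
    · rintro ⟨t, ⟨hc, n, hn⟩, hk⟩; exact ⟨n, t, hk, hc, hn⟩
    · rintro ⟨n, t, hk, hc, hn⟩; exact ⟨t, ⟨hc, n, hn⟩, hk⟩
  rw [this]
  refine MeasurableSet.iUnion fun n => IsCompact.measurableSet (IsCompact.image ?_ continuous_fst)
  exact hK.inter_right ((hC.inter (hF n)).preimage continuous_snd)

theorem measurable_encard_slice {K : Set (ℝ × ℝ)} (hK : IsCompact K) {C U : Set ℝ}
    (hC : IsClosed C) (hU : IsOpen U) :
    Measurable fun s => ({t | (s, t) ∈ K} ∩ (C ∩ U)).encard := by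
  simp only [encard_eq_iSup_dyadicFloor]
  have hmeas : ∀ n, Measurable fun s =>
      (dyadicFloor n '' ({t | (s, t) ∈ K} ∩ (C ∩ U))).encard := by
    intro n
    refine measurable_encard.comp (measurable_set_iff.2 fun k => ?_)
    refine measurable_to_prop ?_
    have h := measurableSet_exists_mem_slice hK (hC.inter (isClosed_Ici (a := (k : ℝ) / 2 ^ n)))
      (hU.inter (isOpen_Iio (a := ((k : ℝ) + 1) / 2 ^ n)))
    convert h using 1
    ext s
    simp only [mem_preimage, mem_singleton_iff, eq_iff_iff, iff_true, mem_image, mem_inter_iff,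
      mem_ofPred_eq, mem_Ici, mem_Iio]
    refine exists_congr fun t => ?_
    rw [dyadicFloor_eq_iff]
    tauto
  have hle : ∀ n : ℕ, MeasurableSet
      {s | ⨆ k, (dyadicFloor k '' ({t | (s, t) ∈ K} ∩ (C ∩ U))).encard ≤ n} := by
    intro n
    simp only [iSup_le_iff, ofPred_forall]
    exact MeasurableSet.iInter fun k => hmeas k (MeasurableSet.of_discrete (s := Iic (n : ℕ∞)))
  refine ENat.measurable_iff.2 fun n => ?_
  rcases n with _ | n
  · convert hle 0 using 1
    ext s
    simp
  · convert (hle (n + 1)).diff (hle n) using 1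
    ext s
    rw [mem_preimage, mem_singleton_iff, Set.mem_sdiff, mem_ofPred_eq, mem_ofPred_eq, not_le,
      le_antisymm_iff]
    refine and_congr_right fun _ => ?_
    push_cast
    exact Order.add_one_le_iff_of_not_isMax (by simp)

theorem eVariationOn_eq_iSup_finset (f : unitInterval → ℝ) :
    eVariationOn f univ = ⨆ T : Finset unitInterval, eVariationOn f T := by
  apply le_antisymm
  · refine iSup_le fun ⟨n, u, hu, _⟩ => ?_
    classical
    refine le_iSup_of_le ((Finset.range (n + 1)).image u) ?_
    refine eVariationOn.sum_le_of_monotoneOn_Iic (hu.monotoneOn _) ?_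
    intro i hi
    simp only [Finset.coe_image, Finset.coe_range]
    exact ⟨i, Nat.lt_succ_of_le hi, rfl⟩
  · exact iSup_le fun T => eVariationOn.mono _ (subset_univ _)

theorem edist_coord_add_le (p q : Plane) :
    edist (p 0) (q 0) + edist (p 1) (q 1) ≤ ENNReal.ofReal (Real.sqrt 2) * edist p q := by
  rw [edist_dist, edist_dist, edist_dist, ← ENNReal.ofReal_add dist_nonneg dist_nonneg,
    ← ENNReal.ofReal_mul (Real.sqrt_nonneg 2)]
  apply ENNReal.ofReal_le_ofReal
  rw [EuclideanSpace.dist_eq, ← Real.sqrt_mul zero_le_two]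
  apply Real.le_sqrt_of_sq_le
  rw [Fin.sum_univ_two]
  nlinarith [sq_nonneg (dist (p 0) (q 0) - dist (p 1) (q 1))]

theorem exists_monotone_image_Iic (T : Finset unitInterval) (hT : T.Nonempty) :
    ∃ (u : ℕ → unitInterval) (n : ℕ), Monotone u ∧ (T : Set unitInterval) = u '' Iic n := by
  have hc : 0 < T.card := hT.card_pos
  let o := T.orderEmbOfFin rfl
  refine ⟨fun i => o ⟨min i (T.card - 1), by omega⟩, T.card - 1, ?_, ?_⟩
  · intro a b hab
    apply o.monotone
    rw [Fin.le_def]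
    exact min_le_min_right _ hab
  · rw [← T.range_orderEmbOfFin rfl]
    ext x
    constructor
    · rintro ⟨k, rfl⟩
      refine ⟨k, by rw [mem_Iic]; omega, ?_⟩
      dsimp only
      congr 1
      ext
      simp only
      omega
    · rintro ⟨k, _, rfl⟩
      exact ⟨_, rfl⟩

/-- The partitions for the two coordinates are merged into a common refinement, on which `|dx| +
|dy| ≤ √2 |dp|` applies chord by chord. -/
theorem eVariationOn_coord_add_le (γ : unitInterval → Plane) :
    eVariationOn (fun t => γ t 0) univ + eVariationOn (fun t => γ t 1) univ ≤
      ENNReal.ofReal (Real.sqrt 2) * eVariationOn γ univ := by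
  classical
  rw [eVariationOn_eq_iSup_finset (fun t => γ t 0), eVariationOn_eq_iSup_finset (fun t => γ t 1)]
  refine ENNReal.iSup_add_iSup_le fun T₁ T₂ => ?_
  let T := insert 0 (T₁ ∪ T₂)
  have h1 : (T₁ : Set unitInterval) ⊆ T := by intro x hx; simp [T, Finset.mem_coe.1 hx]
  have h2 : (T₂ : Set unitInterval) ⊆ T := by intro x hx; simp [T, Finset.mem_coe.1 hx]
  refine (add_le_add (eVariationOn.mono _ h1) (eVariationOn.mono _ h2)).trans ?_
  obtain ⟨u, n, hu, hTu⟩ := exists_monotone_image_Iic T ⟨0, Finset.mem_insert_self _ _⟩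
  rw [hTu, eVariationOn.image_range_of_monotone _ hu, eVariationOn.image_range_of_monotone _ hu,
    ← Finset.sum_add_distrib]
  calc _ ≤ ∑ i ∈ Finset.range n, ENNReal.ofReal (Real.sqrt 2) * edist (γ (u i)) (γ (u (i + 1))) :=
        Finset.sum_le_sum fun i _ => edist_coord_add_le _ _
    _ = ENNReal.ofReal (Real.sqrt 2) * eVariationOn γ (u '' Iic n) := by
        rw [← Finset.mul_sum, eVariationOn.image_range_of_monotone _ hu]
    _ ≤ _ := by gcongr; exact eVariationOn.mono _ (subset_univ _)

theorem linePoint_apply_self (i : Fin 2) (s t : ℝ) : linePoint i s t i = s := by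
  simp [linePoint]

theorem linePoint_apply_other (i : Fin 2) (s t : ℝ) : linePoint i s t (1 - i) = t := by
  fin_cases i <;> simp [linePoint]

theorem linePoint_other (i : Fin 2) (s t : ℝ) : linePoint (1 - i) s t = linePoint i t s := by
  ext k
  fin_cases i <;> fin_cases k <;> simp [linePoint]

theorem linePoint_self (i : Fin 2) (p : Plane) : linePoint i (p i) (p (1 - i)) = p := by
  ext k
  fin_cases i <;> fin_cases k <;> simp [linePoint]

theorem continuous_linePoint (i : Fin 2) : Continuous fun x : ℝ × ℝ => linePoint i x.1 x.2 := by
  unfold linePoint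
  refine (PiLp.continuous_toLp 2 _).comp (continuous_pi fun k => ?_)
  split_ifs <;> fun_prop

theorem lintegral_encard_slice_le (G : PlaneGraph) (i : Fin 2) :
    ∫⁻ s, ((slice i s G.edgeSet).encard : ℝ≥0∞) ≤
      ∑ e, eVariationOn (fun t => G.edge e t i) univ := by
  let g : Fin G.numEdges → ℝ → ℝ := fun e t => G.edge e (projIcc 0 1 zero_le_one t) i
  have hg : ∀ e, Continuous (g e) := fun e => by
    have : Continuous fun t : ℝ => G.edge e (projIcc 0 1 zero_le_one t) :=
      (G.edge e).continuous.comp continuous_projIcc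
    exact (PiLp.continuous_apply 2 _ i).comp this
  have hv : ∀ e, eVariationOn (g e) (Icc 0 1) ≤ eVariationOn (fun t => G.edge e t i) univ :=
    fun e => eVariationOn.comp_le_of_monotoneOn (fun t => G.edge e t i) (projIcc 0 1 zero_le_one)
      ((monotone_projIcc _).monotoneOn _) (fun _ _ => mem_univ _)
  have hpt : ∀ s, ((slice i s G.edgeSet).encard : ℝ≥0∞) ≤
      ∑ e, ((Icc 0 1 ∩ g e ⁻¹' {s}).encard : ℝ≥0∞) := by
    intro s
    have h1 : slice i s G.edgeSet ⊆ ⋃ e, (fun t : ℝ => G.edge e (projIcc 0 1 zero_le_one t) (1 - i)) ''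
        (Icc 0 1 ∩ g e ⁻¹' {s}) := by
      intro t ht
      obtain ⟨e, u, hu⟩ := mem_iUnion.1 ht
      refine mem_iUnion.2 ⟨e, u, ⟨u.2, ?_⟩, ?_⟩
      · simp only [g, mem_preimage, mem_singleton_iff, projIcc_val, hu, linePoint_apply_self]
      · simp only [projIcc_val, hu, linePoint_apply_other]
    have h2 : (slice i s G.edgeSet).encard ≤ ∑ e, (Icc 0 1 ∩ g e ⁻¹' {s}).encard := by
      refine (encard_le_encard h1).trans ((encard_iUnion_le_of_fintype _).trans ?_)
      exact Finset.sum_le_sum fun e _ => encard_image_le _ _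
    calc _ ≤ ((∑ e, (Icc 0 1 ∩ g e ⁻¹' {s}).encard : ℕ∞) : ℝ≥0∞) := by exact_mod_cast h2
      _ = _ := map_sum ENat.toENNRealRingHom _ _
  have hmeas : ∀ e, Measurable fun s => ((Icc 0 1 ∩ g e ⁻¹' {s}).encard : ℝ≥0∞) := by
    intro e
    -- The fiber of `g e` over `s` is the slice at `s` of the transposed graph of `g e`, which is
    -- compact.
    have hK : IsCompact ((fun t => (g e t, t)) '' Icc 0 1) :=
      isCompact_Icc.image ((hg e).prodMk continuous_id)
    have h := measurable_encard_slice hK isClosed_univ isOpen_univ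
    have hset : ∀ s, {t | (s, t) ∈ (fun t => (g e t, t)) '' Icc 0 1} ∩ (univ ∩ univ) =
        Icc 0 1 ∩ g e ⁻¹' {s} := by
      intro s
      ext t
      simp only [mem_inter_iff, mem_preimage, mem_singleton_iff, mem_ofPred_eq, mem_image,
        Prod.mk.injEq, mem_univ, and_true]
      constructor
      · rintro ⟨t', ht, rfl, rfl⟩; exact ⟨ht, rfl⟩
      · rintro ⟨ht, rfl⟩; exact ⟨t, ht, rfl, rfl⟩
    simp only [hset] at h
    exact (Measurable.of_discrete (f := ENat.toENNReal)).comp h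
  calc _ ≤ ∫⁻ s, ∑ e, ((Icc 0 1 ∩ g e ⁻¹' {s}).encard : ℝ≥0∞) := lintegral_mono hpt
    _ = ∑ e, ∫⁻ s, ((Icc 0 1 ∩ g e ⁻¹' {s}).encard : ℝ≥0∞) :=
        lintegral_finsetSum _ fun e _ => hmeas e
    _ ≤ _ := Finset.sum_le_sum fun e _ =>
        (lintegral_encard_fiber_le (g e) (hg e).continuousOn).trans (hv e)

theorem PlaneGraph.isCompact_edgeSet (G : PlaneGraph) : IsCompact G.edgeSet :=
  isCompact_iUnion fun e => isCompact_range (G.edge e).continuous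

theorem measurable_encard_slice_inter {E : Set Plane} (hE : IsCompact E) (i : Fin 2) {C U : Set ℝ}
    (hC : IsClosed C) (hU : IsOpen U) : Measurable fun s => (slice i s E ∩ (C ∩ U)).encard := by
  have hK : IsCompact ((fun p : Plane => (p i, p (1 - i))) '' E) := by
    refine hE.image ?_
    exact (PiLp.continuous_apply 2 _ i).prodMk (PiLp.continuous_apply 2 _ (1 - i))
  have h := measurable_encard_slice hK hC hU
  have hset : ∀ s, {t | (s, t) ∈ (fun p : Plane => (p i, p (1 - i))) '' E} = slice i s E := by
    intro s
    ext t
    constructor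
    · rintro ⟨p, hp, h⟩
      simp only [Prod.mk.injEq] at h
      obtain ⟨rfl, rfl⟩ := h
      change linePoint i _ _ ∈ E
      rwa [linePoint_self]
    · intro ht
      exact ⟨_, ht, by simp [linePoint_apply_self, linePoint_apply_other]⟩
  simpa only [hset] using h

theorem sum_lintegral_encard_slice_le (G : PlaneGraph) :
    (∫⁻ s, ((slice 0 s G.edgeSet).encard : ℝ≥0∞)) + ∫⁻ s, ((slice 1 s G.edgeSet).encard : ℝ≥0∞) ≤
      ENNReal.ofReal (Real.sqrt 2) * G.length := by
  refine (add_le_add (lintegral_encard_slice_le G 0) (lintegral_encard_slice_le G 1)).trans ?_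
  rw [← Finset.sum_add_distrib, PlaneGraph.length, Finset.mul_sum]
  exact Finset.sum_le_sum fun e _ => eVariationOn_coord_add_le _

theorem ae_finite_slice (G : PlaneGraph) (hG : G.length ≠ ⊤) (i : Fin 2) :
    ∀ᵐ s, (slice i s G.edgeSet).Finite := by
  have hfin : ∫⁻ s, ((slice i s G.edgeSet).encard : ℝ≥0∞) ≠ ⊤ := by
    have h := ne_top_of_le_ne_top (ENNReal.mul_ne_top ENNReal.ofReal_ne_top hG)
      (sum_lintegral_encard_slice_le G)
    rw [ENNReal.add_ne_top] at h
    fin_cases i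
    exacts [h.1, h.2]
  have hm : Measurable fun s => ((slice i s G.edgeSet).encard : ℝ≥0∞) := by
    have h := measurable_encard_slice_inter G.isCompact_edgeSet i isClosed_univ isOpen_univ
    simp only [inter_univ] at h
    exact (Measurable.of_discrete (f := ENat.toENNReal)).comp h
  filter_upwards [ae_lt_top hm hfin] with s hs
  rw [ENat.toENNReal_lt_top] at hs
  exact encard_lt_top_iff.1 hs

/-! ### The area of a neighborhood of a connected graph, and the number of disks. -/

theorem volume_eq_lintegral_slice {A : Set Plane} (hA : MeasurableSet A) :
    volume A = ∫⁻ y, volume (slice 1 y A) := by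
  have h1 : MeasurePreserving (fun p : Plane => (p 0, p 1)) volume (volume.prod volume) :=
    (volume_preserving_finTwoArrow ℝ).comp (PiLp.volume_preserving_ofLp (Fin 2))
  have hm : Measurable fun x : ℝ × ℝ => linePoint 1 x.2 x.1 :=
    ((continuous_linePoint 1).comp continuous_swap).measurable
  have hpre : (fun p : Plane => (p 0, p 1)) ⁻¹' ((fun x : ℝ × ℝ => linePoint 1 x.2 x.1) ⁻¹' A) =
      A := by
    ext p
    have := linePoint_self 1 p
    simp only [sub_self] at this
    simp [this]
  conv_lhs => rw [← hpre]
  rw [h1.measure_preimage (hm hA).nullMeasurableSet, Measure.prod_apply_symm (hm hA)]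
  rfl

theorem mem_closedBall_iff (i : Fin 2) (c : Plane) (r s t : ℝ) (hr : 0 ≤ r) :
    linePoint i s t ∈ closedBall c r ↔ (s - c i) ^ 2 + (t - c (1 - i)) ^ 2 ≤ r ^ 2 := by
  rw [mem_closedBall, EuclideanSpace.dist_eq, Real.sqrt_le_left hr, Fin.sum_univ_two]
  fin_cases i <;> simp [linePoint, Real.dist_eq, sq_abs, add_comm]

/-- Shifting a disk by `d` along the first axis moves each of its horizontal chords by `d`, so at
height `y` with `|y| ≤ r` the shifted disk protrudes by length at most `d`. -/
theorem volume_closedBall_diff_aux (d r : ℝ) (hd : 0 ≤ d) (hr : 0 ≤ r) :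
    volume (closedBall (linePoint 0 d 0) r \ closedBall (0 : Plane) r) ≤
      ENNReal.ofReal (2 * r * d) := by
  rw [volume_eq_lintegral_slice (measurableSet_closedBall.diff measurableSet_closedBall)]
  have hpt : ∀ y, volume (slice 1 y (closedBall (linePoint 0 d 0) r \ closedBall (0 : Plane) r)) ≤
      (Icc (-r) r).indicator (fun _ => ENNReal.ofReal d) y := by
    intro y
    have hsub : ∀ x ∈ slice 1 y (closedBall (linePoint 0 d 0) r \ closedBall (0 : Plane) r),
        y ^ 2 + (x - d) ^ 2 ≤ r ^ 2 ∧ r ^ 2 < y ^ 2 + x ^ 2 := by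
      rintro x ⟨h1, h2⟩
      rw [mem_closedBall_iff _ _ _ _ _ hr] at h1 h2
      simpa [linePoint] using And.intro h1 h2
    by_cases hy : y ∈ Icc (-r) r
    · rw [indicator_of_mem hy]
      have hw : 0 ≤ r ^ 2 - y ^ 2 := by nlinarith [hy.1, hy.2]
      set w := Real.sqrt (r ^ 2 - y ^ 2)
      have hw2 : w ^ 2 = r ^ 2 - y ^ 2 := Real.sq_sqrt hw
      have hw0 : 0 ≤ w := Real.sqrt_nonneg _
      have : slice 1 y (closedBall (linePoint 0 d 0) r \ closedBall (0 : Plane) r) ⊆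
          Icc w (w + d) := by
        intro x hx
        obtain ⟨h1, h2⟩ := hsub x hx
        have h3 := abs_le_of_sq_le_sq' (by linarith : (x - d) ^ 2 ≤ w ^ 2) hw0
        refine ⟨?_, by linarith [h3.2]⟩
        by_contra! hlt
        nlinarith [h3.1]
      refine (measure_mono this).trans ?_
      rw [Real.volume_Icc]
      simp
    · have : slice 1 y (closedBall (linePoint 0 d 0) r \ closedBall (0 : Plane) r) = ∅ := by
        rw [eq_empty_iff_forall_notMem]
        intro x hx
        refine hy (abs_le.1 (abs_le_of_sq_le_sq (by nlinarith [(hsub x hx).1, sq_nonneg (x - d)]) hr))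
      rw [this]
      simp
  refine (lintegral_mono hpt).trans ?_
  rw [lintegral_indicator measurableSet_Icc, setLIntegral_const, Real.volume_Icc,
    ← ENNReal.ofReal_mul hd]
  exact ENNReal.ofReal_le_ofReal (by linarith)

theorem volume_closedBall_diff_le (p q : Plane) (r : ℝ) (hr : 0 ≤ r) :
    volume (closedBall q r \ closedBall p r) ≤ ENNReal.ofReal (2 * r * dist p q) := by
  set d := dist p q
  have hnorm : ‖q - p‖ = ‖linePoint 0 d 0‖ := by
    rw [EuclideanSpace.norm_eq (linePoint 0 d 0), Fin.sum_univ_two]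
    simp [linePoint, d, dist_comm p q, ← dist_eq_norm]
  -- The reflection in the perpendicular bisector of two vectors of equal length swaps them, so `R`
  -- makes the displacement `q - p` horizontal.
  let R := Submodule.reflection (ℝ ∙ ((q - p) - linePoint 0 d 0))ᗮ
  have hR : R (q - p) = linePoint 0 d 0 := Submodule.reflection_sub hnorm
  let Φ : Plane → Plane := fun x => R (x - p)
  have hΦ : MeasurePreserving Φ volume volume :=
    R.measurePreserving.comp (measurePreserving_sub_right volume p)
  have hdist : ∀ x y, dist (Φ x) (Φ y) = dist x y := by
    intro x y
    simp only [Φ, LinearIsometryEquiv.dist_map, dist_sub_right]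
  have hpre : closedBall q r \ closedBall p r =
      Φ ⁻¹' (closedBall (linePoint 0 d 0) r \ closedBall (0 : Plane) r) := by
    have hq : linePoint 0 d 0 = Φ q := hR.symm
    have hp : (0 : Plane) = Φ p := by simp [Φ]
    ext x
    simp only [Set.mem_sdiff, mem_preimage, mem_closedBall]
    rw [hq, hp, hdist, hdist]
  rw [hpre, hΦ.measure_preimage
    (measurableSet_closedBall.diff measurableSet_closedBall).nullMeasurableSet]
  exact volume_closedBall_diff_aux d r dist_nonneg hr

/-- Each ball of the chain contributes only what lies outside its predecessor, at most `2 r` times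
the step. -/
theorem volume_iUnion_closedBall_diff_le (a : ℕ → Plane) (r : ℝ) (hr : 0 ≤ r) (n : ℕ) :
    volume ((⋃ k ∈ Iic n, closedBall (a k) r) \ closedBall (a 0) r) ≤
      ENNReal.ofReal (2 * r) * ∑ k ∈ Finset.range n, edist (a k) (a (k + 1)) := by
  induction n with
  | zero => simp [Iic]
  | succ n ih =>
    rw [Finset.sum_range_succ, mul_add]
    have hsub : (⋃ k ∈ Iic (n + 1), closedBall (a k) r) \ closedBall (a 0) r ⊆
        ((⋃ k ∈ Iic n, closedBall (a k) r) \ closedBall (a 0) r) ∪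
          (closedBall (a (n + 1)) r \ closedBall (a n) r) := by
      rintro x ⟨hx, hx0⟩
      by_cases h : ∃ k ≤ n, x ∈ closedBall (a k) r
      · obtain ⟨k, hk, hxk⟩ := h
        exact Or.inl ⟨mem_iUnion₂.2 ⟨k, hk, hxk⟩, hx0⟩
      · push Not at h
        obtain ⟨k, hk, hxk⟩ := mem_iUnion₂.1 hx
        rcases Nat.le_succ_iff.1 hk with hk' | rfl
        · exact absurd hxk (h k hk')
        · exact Or.inr ⟨hxk, h n le_rfl⟩
    refine (measure_mono hsub).trans ((measure_union_le _ _).trans (add_le_add ih ?_))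
    rw [edist_dist, ← ENNReal.ofReal_mul (by positivity)]
    exact volume_closedBall_diff_le _ _ _ hr

theorem exists_chain (γ : C(unitInterval, Plane)) {ε : ℝ} (hε : 0 < ε) :
    ∃ (n : ℕ) (u : ℕ → unitInterval), Monotone u ∧ u 0 = 0 ∧ u n = 1 ∧
      ∀ t, ∃ k ≤ n, dist (γ t) (γ (u k)) ≤ ε := by
  obtain ⟨η, hη, hγ⟩ := Metric.uniformContinuous_iff.1
    (CompactSpace.uniformContinuous_of_continuous γ.continuous) ε hε
  obtain ⟨n, hn⟩ := exists_nat_one_div_lt hη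
  have hn0 : (0 : ℝ) < n + 1 := by positivity
  let u : ℕ → unitInterval := fun k => projIcc 0 1 zero_le_one ((k : ℝ) / (n + 1))
  refine ⟨n + 1, u, ?_, ?_, ?_, ?_⟩
  · intro a b hab
    exact monotone_projIcc _ (by gcongr)
  · simp [u, projIcc_left]
  · simp only [u]
    push_cast
    rw [div_self hn0.ne']
    exact projIcc_right _
  · intro t
    have ht : (0 : ℝ) ≤ (n + 1) * t := mul_nonneg hn0.le t.2.1
    have hk : (⌊((n : ℝ) + 1) * t⌋₊ : ℝ) ≤ (n + 1) * t := Nat.floor_le ht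
    have hk1 : ((n : ℝ) + 1) * t ≤ n + 1 := by nlinarith [t.2.2]
    refine ⟨⌊((n : ℝ) + 1) * t⌋₊, ?_, (hγ ?_).le⟩
    · exact_mod_cast hk.trans hk1
    · have hmem : (⌊((n : ℝ) + 1) * t⌋₊ : ℝ) / (n + 1) ∈ Icc (0 : ℝ) 1 :=
        ⟨by positivity, (div_le_one hn0).2 (hk.trans hk1)⟩
      rw [Subtype.dist_eq]
      simp only [u, projIcc_of_mem zero_le_one hmem]
      rw [Real.dist_eq, abs_of_nonneg]
      · refine lt_of_lt_of_le ?_ (le_of_lt hn)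
        rw [sub_lt_iff_lt_add, ← add_div, lt_div_iff₀ hn0]
        linarith [Nat.lt_floor_add_one (((n : ℝ) + 1) * t)]
      · rw [sub_nonneg, div_le_iff₀ hn0]
        linarith

/-- `U` is the union of balls around finitely many points of the arc; the extra radius `ε` absorbs
the discretization. The excess area is bounded relative to the ball at either end, because an edge
may have to be attached to a graph at either end. -/
theorem exists_ball_cover (γ : C(unitInterval, Plane)) {ε : ℝ} (hε : 0 < ε) (r : ℝ)
    (hr : 0 ≤ r) :
    ∃ U : Set Plane, closedBall (γ 0) (r + ε) ⊆ U ∧ closedBall (γ 1) (r + ε) ⊆ U ∧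
      (∀ t, closedBall (γ t) r ⊆ U) ∧
      volume (U \ closedBall (γ 0) (r + ε)) ≤
        ENNReal.ofReal (2 * (r + ε)) * eVariationOn γ univ ∧
      volume (U \ closedBall (γ 1) (r + ε)) ≤
        ENNReal.ofReal (2 * (r + ε)) * eVariationOn γ univ := by
  obtain ⟨n, u, hu, hu0, hun, hcov⟩ := exists_chain γ hε
  have hrε : 0 ≤ r + ε := by positivity
  refine ⟨⋃ k ∈ Iic n, closedBall (γ (u k)) (r + ε), ?_, ?_, ?_, ?_, ?_⟩
  · rw [← hu0]
    exact subset_biUnion_of_mem (u := fun k => closedBall (γ (u k)) (r + ε))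
      (mem_Iic.2 (Nat.zero_le n))
  · rw [← hun]
    exact subset_biUnion_of_mem (u := fun k => closedBall (γ (u k)) (r + ε)) (mem_Iic.2 le_rfl)
  · intro t
    obtain ⟨k, hk, hd⟩ := hcov t
    exact (closedBall_subset_closedBall' (by linarith)).trans
      (subset_biUnion_of_mem (u := fun k => closedBall (γ (u k)) (r + ε)) (mem_Iic.2 hk))
  · have h := volume_iUnion_closedBall_diff_le (fun k => γ (u k)) (r + ε) hrε n
    rw [hu0] at h
    refine h.trans ?_
    gcongr
    simp only [edist_comm (γ (u _)) (γ (u (_ + 1)))]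
    exact eVariationOn.sum_le hu fun _ => mem_univ _
  -- The same chain, traversed backwards.
  · have h := volume_iUnion_closedBall_diff_le (fun k => γ (u (n - k))) (r + ε) hrε n
    simp only [Nat.sub_zero, hun] at h
    have hU : ⋃ k ∈ Iic n, closedBall (γ (u (n - k))) (r + ε) =
        ⋃ k ∈ Iic n, closedBall (γ (u k)) (r + ε) := by
      ext x
      simp only [mem_iUnion, mem_Iic, exists_prop]
      constructor
      · rintro ⟨k, hk, hx⟩; exact ⟨n - k, Nat.sub_le _ _, hx⟩
      · rintro ⟨k, hk, hx⟩; exact ⟨n - k, Nat.sub_le _ _, by rwa [Nat.sub_sub_self hk]⟩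
    rw [hU] at h
    refine h.trans ?_
    gcongr
    rw [← Finset.sum_range_reflect]
    refine le_trans (le_of_eq ?_) (eVariationOn.sum_le hu (n := n) fun _ => mem_univ _)
    refine Finset.sum_congr rfl fun k hk => ?_
    have hk' := Finset.mem_range.1 hk
    have e1 : n - (n - 1 - k) = k + 1 := by omega
    have e2 : n - (n - 1 - k + 1) = k := by omega
    rw [e1, e2]

/-- In a connected plane graph every proper set of edges misses an edge that starts or ends at a
given base vertex or at an end vertex of an edge of the set. -/
theorem PlaneGraph.exists_adjacent_edge (G : PlaneGraph) (hG : G.toSimpleGraph.Connected)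
    (v₀ : Plane) (hv₀ : v₀ ∈ G.vertices) (T : Finset (Fin G.numEdges)) (hT : T ≠ Finset.univ) :
    ∃ e ∉ T, ∃ v, (v = G.edge e 0 ∨ v = G.edge e 1) ∧
      (v = v₀ ∨ ∃ f ∈ T, v = G.edge f 0 ∨ v = G.edge f 1) := by
  let S : Set G.vertices :=
    {v | (v : Plane) = v₀ ∨ ∃ f ∈ T, (v : Plane) = G.edge f 0 ∨ (v : Plane) = G.edge f 1}
  by_cases hS : ∀ v, v ∈ S
  · obtain ⟨e, he⟩ : ∃ e, e ∉ T := by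
      by_contra! h
      exact hT (Finset.eq_univ_of_forall h)
    exact ⟨e, he, G.edge e 0, Or.inl rfl, hS ⟨_, G.source_mem e⟩⟩
  · push Not at hS
    obtain ⟨w, hw⟩ := hS
    obtain ⟨p⟩ := hG.preconnected ⟨v₀, hv₀⟩ w
    obtain ⟨d, -, hd1, hd2⟩ := p.exists_boundary_dart S (Or.inl rfl) hw
    obtain ⟨-, e, he⟩ := d.adj
    have hends : ((d.fst : Plane) = G.edge e 0 ∧ (d.snd : Plane) = G.edge e 1) ∨
        ((d.fst : Plane) = G.edge e 1 ∧ (d.snd : Plane) = G.edge e 0) := by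
      rcases Sym2.eq_iff.1 he with h | h
      · exact Or.inl ⟨h.1.symm, h.2.symm⟩
      · exact Or.inr ⟨h.2.symm, h.1.symm⟩
    refine ⟨e, fun heT => hd2 (Or.inr ⟨e, heT, ?_⟩), d.fst, ?_, hd1⟩
    · rcases hends with h | h
      · exact Or.inr h.2
      · exact Or.inl h.2
    · rcases hends with h | h
      · exact Or.inl h.1
      · exact Or.inr h.1

/-- The neighborhood is built edge by edge, starting from the ball at one vertex. By connectedness a
next edge can always be chosen with an end whose ball is already covered, so it adds area at most `2
(r + ε)` times its length. -/
theorem PlaneGraph.exists_neighborhood (G : PlaneGraph) (hG : G.toSimpleGraph.Connected) {ε : ℝ}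
    (hε : 0 < ε) (r : ℝ) (hr : 0 ≤ r) :
    ∃ A : Set Plane, (∀ x ∈ G.edgeSet, closedBall x r ⊆ A) ∧
      volume A ≤ ENNReal.ofReal ((r + ε) ^ 2 * Real.pi) + ENNReal.ofReal (2 * (r + ε)) * G.length := by
  classical
  choose U hU0 hU1 hUt hV0 hV1 using fun e => exists_ball_cover (G.edge e) hε r hr
  obtain ⟨⟨v₀, hv₀⟩⟩ := hG.nonempty
  have key : ∀ k ≤ G.numEdges, ∃ T : Finset (Fin G.numEdges), T.card = k ∧
      volume (closedBall v₀ (r + ε) ∪ ⋃ e ∈ T, U e) ≤ ENNReal.ofReal ((r + ε) ^ 2 * Real.pi) +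
        ENNReal.ofReal (2 * (r + ε)) * ∑ e ∈ T, eVariationOn (G.edge e) univ := by
    intro k
    induction k with
    | zero =>
      intro _
      refine ⟨∅, rfl, ?_⟩
      simp only [Finset.notMem_empty, iUnion_of_empty, iUnion_empty, union_empty,
        Finset.sum_empty, mul_zero, add_zero]
      rw [EuclideanSpace.volume_closedBall_fin_two, ENNReal.ofReal_mul (by positivity),
        ENNReal.ofReal_pow (by positivity)]
    | succ k ih =>
      intro hk
      obtain ⟨T, hTk, hT⟩ := ih (by omega)
      obtain ⟨e, heT, v, hve, hvT⟩ := G.exists_adjacent_edge hG v₀ hv₀ T (by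
        rintro rfl
        simp at hTk
        omega)
      refine ⟨insert e T, by rw [Finset.card_insert_of_notMem heT, hTk], ?_⟩
      have hball : closedBall v (r + ε) ⊆ closedBall v₀ (r + ε) ∪ ⋃ e ∈ T, U e := by
        rcases hvT with rfl | ⟨f, hf, hvf⟩
        · exact subset_union_left
        · refine Subset.trans ?_ subset_union_right
          refine Subset.trans ?_ (subset_biUnion_of_mem (u := fun e => U e) hf)
          rcases hvf with rfl | rfl
          · exact hU0 f
          · exact hU1 f
      have hsub : closedBall v₀ (r + ε) ∪ ⋃ f ∈ insert e T, U f ⊆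
          (closedBall v₀ (r + ε) ∪ ⋃ e ∈ T, U e) ∪ (U e \ closedBall v (r + ε)) := by
        intro x hx
        by_cases hxA : x ∈ closedBall v₀ (r + ε) ∪ ⋃ e ∈ T, U e
        · exact Or.inl hxA
        · refine Or.inr ⟨?_, fun h => hxA (hball h)⟩
          rcases hx with hx | hx
          · exact absurd (Or.inl hx) hxA
          · obtain ⟨f, hf, hxf⟩ := mem_iUnion₂.1 hx
            rcases Finset.mem_insert.1 hf with h | hf
            · rwa [h] at hxf
            · exact absurd (Or.inr (mem_iUnion₂.2 ⟨f, hf, hxf⟩)) hxA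
      refine (measure_mono (μ := volume) hsub).trans ((measure_union_le _ _).trans ?_)
      rw [Finset.sum_insert heT, mul_add, add_comm (_ * eVariationOn _ _), ← add_assoc]
      refine add_le_add hT ?_
      rcases hve with rfl | rfl
      · exact hV0 e
      · exact hV1 e
  obtain ⟨T, hTk, hT⟩ := key _ le_rfl
  have hTu : T = Finset.univ := by
    rw [← Finset.card_eq_iff_eq_univ, hTk, Fintype.card_fin]
  subst hTu
  refine ⟨_, ?_, hT⟩
  intro x hx
  obtain ⟨e, t, rfl⟩ := mem_iUnion.1 hx
  exact (hUt e t).trans (Subset.trans (subset_biUnion_of_mem (u := fun e => U e)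
    (Finset.mem_univ e)) subset_union_right)

/-- Disjoint disks of equal radius that meet a connected plane graph are few. -/
theorem PlaneGraph.card_disks_le (G : PlaneGraph) (hG : G.toSimpleGraph.Connected) (L : ℝ≥0)
    (hL : G.length = L) (δ : ℝ) (hδ : 0 < δ) (D : Finset Plane)
    (hdisj : (D : Set Plane).PairwiseDisjoint fun c => closedBall c δ)
    (hmeet : ∀ c ∈ D, (closedBall c δ ∩ G.edgeSet).Nonempty) :
    (D.card : ℝ) * (Real.pi * δ) ≤ 4 * L + 4 * (Real.pi * δ) := by
  have key : ∀ ε > 0, (D.card : ℝ) * (δ ^ 2 * Real.pi) ≤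
      (2 * δ + ε) ^ 2 * Real.pi + 2 * (2 * δ + ε) * L := by
    intro ε hε
    obtain ⟨A, hA, hvol⟩ := G.exists_neighborhood hG hε (2 * δ) (by positivity)
    -- A disk of radius `δ` containing the point `x` lies in the ball of radius `2δ` about `x`.
    have hsub : ⋃ c ∈ D, closedBall c δ ⊆ A := by
      refine iUnion₂_subset fun c hc => ?_
      obtain ⟨x, hxc, hxE⟩ := hmeet c hc
      refine Subset.trans ?_ (hA x hxE)
      apply closedBall_subset_closedBall'
      rw [mem_closedBall, dist_comm] at hxc
      linarith
    have h := (measure_mono hsub).trans hvol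
    rw [measure_biUnion_finset hdisj fun c _ => measurableSet_closedBall] at h
    have hb : ∀ c : Plane, volume (closedBall c δ) = ENNReal.ofReal (δ ^ 2 * Real.pi) := by
      intro c
      rw [EuclideanSpace.volume_closedBall_fin_two, ENNReal.ofReal_mul (by positivity),
        ENNReal.ofReal_pow (by positivity)]
    simp only [hb, Finset.sum_const, nsmul_eq_mul, hL] at h
    rw [← ENNReal.ofReal_natCast, ← ENNReal.ofReal_mul (by positivity),
      ← ENNReal.ofReal_coe_nnreal, ← ENNReal.ofReal_mul (by positivity),
      ← ENNReal.ofReal_add (by positivity) (by positivity)] at h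
    exact (ENNReal.ofReal_le_ofReal_iff (by positivity)).1 h
  have hlim : Tendsto (fun ε : ℝ => (2 * δ + ε) ^ 2 * Real.pi + 2 * (2 * δ + ε) * L) (𝓝[>] 0)
      (𝓝 ((2 * δ + 0) ^ 2 * Real.pi + 2 * (2 * δ + 0) * L)) :=
    (Continuous.tendsto (by fun_prop) 0).mono_left nhdsWithin_le_nhds
  have h0 := ge_of_tendsto hlim (eventually_nhdsWithin_of_forall key)
  refine le_of_mul_le_mul_left ?_ hδ
  nlinarith

/-! ### Dense points and the potential of a single line. -/

/-- The points of a line from which, in both directions, at least `m` points of `X` can be seen or,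
if there are more than `2 m` intervals `[bot c, top c]` with `c ∈ H`, at least `m` of these. -/
def denseSet {ι : Type*} (m : ℕ) (X : Set ℝ) (H : Finset ι) (bot top : ι → ℝ) : Set ℝ :=
  {t | ((m : ℕ∞) ≤ (X ∩ Iic t).encard ∨
      (2 * m < H.card ∧ m ≤ (H.filter fun c => top c ≤ t).card)) ∧
    ((m : ℕ∞) ≤ (X ∩ Ici t).encard ∨
      (2 * m < H.card ∧ m ≤ (H.filter fun c => t ≤ bot c).card))}

/-- A bound for `m` times the number of cuts of a line at dense points, if the line carries `n`
points and `k` intervals. -/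
def linePotential (m n k : ℕ) : ℕ := n + k - m - if k = 0 then 0 else 1

/-- The count is a nondecreasing step function of `t`, jumping only at values of `f` and
right-continuous there; hence its superlevel sets are closed rays starting at such a value. -/
theorem setOf_le_card_filter_le {ι : Type*} (A : Finset ι) (f : ι → ℝ) {m : ℕ} (hm : 0 < m) :
    {t | m ≤ (A.filter fun c => f c ≤ t).card} = ∅ ∨
      ∃ a ∈ A, {t | m ≤ (A.filter fun c => f c ≤ t).card} = Ici (f a) := by
  by_cases hne : {t | m ≤ (A.filter fun c => f c ≤ t).card} = ∅
  · exact Or.inl hne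
  right
  have hstep : ∀ t, m ≤ (A.filter fun c => f c ≤ t).card →
      ∃ a ∈ A.filter (fun a => m ≤ (A.filter fun c => f c ≤ f a).card), f a ≤ t := by
    intro t ht
    have hne' : (A.filter fun c => f c ≤ t).Nonempty := Finset.card_pos.1 (by omega)
    obtain ⟨a, ha, hmax⟩ := Finset.exists_max_image _ f hne'
    rw [Finset.mem_filter] at ha
    refine ⟨a, Finset.mem_filter.2 ⟨ha.1, ht.trans (Finset.card_le_card fun c hc => ?_)⟩, ha.2⟩
    exact Finset.mem_filter.2 ⟨(Finset.mem_filter.1 hc).1, hmax c hc⟩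
  obtain ⟨t, ht⟩ := nonempty_iff_ne_empty.2 hne
  obtain ⟨a₀, ha₀, -⟩ := hstep t ht
  obtain ⟨a, ha, hmin⟩ := Finset.exists_min_image _ f ⟨a₀, ha₀⟩
  rw [Finset.mem_filter] at ha
  refine ⟨a, ha.1, Subset.antisymm ?_ ?_⟩
  · intro t ht
    obtain ⟨b, hb, hbt⟩ := hstep t ht
    exact (hmin b hb).trans hbt
  · intro t ht
    refine ha.2.trans (Finset.card_le_card fun c hc => ?_)
    rw [Finset.mem_filter] at hc ⊢
    exact ⟨hc.1, hc.2.trans ht⟩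

theorem setOf_le_card_filter_ge {ι : Type*} (A : Finset ι) (f : ι → ℝ) {m : ℕ} (hm : 0 < m) :
    {t | m ≤ (A.filter fun c => t ≤ f c).card} = ∅ ∨
      ∃ a ∈ A, {t | m ≤ (A.filter fun c => t ≤ f c).card} = Iic (f a) := by
  have hset : {t | m ≤ (A.filter fun c => t ≤ f c).card} =
      Neg.neg ⁻¹' {t | m ≤ (A.filter fun c => -f c ≤ t).card} := by
    ext t; simp
  rw [hset]
  rcases setOf_le_card_filter_le A (fun c => -f c) hm with h | ⟨a, ha, h⟩
  · left; rw [h]; rfl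
  · right
    refine ⟨a, ha, ?_⟩
    rw [h]; ext t; simp

theorem encard_coe_inter_Iic (X : Finset ℝ) (t : ℝ) :
    ((X : Set ℝ) ∩ Iic t).encard = (X.filter fun c => c ≤ t).card := by
  rw [← encard_coe_eq_coe_finsetCard, Finset.coe_filter]; rfl

theorem encard_coe_inter_Ici (X : Finset ℝ) (t : ℝ) :
    ((X : Set ℝ) ∩ Ici t).encard = (X.filter fun c => t ≤ c).card := by
  rw [← encard_coe_eq_coe_finsetCard, Finset.coe_filter]; rfl

theorem union_ray_Ici {P Q : Set ℝ} {S : Set ℝ} (hP : P = ∅ ∨ ∃ a ∈ S, P = Ici a)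
    (hQ : Q = ∅ ∨ ∃ a ∈ S, Q = Ici a) : P ∪ Q = ∅ ∨ ∃ a ∈ S, P ∪ Q = Ici a := by
  rcases hP with rfl | ⟨a, ha, rfl⟩ <;> rcases hQ with rfl | ⟨b, hb, rfl⟩
  · simp
  · right; exact ⟨b, hb, by simp⟩
  · right; exact ⟨a, ha, by simp⟩
  · right
    rcases le_total a b with h | h
    · exact ⟨a, ha, union_eq_left.2 (Ici_subset_Ici.2 h)⟩
    · exact ⟨b, hb, union_eq_right.2 (Ici_subset_Ici.2 h)⟩

theorem union_ray_Iic {P Q : Set ℝ} {S : Set ℝ} (hP : P = ∅ ∨ ∃ a ∈ S, P = Iic a)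
    (hQ : Q = ∅ ∨ ∃ a ∈ S, Q = Iic a) : P ∪ Q = ∅ ∨ ∃ a ∈ S, P ∪ Q = Iic a := by
  rcases hP with rfl | ⟨a, ha, rfl⟩ <;> rcases hQ with rfl | ⟨b, hb, rfl⟩
  · simp
  · right; exact ⟨b, hb, by simp⟩
  · right; exact ⟨a, ha, by simp⟩
  · right
    rcases le_total a b with h | h
    · exact ⟨b, hb, union_eq_right.2 (Iic_subset_Iic.2 h)⟩
    · exact ⟨a, ha, union_eq_left.2 (Iic_subset_Iic.2 h)⟩

/-- Density from below holds on an upward closed ray and density from above on a downward one. The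
provenance of the endpoints serves to place the segment strictly inside the window. -/
theorem denseSet_eq_empty_or_Icc {ι : Type*} {m : ℕ} (hm : 0 < m) {X : Set ℝ} (hX : X.Finite)
    (H : Finset ι) (bot top : ι → ℝ) :
    denseSet m X H bot top = ∅ ∨ ∃ a ∈ X ∪ top '' H, ∃ b ∈ X ∪ bot '' H,
      denseSet m X H bot top = Icc a b := by
  lift X to Finset ℝ using hX
  have h1 : {t | (m : ℕ∞) ≤ ((X : Set ℝ) ∩ Iic t).encard} = ∅ ∨
      ∃ a ∈ (X : Set ℝ) ∪ top '' H, {t | (m : ℕ∞) ≤ ((X : Set ℝ) ∩ Iic t).encard} = Ici a := by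
    simp only [encard_coe_inter_Iic, Nat.cast_le]
    rcases setOf_le_card_filter_le X (fun c => c) hm with h | ⟨a, ha, h⟩
    · exact Or.inl h
    · exact Or.inr ⟨a, Or.inl ha, h⟩
  have h2 : {t | 2 * m < H.card ∧ m ≤ (H.filter fun c => top c ≤ t).card} = ∅ ∨
      ∃ a ∈ (X : Set ℝ) ∪ top '' H,
        {t | 2 * m < H.card ∧ m ≤ (H.filter fun c => top c ≤ t).card} = Ici a := by
    by_cases hk : 2 * m < H.card
    · simp only [hk, true_and]
      rcases setOf_le_card_filter_le H top hm with h | ⟨a, ha, h⟩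
      · exact Or.inl h
      · exact Or.inr ⟨top a, Or.inr ⟨a, ha, rfl⟩, h⟩
    · left; simp [hk]
  have h3 : {t | (m : ℕ∞) ≤ ((X : Set ℝ) ∩ Ici t).encard} = ∅ ∨
      ∃ a ∈ (X : Set ℝ) ∪ bot '' H, {t | (m : ℕ∞) ≤ ((X : Set ℝ) ∩ Ici t).encard} = Iic a := by
    simp only [encard_coe_inter_Ici, Nat.cast_le]
    rcases setOf_le_card_filter_ge X (fun c => c) hm with h | ⟨a, ha, h⟩
    · exact Or.inl h
    · exact Or.inr ⟨a, Or.inl ha, h⟩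
  have h4 : {t | 2 * m < H.card ∧ m ≤ (H.filter fun c => t ≤ bot c).card} = ∅ ∨
      ∃ a ∈ (X : Set ℝ) ∪ bot '' H,
        {t | 2 * m < H.card ∧ m ≤ (H.filter fun c => t ≤ bot c).card} = Iic a := by
    by_cases hk : 2 * m < H.card
    · simp only [hk, true_and]
      rcases setOf_le_card_filter_ge H bot hm with h | ⟨a, ha, h⟩
      · exact Or.inl h
      · exact Or.inr ⟨bot a, Or.inr ⟨a, ha, rfl⟩, h⟩
    · left; simp [hk]
  have hJ : denseSet m (X : Set ℝ) H bot top =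
      ({t | (m : ℕ∞) ≤ ((X : Set ℝ) ∩ Iic t).encard} ∪
        {t | 2 * m < H.card ∧ m ≤ (H.filter fun c => top c ≤ t).card}) ∩
      ({t | (m : ℕ∞) ≤ ((X : Set ℝ) ∩ Ici t).encard} ∪
        {t | 2 * m < H.card ∧ m ≤ (H.filter fun c => t ≤ bot c).card}) := rfl
  rcases union_ray_Ici h1 h2 with h | ⟨a, ha, h⟩
  · left; rw [hJ, h, empty_inter]
  rcases union_ray_Iic h3 h4 with h' | ⟨b, hb, h'⟩
  · left; rw [hJ, h', inter_empty]
  · right; exact ⟨a, ha, b, hb, by rw [hJ, h, h', Ici_inter_Iic]⟩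

/-- Both endpoints of the span are dense points of `X`. If there is at most one dense point, a
nonempty span is a point of `X`, so no bridge is needed. -/
theorem spanOf_subset_of_subsingleton {ι : Type*} {m : ℕ} {X : Set ℝ} (hX : X.Finite)
    (H : Finset ι) (bot top : ι → ℝ) (hJ : (denseSet m X H bot top).Subsingleton) :
    spanOf m X ⊆ X := by
  rintro t ⟨-, a, ha, b, hb, hca, hcb, ht⟩
  have hea : (X ∩ Ici a).encard = m := by
    rw [← (hX.inter_of_left _).cast_ncard_eq, hca]
  have heb : (X ∩ Iic b).encard = m := by
    rw [← (hX.inter_of_left _).cast_ncard_eq, hcb]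
  have hba : b ≤ a := ht.1.trans ht.2
  have ha' : a ∈ denseSet m X H bot top :=
    ⟨Or.inl (heb.symm.le.trans (encard_le_encard (inter_subset_inter_right _
      (Iic_subset_Iic.2 hba)))), Or.inl hea.symm.le⟩
  have hb' : b ∈ denseSet m X H bot top :=
    ⟨Or.inl heb.symm.le, Or.inl (hea.symm.le.trans (encard_le_encard (inter_subset_inter_right _
      (Ici_subset_Ici.2 hba))))⟩
  have := hJ ha' hb'
  subst this
  have : t = a := le_antisymm ht.2 ht.1
  rwa [this]

theorem frontier_finite_union_Icc_subset {X : Set ℝ} (hX : X.Finite) (a b : ℝ) :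
    frontier (X ∪ Icc a b) ⊆ X ∪ {a, b} := by
  refine (frontier_union_subset _ _).trans (union_subset_union ?_ ?_)
  · exact inter_subset_left.trans hX.isClosed.frontier_subset
  · refine inter_subset_right.trans ?_
    rcases le_or_gt a b with h | h
    · rw [frontier_Icc h]
    · simp [Icc_eq_empty_of_lt h]

/-- The bridge changes the endpoints on the cut, so the span has to be controlled afresh. If the
`m`-th endpoint from below preceded `a`, the endpoints up to it would all belong to `X`. It would
then be dense, since density from above is inherited from `a`, contradicting the choice of `a`. The
other end is symmetric. -/
theorem spanOf_frontier_subset {ι : Type*} {m : ℕ} {X : Set ℝ} (hX : X.Finite)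
    (H : Finset ι) (bot top : ι → ℝ) {a b : ℝ} (hab : a ≤ b)
    (hJ : denseSet m X H bot top = Icc a b) :
    spanOf m (frontier (X ∪ Icc a b)) ⊆ Icc a b := by
  have hfr := frontier_finite_union_Icc_subset hX a b
  have ha : a ∈ denseSet m X H bot top := hJ ▸ left_mem_Icc.2 hab
  have hb : b ∈ denseSet m X H bot top := hJ ▸ right_mem_Icc.2 hab
  rintro t ⟨-, p, -, q, -, hp, hq, ht⟩
  have hqa : a ≤ q := by
    by_contra! hlt
    have h1 : (frontier (X ∪ Icc a b) ∩ Iic q).ncard ≤ (X ∩ Iic q).ncard := by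
      refine ncard_le_ncard ?_ (hX.inter_of_left _)
      rintro z ⟨hz, hzq⟩
      refine ⟨(hfr hz).resolve_right ?_, hzq⟩
      have hzq' : z ≤ q := hzq
      rintro (rfl | rfl) <;> linarith
    have h2 : q ∈ denseSet m X H bot top := by
      refine ⟨Or.inl ?_, ?_⟩
      · rw [← (hX.inter_of_left _).cast_ncard_eq]
        exact_mod_cast hq ▸ h1
      · rcases ha.2 with h | ⟨hk, h⟩
        · exact Or.inl (h.trans (encard_le_encard (inter_subset_inter_right _
            (Ici_subset_Ici.2 hlt.le))))
        · exact Or.inr ⟨hk, h.trans (Finset.card_le_card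
            (Finset.monotone_filter_right _ fun c _ hc => hlt.le.trans hc))⟩
    rw [hJ] at h2
    exact absurd h2.1 (not_le.2 hlt)
  have hpb : p ≤ b := by
    by_contra! hlt
    have h1 : (frontier (X ∪ Icc a b) ∩ Ici p).ncard ≤ (X ∩ Ici p).ncard := by
      refine ncard_le_ncard ?_ (hX.inter_of_left _)
      rintro z ⟨hz, hzq⟩
      refine ⟨(hfr hz).resolve_right ?_, hzq⟩
      have hzq' : p ≤ z := hzq
      rintro (rfl | rfl) <;> linarith
    have h2 : p ∈ denseSet m X H bot top := by
      refine ⟨?_, Or.inl ?_⟩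
      · rcases hb.1 with h | ⟨hk, h⟩
        · exact Or.inl (h.trans (encard_le_encard (inter_subset_inter_right _
            (Iic_subset_Iic.2 hlt.le))))
        · exact Or.inr ⟨hk, h.trans (Finset.card_le_card
            (Finset.monotone_filter_right _ fun c _ hc => le_trans hc hlt.le))⟩
      · rw [← (hX.inter_of_left _).cast_ncard_eq]
        exact_mod_cast hp ▸ h1
    rw [hJ] at h2
    exact absurd h2.2 (not_le.2 hlt)
  exact ⟨hqa.trans ht.1, ht.2.trans hpb⟩

theorem diskSpan_mem_denseSet {ι : Type*} {m : ℕ} {X : Set ℝ} {H : Finset ι} {bot top : ι → ℝ}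
    (hk : 2 * m < H.card) {a b : ι} (ha : (H.filter fun c => bot a ≤ bot c).card = m)
    (hb : (H.filter fun c => top c ≤ top b).card = m) {t : ℝ} (ht : t ∈ Icc (top b) (bot a)) :
    t ∈ denseSet m X H bot top := by
  refine ⟨Or.inr ⟨hk, ?_⟩, Or.inr ⟨hk, ?_⟩⟩
  · rw [← hb]
    exact Finset.card_le_card (Finset.monotone_filter_right _ fun c _ hc => le_trans hc ht.1)
  · rw [← ha]
    exact Finset.card_le_card (Finset.monotone_filter_right _ fun c _ hc => le_trans ht.2 hc)

/-- `z` counts the intervals having `x` in their interior, at most one by disjointness; such an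
interval is hit on both sides of `x`. -/
theorem card_filter_bot_add_card_filter_top_le {ι : Type*} {H : Finset ι} {bot top : ι → ℝ}
    (hdis : ∀ c ∈ H, ∀ c' ∈ H, c ≠ c' → top c < bot c' ∨ top c' < bot c)
    (hle : ∀ c ∈ H, bot c ≤ top c) (x : ℝ)
    (hxb : ∀ c ∈ H, x ≠ bot c) (hxt : ∀ c ∈ H, x ≠ top c) :
    ∃ z ≤ 1, (H.filter fun c => bot c ≤ x).card = (H.filter fun c => top c ≤ x).card + z ∧
      (H.filter fun c => x ≤ top c).card = (H.filter fun c => x ≤ bot c).card + z ∧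
      H.card = (H.filter fun c => top c ≤ x).card + (H.filter fun c => x ≤ bot c).card + z := by
  classical
  refine ⟨(H.filter fun c => bot c < x ∧ x < top c).card, ?_, ?_, ?_, ?_⟩
  · rw [Finset.card_le_one]
    intro c hc c' hc'
    rw [Finset.mem_filter] at hc hc'
    by_contra hne
    rcases hdis c hc.1 c' hc'.1 hne with h | h <;> linarith [hc.2.1, hc.2.2, hc'.2.1, hc'.2.2]
  · rw [← Finset.card_union_of_disjoint]
    · congr 1
      ext c
      simp only [Finset.mem_filter, Finset.mem_union]
      constructor
      · rintro ⟨hc, h⟩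
        rcases le_or_gt (top c) x with h' | h'
        · exact Or.inl ⟨hc, h'⟩
        · exact Or.inr ⟨hc, lt_of_le_of_ne h (hxb c hc).symm, h'⟩
      · rintro (⟨hc, h⟩ | ⟨hc, h, -⟩)
        · exact ⟨hc, (hle c hc).trans h⟩
        · exact ⟨hc, h.le⟩
    · rw [Finset.disjoint_filter]
      intro c _ h h'
      linarith [h'.2]
  · rw [← Finset.card_union_of_disjoint]
    · congr 1
      ext c
      simp only [Finset.mem_filter, Finset.mem_union]
      constructor
      · rintro ⟨hc, h⟩
        rcases le_or_gt x (bot c) with h' | h'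
        · exact Or.inl ⟨hc, h'⟩
        · exact Or.inr ⟨hc, h', lt_of_le_of_ne h (hxt c hc)⟩
      · rintro (⟨hc, h⟩ | ⟨hc, -, h⟩)
        · exact ⟨hc, h.trans (hle c hc)⟩
        · exact ⟨hc, h.le⟩
    · rw [Finset.disjoint_filter]
      intro c _ h h'
      linarith [h'.1]
  · rw [← Finset.card_union_of_disjoint, ← Finset.card_union_of_disjoint]
    · congr 1
      ext c
      simp only [Finset.mem_filter, Finset.mem_union]
      constructor
      · intro hc
        rcases le_or_gt (top c) x with h' | h'
        · exact Or.inl (Or.inl ⟨hc, h'⟩)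
        · rcases le_or_gt x (bot c) with h | h
          · exact Or.inl (Or.inr ⟨hc, h⟩)
          · exact Or.inr ⟨hc, h, h'⟩
      · rintro ((⟨hc, -⟩ | ⟨hc, -⟩) | ⟨hc, -⟩) <;> exact hc
    · rw [Finset.disjoint_left]
      intro c h h'
      simp only [Finset.mem_filter, Finset.mem_union] at h h'
      rcases h with h | h <;> linarith [h.2, h'.2.1, h'.2.2]
    · rw [Finset.disjoint_filter]
      intro c hc h h'
      exact hxt c hc (le_antisymm (h'.trans (hle c hc)) h)

/-- A straddling interval is counted twice after the cut, but then both sides carry an interval and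
the unit for `k ≠ 0` is also subtracted twice. -/
theorem linePotential_split {m xl xr dl dr z : ℕ} (hz : z ≤ 1) :
    linePotential m xl (dl + z) + linePotential m xr (dr + z) ≤
      linePotential m (xl + xr) (dl + dr + z) := by
  unfold linePotential
  split_ifs <;> omega

/-- Without truncation the drop by `m` is immediate, as `m` is subtracted once before and twice
after the cut. Density handles the truncated cases. If both sides have potential zero, the claim is
`2 m + [k > 0] ≤ n + k`. This holds if both sides have `m` points, and otherwise because `2 m < k`;
here the strict threshold for disks matters. -/
theorem linePotential_split_dense {m xl xr dl dr z : ℕ} (hm : 0 < m) (hz : z ≤ 1)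
    (hl : m ≤ xl ∨ (2 * m < dl + dr + z ∧ m ≤ dl)) (hr : m ≤ xr ∨ (2 * m < dl + dr + z ∧ m ≤ dr)) :
    linePotential m xl (dl + z) + linePotential m xr (dr + z) + m ≤
      linePotential m (xl + xr) (dl + dr + z) := by
  unfold linePotential
  split_ifs <;> omega

theorem linePotential_cut {ι : Type*} {m : ℕ} (hm : 0 < m) {X : Set ℝ} (hX : X.Finite)
    {H : Finset ι} {bot top : ι → ℝ}
    (hdis : ∀ c ∈ H, ∀ c' ∈ H, c ≠ c' → top c < bot c' ∨ top c' < bot c)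
    (hle : ∀ c ∈ H, bot c ≤ top c) {x : ℝ} (hxX : x ∉ X)
    (hxb : ∀ c ∈ H, x ≠ bot c) (hxt : ∀ c ∈ H, x ≠ top c) :
    linePotential m (X ∩ Iio x).ncard (H.filter fun c => bot c ≤ x).card +
        linePotential m (X ∩ Ioi x).ncard (H.filter fun c => x ≤ top c).card +
        (denseSet m X H bot top).indicator (fun _ => m) x ≤
      linePotential m X.ncard H.card := by
  obtain ⟨z, hz, h1, h2, h3⟩ := card_filter_bot_add_card_filter_top_le hdis hle x hxb hxt
  have hXl : X ∩ Iic x = X ∩ Iio x := by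
    ext y
    refine and_congr_right fun hy => ⟨fun h => mem_Iio.2 (lt_of_le_of_ne h ?_), fun h => Iio_subset_Iic_self h⟩
    rintro rfl; exact hxX hy
  have hXr : X ∩ Ici x = X ∩ Ioi x := by
    ext y
    refine and_congr_right fun hy => ⟨fun h => mem_Ioi.2 (lt_of_le_of_ne h ?_), fun h => Ioi_subset_Ici_self h⟩
    rintro rfl; exact hxX hy
  have hXn : X.ncard = (X ∩ Iio x).ncard + (X ∩ Ioi x).ncard := by
    rw [← hXr, ← ncard_union_eq _ (hX.inter_of_left _) (hX.inter_of_left _), ← inter_union_distrib_left,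
      Iio_union_Ici, inter_univ]
    exact disjoint_left.2 fun y hy hy' => not_lt_of_ge (mem_Ici.1 hy'.2) (mem_Iio.1 hy.2)
  rw [h1, h2, h3, hXn]
  by_cases hx : x ∈ denseSet m X H bot top
  · rw [indicator_of_mem hx]
    obtain ⟨hl, hr⟩ := hx
    rw [hXl, ← (hX.inter_of_left _).cast_ncard_eq, Nat.cast_le, h3] at hl
    rw [hXr, ← (hX.inter_of_left _).cast_ncard_eq, Nat.cast_le, h3] at hr
    exact linePotential_split_dense hm hz hl hr
  · rw [indicator_of_notMem hx, add_zero]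
    exact linePotential_split hz

/-! ### Chords of disks and generic lines. -/

/-- The lower end of the chord of a disk on the line `{p | p i = s}`. -/
def chordLow (δ : ℝ) (i : Fin 2) (s : ℝ) (c : Plane) : ℝ :=
  c (1 - i) - Real.sqrt (δ ^ 2 - (s - c i) ^ 2)

/-- The upper end of the chord of a disk on the line `{p | p i = s}`. -/
def chordHigh (δ : ℝ) (i : Fin 2) (s : ℝ) (c : Plane) : ℝ :=
  c (1 - i) + Real.sqrt (δ ^ 2 - (s - c i) ^ 2)

open Classical in
/-- The disks whose chord on the line `{p | p i = s}` meets `[l, h]`. -/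
def chordsHit (D : Finset Plane) (δ : ℝ) (i : Fin 2) (s l h : ℝ) : Finset Plane :=
  D.filter fun c => |s - c i| ≤ δ ∧ chordLow δ i s c ≤ h ∧ l ≤ chordHigh δ i s c

theorem one_sub_one_sub (i : Fin 2) : 1 - (1 - i) = i := by
  fin_cases i <;> rfl

theorem chordLow_le_chordHigh (δ : ℝ) (i : Fin 2) (s : ℝ) (c : Plane) :
    chordLow δ i s c ≤ chordHigh δ i s c := by
  unfold chordLow chordHigh
  linarith [Real.sqrt_nonneg (δ ^ 2 - (s - c i) ^ 2)]

theorem mem_slice_closedBall_iff {δ : ℝ} (hδ : 0 < δ) (i : Fin 2) (s t : ℝ) (c : Plane) :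
    t ∈ slice i s (closedBall c δ) ↔
      |s - c i| ≤ δ ∧ chordLow δ i s c ≤ t ∧ t ≤ chordHigh δ i s c := by
  change linePoint i s t ∈ closedBall c δ ↔ _
  rw [mem_closedBall_iff _ _ _ _ _ hδ.le]
  unfold chordLow chordHigh
  constructor
  · intro h
    have h1 : |s - c i| ≤ δ := abs_le_of_sq_le_sq (by nlinarith [sq_nonneg (t - c (1 - i))]) hδ.le
    have h2 := abs_le.1 (Real.abs_le_sqrt (by linarith :
      (t - c (1 - i)) ^ 2 ≤ δ ^ 2 - (s - c i) ^ 2))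
    exact ⟨h1, by linarith [h2.1], by linarith [h2.2]⟩
  · rintro ⟨h1, h2, h3⟩
    have h4 : 0 ≤ δ ^ 2 - (s - c i) ^ 2 := by nlinarith [abs_le.1 h1]
    have h5 := Real.sq_sqrt h4
    have h6 : (t - c (1 - i)) ^ 2 ≤ Real.sqrt (δ ^ 2 - (s - c i) ^ 2) ^ 2 :=
      sq_le_sq' (by linarith) (by linarith)
    linarith

theorem slice_closedBall {δ : ℝ} (hδ : 0 < δ) {i : Fin 2} {s : ℝ} {c : Plane}
    (h : |s - c i| ≤ δ) :
    slice i s (closedBall c δ) = Icc (chordLow δ i s c) (chordHigh δ i s c) := by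
  ext t
  rw [mem_slice_closedBall_iff hδ]
  simp [h]

theorem chordBot_eq {δ : ℝ} (hδ : 0 < δ) {i : Fin 2} {s : ℝ} {c : Plane} (h : |s - c i| ≤ δ) :
    chordBot δ i s c = chordLow δ i s c := by
  rw [chordBot, slice_closedBall hδ h, csInf_Icc (chordLow_le_chordHigh _ _ _ _)]

theorem chordTop_eq {δ : ℝ} (hδ : 0 < δ) {i : Fin 2} {s : ℝ} {c : Plane} (h : |s - c i| ≤ δ) :
    chordTop δ i s c = chordHigh δ i s c := by
  rw [chordTop, slice_closedBall hδ h, csSup_Icc (chordLow_le_chordHigh _ _ _ _)]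

theorem linePoint_mem_window_iff {lo hi : Fin 2 → ℝ} (i : Fin 2) (s t : ℝ) :
    linePoint i s t ∈ window lo hi ↔
      (lo i ≤ s ∧ s ≤ hi i) ∧ lo (1 - i) ≤ t ∧ t ≤ hi (1 - i) := by
  change (∀ k, _) ↔ _
  rw [Fin.forall_fin_two]
  fin_cases i <;> simp [linePoint, and_comm]

theorem disksHit_eq {D : Finset Plane} {δ : ℝ} (hδ : 0 < δ) {lo hi : Fin 2 → ℝ} {i : Fin 2}
    {s : ℝ} (hs : s ∈ Icc (lo i) (hi i)) (hw : lo (1 - i) ≤ hi (1 - i)) :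
    disksHit D δ lo hi i s = chordsHit D δ i s (lo (1 - i)) (hi (1 - i)) := by
  ext c
  rw [chordsHit, Finset.coe_filter]
  refine and_congr_right fun _ => ?_
  constructor
  · rintro ⟨t, ht1, ht2⟩
    have h1 := (mem_slice_closedBall_iff hδ i s t c).1 ht1
    have h2 := (linePoint_mem_window_iff i s t).1 ht2
    exact ⟨h1.1, h1.2.1.trans h2.2.2, h2.2.1.trans h1.2.2⟩
  · rintro ⟨h1, h2, h3⟩
    refine ⟨max (lo (1 - i)) (chordLow δ i s c), (mem_slice_closedBall_iff hδ i s _ c).2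
      ⟨h1, le_max_right _ _, max_le h3 (chordLow_le_chordHigh _ _ _ _)⟩,
      (linePoint_mem_window_iff i s _).2 ⟨hs, le_max_left _ _, max_le hw h2⟩⟩

theorem chords_separated {D : Finset Plane} {δ : ℝ} (hδ : 0 < δ)
    (hdisj : (D : Set Plane).PairwiseDisjoint fun c => closedBall c δ) (i : Fin 2) (s l h : ℝ) :
    ∀ c ∈ chordsHit D δ i s l h, ∀ c' ∈ chordsHit D δ i s l h, c ≠ c' →
      chordHigh δ i s c < chordLow δ i s c' ∨ chordHigh δ i s c' < chordLow δ i s c := by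
  intro c hc c' hc' hne
  rw [chordsHit, Finset.mem_filter] at hc hc'
  by_contra! hcon
  have h1 : max (chordLow δ i s c) (chordLow δ i s c') ∈ slice i s (closedBall c δ) :=
    (mem_slice_closedBall_iff hδ _ _ _ _).2
      ⟨hc.2.1, le_max_left _ _, max_le (chordLow_le_chordHigh _ _ _ _) hcon.1⟩
  have h2 : max (chordLow δ i s c) (chordLow δ i s c') ∈ slice i s (closedBall c' δ) :=
    (mem_slice_closedBall_iff hδ _ _ _ _).2
      ⟨hc'.2.1, le_max_right _ _, max_le hcon.2 (chordLow_le_chordHigh _ _ _ _)⟩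
  exact disjoint_left.1 (hdisj hc.1 hc'.1 hne) h1 h2

/-- The points of the line `{p | p i = s}` between `l` and `h` that are dense for `E` and `D`. -/
def lineDense (m : ℕ) (E : Set Plane) (D : Finset Plane) (δ : ℝ) (i : Fin 2) (s l h : ℝ) : Set ℝ :=
  denseSet m (slice i s E ∩ Ioo l h) (chordsHit D δ i s l h) (chordLow δ i s) (chordHigh δ i s)

/-- The potential of the part of the line `{p | p i = s}` between `l` and `h`. -/
def potentialOn (m : ℕ) (E : Set Plane) (D : Finset Plane) (δ : ℝ) (i : Fin 2) (s l h : ℝ) : ℕ :=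
  linePotential m (slice i s E ∩ Ioo l h).ncard (chordsHit D δ i s l h).card

/-- The chords that meet a part of the line are those of the whole that reach beyond `x` on that
side. Avoiding `E` and the circles at `x` provides the general position required by
`linePotential_cut`. -/
theorem potentialOn_cut {m : ℕ} (hm : 0 < m) {E : Set Plane} {D : Finset Plane} {δ : ℝ}
    (hδ : 0 < δ) (hdisj : (D : Set Plane).PairwiseDisjoint fun c => closedBall c δ)
    {i : Fin 2} {s l x h : ℝ} (hlx : l < x) (hxh : x < h) (hfin : (slice i s E).Finite)
    (hxE : x ∉ slice i s E) (hxD : ∀ c ∈ D, (s - c i) ^ 2 + (x - c (1 - i)) ^ 2 ≠ δ ^ 2) :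
    potentialOn m E D δ i s l x + potentialOn m E D δ i s x h +
      (lineDense m E D δ i s l h).indicator (fun _ => m) x ≤ potentialOn m E D δ i s l h := by
  have hends : ∀ c ∈ chordsHit D δ i s l h, x ≠ chordLow δ i s c ∧ x ≠ chordHigh δ i s c := by
    intro c hc
    rw [chordsHit, Finset.mem_filter] at hc
    have h4 : 0 ≤ δ ^ 2 - (s - c i) ^ 2 := by nlinarith [abs_le.1 hc.2.1]
    have h5 := Real.sq_sqrt h4
    unfold chordLow chordHigh
    constructor
    · rintro rfl
      apply hxD c hc.1
      ring_nf at h5 ⊢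
      linarith
    · rintro rfl
      apply hxD c hc.1
      ring_nf at h5 ⊢
      linarith
  have key := linePotential_cut (m := m) hm (X := slice i s E ∩ Ioo l h)
    (hfin.inter_of_left _) (H := chordsHit D δ i s l h) (bot := chordLow δ i s)
    (top := chordHigh δ i s) (chords_separated hδ hdisj i s l h)
    (fun c _ => chordLow_le_chordHigh _ _ _ _) (x := x) (fun hx => hxE hx.1)
    (fun c hc => (hends c hc).1) (fun c hc => (hends c hc).2)
  have e1 : slice i s E ∩ Ioo l h ∩ Iio x = slice i s E ∩ Ioo l x := by
    rw [inter_assoc]; congr 1; ext y; simp only [mem_inter_iff, mem_Ioo, mem_Iio]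
    constructor
    · rintro ⟨⟨a, b⟩, c⟩; exact ⟨a, c⟩
    · rintro ⟨a, b⟩; exact ⟨⟨a, b.trans hxh⟩, b⟩
  have e2 : slice i s E ∩ Ioo l h ∩ Ioi x = slice i s E ∩ Ioo x h := by
    rw [inter_assoc]; congr 1; ext y; simp only [mem_inter_iff, mem_Ioo, mem_Ioi]
    constructor
    · rintro ⟨⟨a, b⟩, c⟩; exact ⟨c, b⟩
    · rintro ⟨a, b⟩; exact ⟨⟨hlx.trans a, b⟩, a⟩
  have e3 : (chordsHit D δ i s l h).filter (fun c => chordLow δ i s c ≤ x) =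
      chordsHit D δ i s l x := by
    ext c
    simp only [chordsHit, Finset.mem_filter]
    constructor
    · rintro ⟨⟨a, b, -, d⟩, e⟩; exact ⟨a, b, e, d⟩
    · rintro ⟨a, b, e, d⟩; exact ⟨⟨a, b, e.trans hxh.le, d⟩, e⟩
  have e4 : (chordsHit D δ i s l h).filter (fun c => x ≤ chordHigh δ i s c) =
      chordsHit D δ i s x h := by
    ext c
    simp only [chordsHit, Finset.mem_filter]
    constructor
    · rintro ⟨⟨a, b, d, -⟩, e⟩; exact ⟨a, b, d, e⟩
    · rintro ⟨a, b, d, e⟩; exact ⟨⟨a, b, d, hlx.le.trans e⟩, e⟩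
  rw [e1, e2, e3, e4] at key
  exact key

/-- A line that meets `E` in finitely many points, is tangent to no disk, and meets no circle in
the coordinates `l` and `h`. -/
def IsGenericLine (E : Set Plane) (D : Finset Plane) (δ : ℝ) (i : Fin 2) (s l h : ℝ) : Prop :=
  (slice i s E).Finite ∧ ∀ c ∈ D, |s - c i| ≠ δ ∧ (s - c i) ^ 2 + (l - c (1 - i)) ^ 2 ≠ δ ^ 2 ∧
    (s - c i) ^ 2 + (h - c (1 - i)) ^ 2 ≠ δ ^ 2

theorem ae_sq_sub_ne (a b : ℝ) : ∀ᵐ s : ℝ, (s - a) ^ 2 ≠ b := by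
  have h : {s : ℝ | (s - a) ^ 2 = b} ⊆ {a + Real.sqrt b, a - Real.sqrt b} := by
    rintro s rfl
    rw [Real.sqrt_sq_eq_abs]
    rcases abs_choice (s - a) with h | h <;> rw [h] <;> simp
  have h0 : volume {s : ℝ | (s - a) ^ 2 = b} = 0 :=
    measure_mono_null h ((Set.toFinite _).measure_zero _)
  rw [ae_iff]
  simpa using h0

theorem ae_isGenericLine {E : Set Plane} {i : Fin 2} (hE : ∀ᵐ s, (slice i s E).Finite)
    (D : Finset Plane) (δ l h : ℝ) : ∀ᵐ s, IsGenericLine E D δ i s l h := by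
  refine hE.and ?_
  rw [eventually_all_finset]
  intro c _
  filter_upwards [ae_sq_sub_ne (c i) (δ ^ 2), ae_sq_sub_ne (c i) (δ ^ 2 - (l - c (1 - i)) ^ 2),
    ae_sq_sub_ne (c i) (δ ^ 2 - (h - c (1 - i)) ^ 2)] with s h1 h2 h3
  refine ⟨fun h => h1 ?_, fun h => h2 (by linarith), fun h' => h3 (by linarith)⟩
  rw [← h, sq_abs]

/-- A generic line has no chord ending exactly at `l` or `h`, which makes the inequalities strict.
Bridges therefore stay in the open window. -/
theorem IsGenericLine.lineDense_eq {m : ℕ} (hm : 0 < m) {E : Set Plane} {D : Finset Plane} {δ : ℝ}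
    {i : Fin 2} {s l h : ℝ} (hs : IsGenericLine E D δ i s l h) :
    lineDense m E D δ i s l h = ∅ ∨ ∃ a b, l < a ∧ b < h ∧
      lineDense m E D δ i s l h = Icc a b := by
  rcases denseSet_eq_empty_or_Icc hm (hs.1.inter_of_left (Ioo l h)) (chordsHit D δ i s l h)
    (chordLow δ i s) (chordHigh δ i s) with h0 | ⟨a, ha, b, hb, hab⟩
  · exact Or.inl h0
  · refine Or.inr ⟨a, b, ?_, ?_, hab⟩
    · rcases ha with ha | ⟨c, hc, rfl⟩
      · exact ha.2.1
      · have hc' := Finset.mem_coe.1 hc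
        rw [chordsHit, Finset.mem_filter] at hc'
        refine lt_of_le_of_ne hc'.2.2.2 fun heq => (hs.2 c hc'.1).2.1 ?_
        have h5 := Real.sq_sqrt (by nlinarith [abs_le.1 hc'.2.1] : 0 ≤ δ ^ 2 - (s - c i) ^ 2)
        rw [heq]
        unfold chordHigh
        rw [add_sub_cancel_left]
        linarith
    · rcases hb with hb | ⟨c, hc, rfl⟩
      · exact hb.2.2
      · have hc' := Finset.mem_coe.1 hc
        rw [chordsHit, Finset.mem_filter] at hc'
        refine lt_of_le_of_ne hc'.2.2.1 fun heq => (hs.2 c hc'.1).2.2 ?_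
        have h5 := Real.sq_sqrt (by nlinarith [abs_le.1 hc'.2.1] : 0 ≤ δ ^ 2 - (s - c i) ^ 2)
        rw [← heq]
        unfold chordLow
        rw [sub_sub_cancel_left, neg_sq]
        linarith

theorem IsGenericLine.lineDense_subset {m : ℕ} (hm : 0 < m) {E : Set Plane} {D : Finset Plane}
    {δ : ℝ} {i : Fin 2} {s l h : ℝ} (hs : IsGenericLine E D δ i s l h) :
    lineDense m E D δ i s l h ⊆ Ioo l h := by
  rcases hs.lineDense_eq hm with h0 | ⟨a, b, ha, hb, hab⟩
  · rw [h0]; exact empty_subset _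
  · rw [hab]; exact Icc_subset_Ioo ha hb

/-! ### Measurability of potentials and dense sets. -/

theorem measurable_chordLow (δ : ℝ) (i : Fin 2) (c : Plane) :
    Measurable fun s => chordLow δ i s c := by
  unfold chordLow; fun_prop

theorem measurable_chordHigh (δ : ℝ) (i : Fin 2) (c : Plane) :
    Measurable fun s => chordHigh δ i s c := by
  unfold chordHigh; fun_prop

theorem measurable_card_filter {α ι : Type*} [MeasurableSpace α] (A : Finset ι)
    (P : α → ι → Prop) [∀ a, DecidablePred (P a)] (hP : ∀ c, MeasurableSet {a | P a c}) :
    Measurable fun a => (A.filter (P a)).card := by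
  simp only [Finset.card_filter]
  exact Finset.measurable_fun_sum _ fun c _ => Measurable.ite (hP c) measurable_const
    measurable_const

theorem measurableSet_hit (δ : ℝ) (i : Fin 2) (l h : ℝ) (c : Plane) :
    MeasurableSet {s | |s - c i| ≤ δ ∧ chordLow δ i s c ≤ h ∧ l ≤ chordHigh δ i s c} := by
  refine (measurableSet_le (by fun_prop : Continuous fun s : ℝ => |s - c i|).measurable
    measurable_const).inter
    ((measurableSet_le (measurable_chordLow δ i c) measurable_const).inter
      (measurableSet_le measurable_const (measurable_chordHigh δ i c)))

theorem measurable_card_chordsHit (D : Finset Plane) (δ : ℝ) (i : Fin 2) (l h : ℝ) :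
    Measurable fun s => (chordsHit D δ i s l h).card := by
  classical
  unfold chordsHit
  exact measurable_card_filter D _ (measurableSet_hit δ i l h)

theorem measurable_encard_slice_Ioo {E : Set Plane} (hE : IsCompact E) (i : Fin 2) (l h : ℝ) :
    Measurable fun s => (slice i s E ∩ Ioo l h).encard := by
  simpa only [univ_inter] using measurable_encard_slice_inter hE i isClosed_univ (isOpen_Ioo (a := l) (b := h))

theorem measurable_potentialOn {E : Set Plane} (hE : IsCompact E) (m : ℕ) (D : Finset Plane)
    (δ : ℝ) (i : Fin 2) (l h : ℝ) : Measurable fun s => potentialOn m E D δ i s l h := by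
  have h1 : Measurable fun s => (slice i s E ∩ Ioo l h).ncard :=
    (Measurable.of_discrete (f := ENat.toNat)).comp (measurable_encard_slice_Ioo hE i l h)
  exact (Measurable.of_discrete (f := fun p : ℕ × ℕ => linePotential m p.1 p.2)).comp
    (h1.prodMk (measurable_card_chordsHit D δ i l h))

theorem measurableSet_finite_slice {E : Set Plane} (hE : IsCompact E) (i : Fin 2) :
    MeasurableSet {s | (slice i s E).Finite} := by
  have h := measurable_encard_slice_inter hE i isClosed_univ isOpen_univ
  simp only [inter_univ] at h
  have := h (MeasurableSet.of_discrete (s := Iio (⊤ : ℕ∞)))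
  convert this using 1
  ext s
  simp [encard_lt_top_iff]

/-- For finite `X` the count up to `t` is right-continuous in `t`, so rational thresholds suffice.
They turn the condition into a countable intersection of measurable ones. -/
theorem le_encard_inter_Iic_iff {X : Set ℝ} (hX : X.Finite) (m : ℕ) (t : ℝ) :
    (m : ℕ∞) ≤ (X ∩ Iic t).encard ↔ ∀ q : ℚ, t < q → (m : ℕ∞) ≤ (X ∩ Iic (q : ℝ)).encard := by
  constructor
  · intro h q hq
    exact h.trans (encard_le_encard (inter_subset_inter_right _ (Iic_subset_Iic.2 hq.le)))
  · intro h
    obtain ⟨u, hu, hXu⟩ : ∃ u > t, ∀ x ∈ X, x < u → x ≤ t := by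
      have : ∀ᶠ u in 𝓝[>] t, ∀ x ∈ X, x < u → x ≤ t := by
        rw [eventually_all_finite hX]
        intro x _
        rcases le_or_gt x t with hx | hx
        · exact Eventually.of_forall fun _ _ => hx
        · filter_upwards [Ioo_mem_nhdsGT hx] with u hu hxu
          exact absurd hxu (not_lt.2 hu.2.le)
      obtain ⟨u, hu, hu'⟩ := (this.and self_mem_nhdsWithin).exists
      exact ⟨u, hu', hu⟩
    obtain ⟨q, hq1, hq2⟩ := exists_rat_btwn hu
    refine (h q hq1).trans (encard_le_encard ?_)
    rintro x ⟨hx, hxq⟩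
    exact ⟨hx, hXu x hx (lt_of_le_of_lt hxq hq2)⟩

theorem le_encard_inter_Ici_iff {X : Set ℝ} (hX : X.Finite) (m : ℕ) (t : ℝ) :
    (m : ℕ∞) ≤ (X ∩ Ici t).encard ↔ ∀ q : ℚ, (q : ℝ) < t → (m : ℕ∞) ≤ (X ∩ Ici (q : ℝ)).encard := by
  constructor
  · intro h q hq
    exact h.trans (encard_le_encard (inter_subset_inter_right _ (Ici_subset_Ici.2 hq.le)))
  · intro h
    obtain ⟨u, hu, hXu⟩ : ∃ u < t, ∀ x ∈ X, u < x → t ≤ x := by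
      have : ∀ᶠ u in 𝓝[<] t, ∀ x ∈ X, u < x → t ≤ x := by
        rw [eventually_all_finite hX]
        intro x _
        rcases le_or_gt t x with hx | hx
        · exact Eventually.of_forall fun _ _ => hx
        · filter_upwards [Ioo_mem_nhdsLT hx] with u hu hxu
          exact absurd hxu (not_lt.2 hu.1.le)
      obtain ⟨u, hu, hu'⟩ := (this.and self_mem_nhdsWithin).exists
      exact ⟨u, hu', hu⟩
    obtain ⟨q, hq1, hq2⟩ := exists_rat_btwn hu
    refine (h q hq2).trans (encard_le_encard ?_)
    rintro x ⟨hx, hxq⟩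
    exact ⟨hx, hXu x hx (lt_of_lt_of_le hq1 hxq)⟩

theorem measurableSet_lineDense {E : Set Plane} (hE : IsCompact E) (m : ℕ) (D : Finset Plane)
    (δ : ℝ) (i : Fin 2) (l h : ℝ) :
    MeasurableSet {x : ℝ × ℝ | (slice i x.1 E).Finite ∧ x.2 ∈ lineDense m E D δ i x.1 l h} := by
  classical
  have hF : MeasurableSet {x : ℝ × ℝ | (slice i x.1 E).Finite} :=
    (measurableSet_finite_slice hE i).preimage measurable_fst
  have hlow : MeasurableSet {x : ℝ × ℝ | ∀ q : ℚ, x.2 < q →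
      (m : ℕ∞) ≤ (slice i x.1 E ∩ Ioo l h ∩ Iic (q : ℝ)).encard} := by
    rw [ofPred_forall]
    refine MeasurableSet.iInter fun q => ?_
    have h1 := measurable_encard_slice_inter hE i (isClosed_Iic (a := (q : ℝ)))
      (isOpen_Ioo (a := l) (b := h))
    have h2 : MeasurableSet {x : ℝ × ℝ |
        (m : ℕ∞) ≤ (slice i x.1 E ∩ (Iic (q : ℝ) ∩ Ioo l h)).encard} :=
      (h1.comp measurable_fst) (MeasurableSet.of_discrete (s := Ici (m : ℕ∞)))
    have h3 : MeasurableSet {x : ℝ × ℝ | x.2 < q} :=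
      measurableSet_lt measurable_snd measurable_const
    convert h3.compl.union h2 using 1
    ext x
    simp only [mem_ofPred_eq, mem_union, mem_compl_iff, inter_assoc, inter_comm (Ioo l h),
      imp_iff_not_or]
  have hhigh : MeasurableSet {x : ℝ × ℝ | ∀ q : ℚ, (q : ℝ) < x.2 →
      (m : ℕ∞) ≤ (slice i x.1 E ∩ Ioo l h ∩ Ici (q : ℝ)).encard} := by
    rw [ofPred_forall]
    refine MeasurableSet.iInter fun q => ?_
    have h1 := measurable_encard_slice_inter hE i (isClosed_Ici (a := (q : ℝ)))
      (isOpen_Ioo (a := l) (b := h))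
    have h2 : MeasurableSet {x : ℝ × ℝ |
        (m : ℕ∞) ≤ (slice i x.1 E ∩ (Ici (q : ℝ) ∩ Ioo l h)).encard} :=
      (h1.comp measurable_fst) (MeasurableSet.of_discrete (s := Ici (m : ℕ∞)))
    have h3 : MeasurableSet {x : ℝ × ℝ | (q : ℝ) < x.2} :=
      measurableSet_lt measurable_const measurable_snd
    convert h3.compl.union h2 using 1
    ext x
    simp only [mem_ofPred_eq, mem_union, mem_compl_iff, inter_assoc, inter_comm (Ioo l h),
      imp_iff_not_or]
  have hk : MeasurableSet {x : ℝ × ℝ | 2 * m < (chordsHit D δ i x.1 l h).card} :=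
    ((measurable_card_chordsHit D δ i l h).comp measurable_fst)
      (MeasurableSet.of_discrete (s := Ioi (2 * m)))
  have hdl : MeasurableSet {x : ℝ × ℝ |
      m ≤ ((chordsHit D δ i x.1 l h).filter fun c => chordHigh δ i x.1 c ≤ x.2).card} := by
    simp only [chordsHit, Finset.filter_filter]
    refine measurable_card_filter D _ (fun c => ?_) (MeasurableSet.of_discrete (s := Ici m))
    exact ((measurableSet_hit δ i l h c).preimage measurable_fst).inter
      (measurableSet_le ((measurable_chordHigh δ i c).comp measurable_fst) measurable_snd)
  have hdr : MeasurableSet {x : ℝ × ℝ |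
      m ≤ ((chordsHit D δ i x.1 l h).filter fun c => x.2 ≤ chordLow δ i x.1 c).card} := by
    simp only [chordsHit, Finset.filter_filter]
    refine measurable_card_filter D _ (fun c => ?_) (MeasurableSet.of_discrete (s := Ici m))
    exact ((measurableSet_hit δ i l h c).preimage measurable_fst).inter
      (measurableSet_le measurable_snd ((measurable_chordLow δ i c).comp measurable_fst))
  convert hF.inter ((hlow.union (hk.inter hdl)).inter (hhigh.union (hk.inter hdr))) using 1
  ext x
  refine and_congr_right fun hx => ?_
  have hX := (show (slice i x.1 E).Finite from hx).inter_of_left (Ioo l h)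
  change (_ ∨ _) ∧ (_ ∨ _) ↔ (_ ∨ _) ∧ (_ ∨ _)
  rw [le_encard_inter_Iic_iff hX, le_encard_inter_Ici_iff hX]
  rfl

/-! ### Potentials of strips. -/

/-- The integral of the potentials of the lines `{p | p i = s}`, `a < s < b`, between `l` and `h`. -/
def stripPotential (m : ℕ) (E : Set Plane) (D : Finset Plane) (δ : ℝ) (i : Fin 2) (a b l h : ℝ) :
    ℝ≥0∞ :=
  ∫⁻ s in Ioo a b, (potentialOn m E D δ i s l h : ℝ≥0∞)

/-- The length of the set of points with coordinate `t` that are dense on their line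
`{p | p i = s}`, `a < s < b`. -/
def crossLength (m : ℕ) (E : Set Plane) (D : Finset Plane) (δ : ℝ) (i : Fin 2) (a b l h t : ℝ) :
    ℝ≥0∞ :=
  volume {s | s ∈ Ioo a b ∧ (slice i s E).Finite ∧ t ∈ lineDense m E D δ i s l h}

theorem mem_slice_comm (i : Fin 2) (s t : ℝ) (E : Set Plane) :
    t ∈ slice i s E ↔ s ∈ slice (1 - i) t E := by
  change linePoint i s t ∈ E ↔ linePoint (1 - i) t s ∈ E
  rw [linePoint_other]

theorem measurableSet_cross {E : Set Plane} (hE : IsCompact E) (m : ℕ) (D : Finset Plane) (δ : ℝ)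
    (i : Fin 2) (a b l h t : ℝ) :
    MeasurableSet {s | s ∈ Ioo a b ∧ (slice i s E).Finite ∧ t ∈ lineDense m E D δ i s l h} :=
  measurableSet_Ioo.inter
    ((measurableSet_lineDense hE m D δ i l h).preimage (measurable_id.prodMk measurable_const))

/-- This is `potentialOn_cut` integrated over the lines crossing the cut. Since the cut meets `E`
and the circles in finitely many points, almost every crossing line avoids them there. -/
theorem stripPotential_cut {m : ℕ} (hm : 0 < m) {E : Set Plane} (hE : IsCompact E)
    {D : Finset Plane} {δ : ℝ} (hδ : 0 < δ)
    (hdisj : (D : Set Plane).PairwiseDisjoint fun c => closedBall c δ) {i : Fin 2}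
    (hfin : ∀ᵐ s, (slice i s E).Finite) {a b l x h : ℝ} (hlx : l < x) (hxh : x < h)
    (hx : (slice (1 - i) x E).Finite) :
    stripPotential m E D δ i a b l x + stripPotential m E D δ i a b x h +
      m * crossLength m E D δ i a b l h x ≤ stripPotential m E D δ i a b l h := by
  have hpm : ∀ l h, Measurable fun s => (potentialOn m E D δ i s l h : ℝ≥0∞) := fun l h =>
    (Measurable.of_discrete (f := fun n : ℕ => (n : ℝ≥0∞))).comp (measurable_potentialOn hE m D δ i l h)
  have hset := measurableSet_cross hE m D δ i a b l h x
  set A := {s | s ∈ Ioo a b ∧ (slice i s E).Finite ∧ x ∈ lineDense m E D δ i s l h}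
  have hg : m * crossLength m E D δ i a b l h x = ∫⁻ s in Ioo a b, A.indicator (fun _ => (m : ℝ≥0∞)) s := by
    rw [lintegral_indicator hset, setLIntegral_const, Measure.restrict_apply hset,
      inter_eq_left.2 (fun s hs => hs.1)]
    rfl
  rw [hg, stripPotential, stripPotential, stripPotential, ← lintegral_add_left (hpm l x),
    ← lintegral_add_right _ (measurable_const.indicator hset)]
  refine setLIntegral_mono_ae' measurableSet_Ioo ?_
  have h1 : ∀ᵐ s, s ∉ slice (1 - i) x E := by
    rw [ae_iff]; simpa using hx.measure_zero volume
  have h2 : ∀ᵐ s, ∀ c ∈ D, (s - c i) ^ 2 + (x - c (1 - i)) ^ 2 ≠ δ ^ 2 := by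
    rw [eventually_all_finset]
    intro c _
    filter_upwards [ae_sq_sub_ne (c i) (δ ^ 2 - (x - c (1 - i)) ^ 2)] with s hs h
    exact hs (by linarith)
  filter_upwards [hfin, h1, h2] with s hs1 hs2 hs3 hsI
  have key := potentialOn_cut hm hδ hdisj hlx hxh hs1
    (fun h => hs2 ((mem_slice_comm i s x E).1 h)) hs3
  have hind : A.indicator (fun _ => (m : ℝ≥0∞)) s =
      (((lineDense m E D δ i s l h).indicator (fun _ => m) x : ℕ) : ℝ≥0∞) := by
    by_cases hd : x ∈ lineDense m E D δ i s l h
    · rw [indicator_of_mem hd, indicator_of_mem (show s ∈ A from ⟨hsI, hs1, hd⟩)]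
    · rw [indicator_of_notMem hd, indicator_of_notMem (fun h : s ∈ A => hd h.2.2)]
      simp
  rw [hind]
  exact_mod_cast key

theorem stripPotential_split (m : ℕ) (E : Set Plane) (D : Finset Plane) (δ : ℝ) (i : Fin 2)
    {a x b : ℝ} (hax : a ≤ x) (hxb : x ≤ b) (l h : ℝ) :
    stripPotential m E D δ i a x l h + stripPotential m E D δ i x b l h ≤
      stripPotential m E D δ i a b l h := by
  unfold stripPotential
  rw [← lintegral_union measurableSet_Ioo]
  · exact lintegral_mono_set (union_subset (Ioo_subset_Ioo_right hxb) (Ioo_subset_Ioo_left hax))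
  · exact disjoint_left.2 fun s hs hs' => lt_asymm hs.2 hs'.1

/-- Tonelli for the planar set of points that are dense on their line of direction `i`: sliced along
these lines it yields costs, sliced across them it yields gains. -/
theorem lintegral_volume_lineDense {m : ℕ} (hm : 0 < m) {E : Set Plane} (hE : IsCompact E)
    (D : Finset Plane) (δ : ℝ) {i : Fin 2} (hfin : ∀ᵐ s, (slice i s E).Finite) (a b l h : ℝ) :
    ∫⁻ s in Ioo a b, volume (lineDense m E D δ i s l h) =
      ∫⁻ t in Ioo l h, crossLength m E D δ i a b l h t := by
  have hA : MeasurableSet {x : ℝ × ℝ | (x.1 ∈ Ioo a b ∧ x.2 ∈ Ioo l h) ∧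
      (slice i x.1 E).Finite ∧ x.2 ∈ lineDense m E D δ i x.1 l h} :=
    ((measurableSet_Ioo.preimage measurable_fst).inter
      (measurableSet_Ioo.preimage measurable_snd)).inter (measurableSet_lineDense hE m D δ i l h)
  set A := {x : ℝ × ℝ | (x.1 ∈ Ioo a b ∧ x.2 ∈ Ioo l h) ∧
      (slice i x.1 E).Finite ∧ x.2 ∈ lineDense m E D δ i x.1 l h}
  have h1 : (volume.prod volume) A = ∫⁻ s in Ioo a b, volume (lineDense m E D δ i s l h) := by
    rw [Measure.prod_apply hA, ← lintegral_indicator measurableSet_Ioo]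
    refine lintegral_congr_ae ?_
    filter_upwards [ae_isGenericLine hfin D δ l h] with s hs
    by_cases hsI : s ∈ Ioo a b
    · rw [indicator_of_mem hsI]
      congr 1
      ext t
      exact ⟨fun h => h.2.2, fun h => ⟨⟨hsI, hs.lineDense_subset hm h⟩, hs.1, h⟩⟩
    · rw [indicator_of_notMem hsI]
      have : Prod.mk s ⁻¹' A = ∅ := by
        rw [eq_empty_iff_forall_notMem]
        exact fun t ht => hsI ht.1.1
      rw [this, measure_empty]
  have h2 : (volume.prod volume) A = ∫⁻ t in Ioo l h, crossLength m E D δ i a b l h t := by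
    rw [Measure.prod_apply_symm hA, ← lintegral_indicator measurableSet_Ioo]
    refine lintegral_congr fun t => ?_
    by_cases htI : t ∈ Ioo l h
    · rw [indicator_of_mem htI, crossLength]
      congr 1
      ext s
      exact ⟨fun h => ⟨h.1.1, h.2⟩, fun h => ⟨⟨h.1, htI⟩, h.2⟩⟩
    · rw [indicator_of_notMem htI]
      have : (fun s => (s, t)) ⁻¹' A = ∅ := by
        rw [eq_empty_iff_forall_notMem]
        exact fun s hs => htI hs.1.2
      rw [this, measure_empty]
  rw [← h1, h2]

theorem crossLength_le (m : ℕ) (E : Set Plane) (D : Finset Plane) (δ : ℝ) (i : Fin 2)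
    (a b l h t : ℝ) : crossLength m E D δ i a b l h t ≤ ENNReal.ofReal (b - a) := by
  rw [← Real.volume_Ioo]
  exact measure_mono fun s hs => hs.1

/-! ### Potentials of windows and the choice of a cheap cut. -/

/-- The potential of a window. -/
def windowPotential (m : ℕ) (E : Set Plane) (D : Finset Plane) (δ : ℝ) (lo hi : Fin 2 → ℝ) :
    ℝ≥0∞ :=
  ∑ i, stripPotential m E D δ i (lo i) (hi i) (lo (1 - i)) (hi (1 - i))

/-- The length of the bridge that is added on a cut. -/
def cutCost (m : ℕ) (E : Set Plane) (D : Finset Plane) (δ : ℝ) (lo hi : Fin 2 → ℝ) (i : Fin 2)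
    (s : ℝ) : ℝ≥0∞ :=
  volume (lineDense m E D δ i s (lo (1 - i)) (hi (1 - i)))

/-- The length of the part of a cut that is dense in the transversal direction. -/
def cutGain (m : ℕ) (E : Set Plane) (D : Finset Plane) (δ : ℝ) (lo hi : Fin 2 → ℝ) (i : Fin 2)
    (s : ℝ) : ℝ≥0∞ :=
  crossLength m E D δ (1 - i) (lo (1 - i)) (hi (1 - i)) (lo i) (hi i) s

theorem sum_eq_add_other {M : Type*} [AddCommMonoid M] (f : Fin 2 → M) (i : Fin 2) :
    ∑ k, f k = f i + f (1 - i) := by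
  rw [Fin.sum_univ_two]
  fin_cases i
  · rfl
  · exact add_comm _ _

theorem other_ne (i : Fin 2) : 1 - i ≠ i := by
  fin_cases i <;> decide

/-- Lines parallel to the cut are merely distributed between the two parts, while lines crossing it
are cut at `s` and release `m` per dense crossing. -/
theorem windowPotential_cut {m : ℕ} (hm : 0 < m) {E : Set Plane} (hE : IsCompact E)
    {D : Finset Plane} {δ : ℝ} (hδ : 0 < δ)
    (hdisj : (D : Set Plane).PairwiseDisjoint fun c => closedBall c δ)
    (hfin : ∀ i, ∀ᵐ s, (slice i s E).Finite) {lo hi : Fin 2 → ℝ} {i : Fin 2} {s : ℝ}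
    (hlo : lo i < s) (hhi : s < hi i) (hs : (slice i s E).Finite) :
    windowPotential m E D δ lo (Function.update hi i s) +
        windowPotential m E D δ (Function.update lo i s) hi + m * cutGain m E D δ lo hi i s ≤
      windowPotential m E D δ lo hi := by
  have hne := other_ne i
  simp only [windowPotential]
  rw [sum_eq_add_other _ i, sum_eq_add_other _ i, sum_eq_add_other _ i]
  simp only [one_sub_one_sub, Function.update_self, Function.update_of_ne hne]
  have h1 := stripPotential_split m E D δ i hlo.le hhi.le (lo (1 - i)) (hi (1 - i))
  have h2 := stripPotential_cut hm hE hδ hdisj (i := 1 - i) (hfin (1 - i)) (a := lo (1 - i))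
    (b := hi (1 - i)) hlo hhi (by rwa [one_sub_one_sub])
  refine le_trans (le_of_eq ?_) (add_le_add h1 h2)
  rw [cutGain]
  ring

/-- If cost exceeded gain plus the indicated excess on all admissible cuts of both directions,
integrating would give two inequalities whose sum contradicts the equality of integrated costs and
gains. The excess `κ` on the middle half beats the loss from excluding the margins of width `η`. -/
theorem exists_cut {m : ℕ} (hm : 0 < m) {E : Set Plane} (hE : IsCompact E) (D : Finset Plane)
    {δ : ℝ} (hδ : 0 < δ) (hfin : ∀ i, ∀ᵐ s, (slice i s E).Finite) {κ η : ℝ} (hη : 0 < η)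
    (hηδ : η < δ / 2) (hκ : 2 * η < κ * δ) {lo hi : Fin 2 → ℝ}
    (hw : ∀ i, 2 * δ ≤ hi i - lo i) (hw1 : ∀ i, hi i - lo i ≤ 1) :
    ∃ i s, lo i + η < s ∧ s < hi i - η ∧ IsGenericLine E D δ i s (lo (1 - i)) (hi (1 - i)) ∧
      cutCost m E D δ lo hi i s ≤ cutGain m E D δ lo hi i s +
        (Icc (lo i + (hi i - lo i) / 4) (hi i - (hi i - lo i) / 4)).indicator
          (fun _ => ENNReal.ofReal κ) s := by
  by_contra! hcon
  have hκ0 : 0 < κ := by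
    by_contra! h
    nlinarith
  let a : Fin 2 → ℝ≥0∞ := fun i => ∫⁻ s in Ioo (lo i) (hi i), cutCost m E D δ lo hi i s
  have ha : ∀ i, a i = ∫⁻ t in Ioo (lo (1 - i)) (hi (1 - i)), cutGain m E D δ lo hi (1 - i) t := by
    intro i
    have h := lintegral_volume_lineDense hm hE D δ (hfin i) (lo i) (hi i) (lo (1 - i)) (hi (1 - i))
    simp only [cutGain, one_sub_one_sub]
    exact h
  have hgain : ∀ i s, cutGain m E D δ lo hi i s ≤ 1 := fun i s =>
    (crossLength_le _ _ _ _ _ _ _ _ _ _).trans (by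
      rw [← ENNReal.ofReal_one]; exact ENNReal.ofReal_le_ofReal (hw1 _))
  have hafin : ∀ i, a i ≠ ⊤ := by
    intro i
    rw [ha]
    refine ne_top_of_le_ne_top ?_ (lintegral_mono fun t => hgain (1 - i) t)
    simp
  -- The middle half has length at least `δ`, and gains are at most `1`, so the two margins account
  -- for at most `2 η`. Adding both instances gives `κ δ ≤ 2 η`.
  have key : ∀ i, a (1 - i) + ENNReal.ofReal (κ * δ) ≤ a i + ENNReal.ofReal (2 * η) := by
    intro i
    have hwi := hw i
    set M := Icc (lo i + (hi i - lo i) / 4) (hi i - (hi i - lo i) / 4)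
    set I := Ioo (lo i + η) (hi i - η)
    have hMI : M ⊆ I := Icc_subset_Ioo (by linarith) (by linarith)
    have h1 : ∫⁻ s in I, (cutGain m E D δ lo hi i s +
        M.indicator (fun _ => ENNReal.ofReal κ) s) ≤ a i := by
      refine le_trans (setLIntegral_mono_ae' measurableSet_Ioo ?_)
        (lintegral_mono_set (Ioo_subset_Ioo (by linarith) (by linarith)))
      filter_upwards [ae_isGenericLine (hfin i) D δ (lo (1 - i)) (hi (1 - i))] with s hs hsI
      exact (hcon i s hsI.1 hsI.2 hs).le
    rw [lintegral_add_right _ (measurable_const.indicator measurableSet_Icc),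
      lintegral_indicator measurableSet_Icc, setLIntegral_const,
      Measure.restrict_apply measurableSet_Icc, inter_eq_left.2 hMI, Real.volume_Icc,
      ← ENNReal.ofReal_mul hκ0.le] at h1
    have h2 : ENNReal.ofReal (κ * δ) ≤ ENNReal.ofReal
        (κ * (hi i - (hi i - lo i) / 4 - (lo i + (hi i - lo i) / 4))) := by
      apply ENNReal.ofReal_le_ofReal
      gcongr
      linarith
    have h3 : a (1 - i) ≤ (∫⁻ s in I, cutGain m E D δ lo hi i s) + ENNReal.ofReal (2 * η) := by
      rw [ha, one_sub_one_sub]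
      have hcov : Ioo (lo i) (hi i) ⊆
          I ∪ (Icc (lo i) (lo i + η) ∪ Icc (hi i - η) (hi i)) := by
        intro s hs
        rcases le_or_gt s (lo i + η) with h | h
        · exact Or.inr (Or.inl ⟨hs.1.le, h⟩)
        · rcases le_or_gt (hi i - η) s with h' | h'
          · exact Or.inr (Or.inr ⟨h', hs.2.le⟩)
          · exact Or.inl ⟨h, h'⟩
      refine (lintegral_mono_set hcov).trans ((lintegral_union_le _ _ _).trans ?_)
      gcongr
      refine (lintegral_mono fun t => hgain i t).trans ?_
      rw [setLIntegral_one]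
      refine (measure_union_le _ _).trans ?_
      rw [Real.volume_Icc, Real.volume_Icc, ← ENNReal.ofReal_add (by linarith) (by linarith)]
      exact ENNReal.ofReal_le_ofReal (by linarith)
    calc a (1 - i) + ENNReal.ofReal (κ * δ)
        ≤ (∫⁻ s in I, cutGain m E D δ lo hi i s) + ENNReal.ofReal (2 * η) +
          ENNReal.ofReal (κ * (hi i - (hi i - lo i) / 4 - (lo i + (hi i - lo i) / 4))) :=
        add_le_add h3 h2
      _ = ((∫⁻ s in I, cutGain m E D δ lo hi i s) +
          ENNReal.ofReal (κ * (hi i - (hi i - lo i) / 4 - (lo i + (hi i - lo i) / 4)))) +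
            ENNReal.ofReal (2 * η) := by ring
      _ ≤ _ := by gcongr
  have k0 := key 0
  have k1 := key 1
  simp only [sub_zero, sub_self] at k0 k1
  have hx0 := hafin 0
  have hx1 := hafin 1
  lift a 0 to ℝ≥0 using hx0 with x0
  lift a 1 to ℝ≥0 using hx1 with x1
  rw [← ENNReal.ofReal_coe_nnreal (p := x0), ← ENNReal.ofReal_coe_nnreal (p := x1),
    ← ENNReal.ofReal_add (by positivity) (by positivity),
    ← ENNReal.ofReal_add (by positivity) (by positivity),
    ENNReal.ofReal_le_ofReal_iff (by positivity)] at k0 k1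
  linarith

/-! ### Bridges that make generic cuts good. -/

theorem interior_window (lo hi : Fin 2 → ℝ) :
    interior (window lo hi) = {p | ∀ k, lo k < p k ∧ p k < hi k} := by
  have h : window lo hi = (EuclideanSpace.equiv (Fin 2) ℝ).toHomeomorph ⁻¹'
      (univ.pi fun k => Icc (lo k) (hi k)) := by
    ext p
    exact ⟨fun h k _ => h k, fun h k => h k (mem_univ k)⟩
  rw [h, ← Homeomorph.preimage_interior, interior_pi_set finite_univ]
  simp only [interior_Icc]
  ext p
  exact ⟨fun h k => h k (mem_univ k), fun h k _ => h k⟩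

theorem linePoint_mem_interior_window_iff {lo hi : Fin 2 → ℝ} (i : Fin 2) (s t : ℝ) :
    linePoint i s t ∈ interior (window lo hi) ↔
      (lo i < s ∧ s < hi i) ∧ lo (1 - i) < t ∧ t < hi (1 - i) := by
  rw [interior_window]
  change (∀ k, _) ↔ _
  rw [Fin.forall_fin_two]
  fin_cases i <;> simp [linePoint, and_comm]

theorem segment_linePoint (i : Fin 2) (s : ℝ) {a b : ℝ} (hab : a ≤ b) :
    segment ℝ (linePoint i s a) (linePoint i s b) = linePoint i s '' Icc a b := by
  rw [← segment_eq_Icc hab]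
  let f : ℝ →ᵃ[ℝ] Plane := AffineMap.lineMap (linePoint i s 0) (linePoint i s 1)
  have hf : ∀ t, f t = linePoint i s t := by
    intro t
    ext k
    simp only [f, AffineMap.lineMap_apply, linePoint]
    by_cases hk : k = i <;> simp [hk]
  rw [← hf a, ← hf b, ← image_segment]
  exact image_congr fun t _ => hf t

theorem edist_linePoint (i : Fin 2) (s : ℝ) {a b : ℝ} (hab : a ≤ b) :
    edist (linePoint i s a) (linePoint i s b) = ENNReal.ofReal (b - a) := by
  rw [edist_dist, EuclideanSpace.dist_eq, Fin.sum_univ_two]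
  congr 1
  have : dist a b = b - a := by rw [dist_comm, Real.dist_eq, abs_of_nonneg (by linarith)]
  fin_cases i <;> simp [linePoint, this, Real.sqrt_sq (sub_nonneg.2 hab)]

theorem add_radius_le_of_subset_window {c : Plane} {δ : ℝ} (hδ : 0 < δ) {lo hi : Fin 2 → ℝ}
    (h : closedBall c δ ⊆ window lo hi) (i : Fin 2) : lo i + δ ≤ c i ∧ c i + δ ≤ hi i := by
  have hp : ∀ x, x ^ 2 = δ ^ 2 → linePoint i (c i + x) (c (1 - i)) ∈ window lo hi := by
    intro x hx
    apply h
    rw [mem_closedBall_iff _ _ _ _ _ hδ.le]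
    simp [hx]
  have h1 := (linePoint_mem_window_iff i _ _).1 (hp δ rfl)
  have h2 := (linePoint_mem_window_iff i _ _).1 (hp (-δ) (by ring))
  exact ⟨by linarith [h2.1.1], h1.1.2⟩

theorem exists_of_mem_mDiskSpan {m : ℕ} {D : Finset Plane} {δ : ℝ} (hδ : 0 < δ)
    {lo hi : Fin 2 → ℝ} {i : Fin 2} {s : ℝ} (hs : s ∈ Icc (lo i) (hi i))
    (hw : lo (1 - i) ≤ hi (1 - i)) {t : ℝ} (ht : t ∈ mDiskSpan m D δ lo hi i s) :
    let H := chordsHit D δ i s (lo (1 - i)) (hi (1 - i))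
    2 * m < H.card ∧ ∃ a ∈ H, ∃ b ∈ H,
      (H.filter fun c => chordLow δ i s a ≤ chordLow δ i s c).card = m ∧
      (H.filter fun c => chordHigh δ i s c ≤ chordHigh δ i s b).card = m ∧
      t ∈ Icc (chordHigh δ i s b) (chordLow δ i s a) := by
  intro H
  have hHdef : (H : Set Plane) = disksHit D δ lo hi i s := (disksHit_eq hδ hs hw).symm
  have habs : ∀ c ∈ H, |s - c i| ≤ δ := fun c hc => by
    simp only [H, chordsHit, Finset.mem_filter] at hc
    exact hc.2.1
  obtain ⟨hk, a, ha, b, hb, hca, hcb, ht⟩ := ht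
  rw [← hHdef] at hk ha hb hca hcb
  rw [ncard_coe_finset] at hk
  have e1 : {c ∈ (H : Set Plane) | chordBot δ i s a ≤ chordBot δ i s c} =
      ((H.filter fun c => chordLow δ i s a ≤ chordLow δ i s c : Finset Plane) : Set Plane) := by
    ext c
    rw [Finset.coe_filter]
    refine and_congr_right fun hc => ?_
    rw [chordBot_eq hδ (habs a ha), chordBot_eq hδ (habs c hc)]
  have e2 : {c ∈ (H : Set Plane) | chordTop δ i s c ≤ chordTop δ i s b} =
      ((H.filter fun c => chordHigh δ i s c ≤ chordHigh δ i s b : Finset Plane) : Set Plane) := by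
    ext c
    rw [Finset.coe_filter]
    refine and_congr_right fun hc => ?_
    rw [chordTop_eq hδ (habs b hb), chordTop_eq hδ (habs c hc)]
  rw [e1, ncard_coe_finset] at hca
  rw [e2, ncard_coe_finset] at hcb
  rw [chordTop_eq hδ (habs b hb), chordBot_eq hδ (habs a ha)] at ht
  exact ⟨hk, a, ha, b, hb, hca, hcb, ht⟩

theorem frontier_eq_self_of_finite {X : Set ℝ} (hX : X.Finite) : frontier X = X := by
  rw [hX.isClosed.frontier_eq, interior_eq_empty_iff_dense_compl.2 (hX.countable.dense_compl ℝ),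
    sdiff_empty]

/-- On a generic cut there is a bridge, at most as long as the dense part of the cut, that makes
the cut good. -/
theorem exists_bridge {m : ℕ} (hm : 0 < m) {E : Set Plane} {D : Finset Plane} {δ : ℝ}
    (hδ : 0 < δ) (hdisj : (D : Set Plane).PairwiseDisjoint fun c => closedBall c δ)
    {lo hi : Fin 2 → ℝ} {i : Fin 2} {s : ℝ} (hlo : lo i < s) (hhi : s < hi i)
    (hw : lo (1 - i) < hi (1 - i))
    (hs : IsGenericLine E D δ i s (lo (1 - i)) (hi (1 - i))) :
    ∃ B : List (Plane × Plane),
      (∀ e ∈ B, e.1 i = e.2 i ∧ e.1 ≠ e.2 ∧ (segment ℝ e.1 e.2 ∩ E).Finite ∧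
        segment ℝ e.1 e.2 ⊆ interior (window lo hi) ∩ {p | p i = s}) ∧
      B.Pairwise (fun e f => Disjoint (segment ℝ e.1 e.2) (segment ℝ f.1 f.2)) ∧
      (B.map fun e => edist e.1 e.2).sum ≤ cutCost m E D δ lo hi i s ∧
      ∀ F : Set Plane, (∀ p ∈ interior (window lo hi), p i = s →
        (p ∈ F ↔ p ∈ E ∨ ∃ e ∈ B, p ∈ segment ℝ e.1 e.2)) → IsGoodCut m F D δ lo hi i s := by
  have hIcc : s ∈ Icc (lo i) (hi i) := ⟨hlo.le, hhi.le⟩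
  set l := lo (1 - i) with hl
  set h := hi (1 - i) with hh
  set X := slice i s E ∩ Ioo l h with hXdef
  have hX : X.Finite := hs.1.inter_of_left _
  have hJdef : lineDense m E D δ i s l h = denseSet m X (chordsHit D δ i s l h) (chordLow δ i s)
    (chordHigh δ i s) := rfl
  have hmemI : ∀ t, linePoint i s t ∈ interior (window lo hi) ↔ t ∈ Ioo l h := fun t => by
    rw [linePoint_mem_interior_window_iff]
    simp [hlo, hhi, hl, hh]
  have hdisk : mDiskSpan m D δ lo hi i s ⊆ lineDense m E D δ i s l h := by
    intro t ht
    obtain ⟨hk, a, -, b, -, hca, hcb, ht⟩ := exists_of_mem_mDiskSpan hδ hIcc hw.le ht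
    exact diskSpan_mem_denseSet hk hca hcb ht
  -- With at most one dense point no segment is added, since edges of a plane graph are
  -- nondegenerate; both spans must then be contained in `F` already.
  by_cases hJ : (lineDense m E D δ i s l h).Subsingleton
  · refine ⟨[], by simp, List.Pairwise.nil, by simp, fun F hF => ?_⟩
    have hsl : slice i s (F ∩ interior (window lo hi)) = X := by
      ext t
      change linePoint i s t ∈ F ∧ linePoint i s t ∈ interior (window lo hi) ↔ _
      rw [and_comm, hmemI]
      constructor
      · rintro ⟨h1, h2⟩
        exact ⟨((hF _ ((hmemI t).2 h1) (linePoint_apply_self i s t)).1 h2).resolve_right (by simp), h1⟩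
      · rintro ⟨h1, h2⟩
        exact ⟨h2, (hF _ ((hmemI t).2 h2) (linePoint_apply_self i s t)).2 (Or.inl h1)⟩
    have hP : cutEndpoints F lo hi i s = X := by
      rw [cutEndpoints, hsl, frontier_eq_self_of_finite hX]
    refine ⟨hP ▸ hX, ?_, ?_⟩
    · rintro _ ⟨t, ht, rfl⟩
      rw [mSpan, hP] at ht
      have ht' : t ∈ slice i s (F ∩ interior (window lo hi)) :=
        hsl ▸ spanOf_subset_of_subsingleton hX _ _ _ (hJdef ▸ hJ) ht
      exact ht'.1
    · rintro _ ⟨t, ht, rfl⟩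
      -- Both ends of a nonempty disk-span are dense, hence equal here: the top of one chord is the
      -- bottom of another or of itself. This is impossible, since the chords are disjoint and, on a
      -- line tangent to no disk, nondegenerate.
      exfalso
      obtain ⟨hk, a, ha, b, hb, hca, hcb, ht⟩ := exists_of_mem_mDiskSpan hδ hIcc hw.le ht
      have hle := ht.1.trans ht.2
      have heq := hJ (diskSpan_mem_denseSet hk hca hcb (left_mem_Icc.2 hle))
        (diskSpan_mem_denseSet hk hca hcb (right_mem_Icc.2 hle))
      have hlt : ∀ c ∈ chordsHit D δ i s l h, chordLow δ i s c < chordHigh δ i s c := by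
        intro c hc
        rw [chordsHit, Finset.mem_filter] at hc
        have h1 := lt_of_le_of_ne hc.2.1 (hs.2 c hc.1).1
        have h2 : 0 < Real.sqrt (δ ^ 2 - (s - c i) ^ 2) := by
          apply Real.sqrt_pos.2
          rw [sub_pos, sq_lt_sq, abs_of_pos hδ]
          exact h1
        unfold chordLow chordHigh
        linarith
      by_cases hab : a = b
      · subst hab
        exact absurd heq (hlt a ha).ne'
      · rcases chords_separated hδ hdisj i s l h a ha b hb hab with h' | h'
        · linarith [hlt a ha, hlt b hb]
        · linarith
  · rcases hs.lineDense_eq hm with h0 | ⟨a, b, hla, hbh, hab⟩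
    · exact absurd (h0 ▸ subsingleton_empty) hJ
    have hlt : a < b := by
      by_contra! hba
      exact hJ (hab ▸ subsingleton_Icc_of_ge hba)
    have hseg := segment_linePoint i s hlt.le
    have hin : Icc a b ⊆ Ioo l h := Icc_subset_Ioo hla hbh
    refine ⟨[(linePoint i s a, linePoint i s b)], ?_, List.pairwise_singleton _ _, ?_, ?_⟩
    · intro e he
      rw [List.mem_singleton] at he
      subst he
      refine ⟨by simp [linePoint_apply_self], ?_, ?_, ?_⟩
      · intro heq
        have := congrArg (fun p : Plane => p (1 - i)) heq
        simp only [linePoint_apply_other] at this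
        exact hlt.ne this
      · rw [hseg]
        refine (hs.1.image (linePoint i s)).subset ?_
        rintro _ ⟨⟨t, -, rfl⟩, ht⟩
        exact ⟨t, ht, rfl⟩
      · rw [hseg]
        rintro _ ⟨t, ht, rfl⟩
        exact ⟨(hmemI t).2 (hin ht), linePoint_apply_self i s t⟩
    · simp only [List.map_cons, List.map_nil, List.sum_cons, List.sum_nil, add_zero]
      rw [edist_linePoint i s hlt.le, cutCost, ← hl, ← hh, hab, Real.volume_Icc]
    · intro F hF
      have hsl : slice i s (F ∩ interior (window lo hi)) = X ∪ Icc a b := by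
        ext t
        change linePoint i s t ∈ F ∧ linePoint i s t ∈ interior (window lo hi) ↔ _
        rw [and_comm, hmemI]
        have himg : linePoint i s t ∈ linePoint i s '' Icc a b ↔ t ∈ Icc a b := by
          constructor
          · rintro ⟨t', ht', heq⟩
            have := congrArg (fun p : Plane => p (1 - i)) heq
            simp only [linePoint_apply_other] at this
            rwa [← this]
          · exact fun ht => ⟨t, ht, rfl⟩
        have hF' : t ∈ Ioo l h → (linePoint i s t ∈ F ↔ linePoint i s t ∈ E ∨ t ∈ Icc a b) := by
          intro ht
          rw [hF _ ((hmemI t).2 ht) (linePoint_apply_self i s t)]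
          simp only [List.mem_singleton, exists_eq_left]
          rw [hseg, himg]
        constructor
        · rintro ⟨h1, h2⟩
          rcases (hF' h1).1 h2 with h3 | h3
          · exact Or.inl ⟨h3, h1⟩
          · exact Or.inr h3
        · rintro (⟨h1, h2⟩ | h1)
          · exact ⟨h2, (hF' h2).2 (Or.inl h1)⟩
          · exact ⟨hin h1, (hF' (hin h1)).2 (Or.inr h1)⟩
      have hP : cutEndpoints F lo hi i s = frontier (X ∪ Icc a b) := by rw [cutEndpoints, hsl]
      have hsub : ∀ t ∈ Icc a b, linePoint i s t ∈ F := by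
        intro t ht
        have ht' : t ∈ slice i s (F ∩ interior (window lo hi)) := hsl ▸ Or.inr ht
        exact ht'.1
      refine ⟨?_, ?_, ?_⟩
      · rw [hP]
        exact (hX.union (toFinite {a, b})).subset (frontier_finite_union_Icc_subset hX a b)
      · rintro _ ⟨t, ht, rfl⟩
        rw [mSpan, hP] at ht
        exact hsub t (spanOf_frontier_subset hX _ _ _ hlt.le (hJdef ▸ hab) ht)
      · rintro _ ⟨t, ht, rfl⟩
        exact hsub t (hab ▸ hdisk ht)

/-! ### The recursive construction. -/

/-- The area of a window. -/
def windowArea (lo hi : Fin 2 → ℝ) : ℝ := ∏ k, (hi k - lo k)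

theorem windowArea_eq (lo hi : Fin 2 → ℝ) (i : Fin 2) :
    windowArea lo hi = (hi i - lo i) * (hi (1 - i) - lo (1 - i)) := by
  rw [windowArea, Fin.prod_univ_two]
  fin_cases i
  · rfl
  · exact mul_comm _ _

/-- For parts of widths `u`, `v` and common height `w`, the squared area drops by `2 u v w²`. A cut
in the middle half has `u, v ≥ δ / 2` and `w ≥ 2δ`, so `u v w² ≥ δ⁴`; this is what pays for the
excess allowed in `exists_cut`. -/
theorem windowArea_sq_cut {lo hi : Fin 2 → ℝ} {i : Fin 2} {s : ℝ} (hlo : lo i < s) (hhi : s < hi i)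
    {ε δ : ℝ} (hε : 0 ≤ ε) (hδ : 0 < δ) (hw : ∀ k, 2 * δ ≤ hi k - lo k) :
    ENNReal.ofReal (ε * windowArea lo (Function.update hi i s) ^ 2) +
        ENNReal.ofReal (ε * windowArea (Function.update lo i s) hi ^ 2) +
        (Icc (lo i + (hi i - lo i) / 4) (hi i - (hi i - lo i) / 4)).indicator
          (fun _ => ENNReal.ofReal (2 * ε * δ ^ 4)) s ≤
      ENNReal.ofReal (ε * windowArea lo hi ^ 2) := by
  have hne := other_ne i
  rw [windowArea_eq lo hi i, windowArea_eq _ _ i, windowArea_eq _ _ i]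
  simp only [Function.update_self, Function.update_of_ne hne]
  set w := hi (1 - i) - lo (1 - i)
  have hw1 : 2 * δ ≤ w := hw (1 - i)
  have hw2 := hw i
  have huv : ε * ((hi i - lo i) * w) ^ 2 = ε * ((s - lo i) * w) ^ 2 + ε * ((hi i - s) * w) ^ 2 +
      2 * ε * ((s - lo i) * (hi i - s) * w ^ 2) := by ring
  have hu : 0 < s - lo i := sub_pos.2 hlo
  have hv : 0 < hi i - s := sub_pos.2 hhi
  have hind : (Icc (lo i + (hi i - lo i) / 4) (hi i - (hi i - lo i) / 4)).indicator
      (fun _ => ENNReal.ofReal (2 * ε * δ ^ 4)) s ≤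
      ENNReal.ofReal (2 * ε * ((s - lo i) * (hi i - s) * w ^ 2)) := by
    by_cases hs : s ∈ Icc (lo i + (hi i - lo i) / 4) (hi i - (hi i - lo i) / 4)
    · rw [indicator_of_mem hs]
      apply ENNReal.ofReal_le_ofReal
      have h1 : δ / 2 ≤ s - lo i := by linarith [hs.1]
      have h2 : δ / 2 ≤ hi i - s := by linarith [hs.2]
      have h3 : δ / 2 * (δ / 2) * (2 * δ) ^ 2 ≤ (s - lo i) * (hi i - s) * w ^ 2 := by gcongr
      have h4 : δ ^ 4 ≤ (s - lo i) * (hi i - s) * w ^ 2 := by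
        refine le_trans (le_of_eq ?_) h3
        ring
      gcongr
    · rw [indicator_of_notMem hs]
      exact zero_le
  rw [huv, ENNReal.ofReal_add (by positivity) (by positivity),
    ENNReal.ofReal_add (by positivity) (by positivity)]
  gcongr

theorem interior_window_mono {lo hi lo' hi' : Fin 2 → ℝ} (hlo : lo ≤ lo') (hhi : hi' ≤ hi) :
    interior (window lo' hi') ⊆ interior (window lo hi) :=
  interior_mono fun _ hp k => ⟨(hlo k).trans (hp k).1, (hp k).2.trans (hhi k)⟩

/-- The recursive construction of the bridges in a window. -/
theorem exists_bridges {m : ℕ} (hm : 0 < m) {E : Set Plane} (hE : IsCompact E) {D : Finset Plane}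
    {δ : ℝ} (hδ : 0 < δ) (hdisj : (D : Set Plane).PairwiseDisjoint fun c => closedBall c δ)
    (hfin : ∀ i, ∀ᵐ s, (slice i s E).Finite) {ε η : ℝ} (hε : 0 ≤ ε) (hη : 0 < η)
    (hηδ : η < δ / 2) (hκ : 2 * η < 2 * ε * δ ^ 4 * δ) (n : ℕ) :
    ∀ lo hi : Fin 2 → ℝ, (∀ k, hi k - lo k ≤ 1) → (hi 0 - lo 0) + (hi 1 - lo 1) ≤ n * η →
    ∃ S : List (Plane × Plane),
      (∀ e ∈ S, (∃ i, e.1 i = e.2 i) ∧ e.1 ≠ e.2 ∧ (segment ℝ e.1 e.2 ∩ E).Finite ∧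
        segment ℝ e.1 e.2 ⊆ interior (window lo hi)) ∧
      S.Pairwise (fun e f => Disjoint (segment ℝ e.1 e.2) (segment ℝ f.1 f.2)) ∧
      (S.map fun e => edist e.1 e.2).sum ≤
        windowPotential m E D δ lo hi / m + ENNReal.ofReal (ε * windowArea lo hi ^ 2) ∧
      ∀ F : Set Plane, (∀ p ∈ interior (window lo hi),
        (p ∈ F ↔ p ∈ E ∨ ∃ e ∈ S, p ∈ segment ℝ e.1 e.2)) → IsGuillotine m F D δ lo hi := by
  have hm0 : (m : ℝ≥0∞) ≠ 0 := by exact_mod_cast hm.ne'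
  have hmt : (m : ℝ≥0∞) ≠ ⊤ := ENNReal.natCast_ne_top m
  induction n with
  | zero =>
    intro lo hi _ hsum
    refine ⟨[], by simp, List.Pairwise.nil, by simp, fun F _ => .noDisk lo hi fun c _ hc => ?_⟩
    have h0 := add_radius_le_of_subset_window hδ hc 0
    have h1 := add_radius_le_of_subset_window hδ hc 1
    simp at hsum
    linarith
  | succ n ih =>
    intro lo hi hw1 hsum
    by_cases hdisk : ∀ c ∈ D, ¬ closedBall c δ ⊆ window lo hi
    · exact ⟨[], by simp, List.Pairwise.nil, by simp, fun F _ => .noDisk lo hi hdisk⟩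
    push Not at hdisk
    obtain ⟨c, -, hc⟩ := hdisk
    have hw : ∀ k, 2 * δ ≤ hi k - lo k := fun k => by
      have := add_radius_le_of_subset_window hδ hc k
      linarith
    obtain ⟨i, s, hsl, hsh, hgen, hcost⟩ := exists_cut hm hE D hδ hfin hη hηδ hκ hw hw1
    have hlo : lo i < s := by linarith
    have hhi : s < hi i := by linarith
    have hne := other_ne i
    set hi' := Function.update hi i s with hhi'
    set lo' := Function.update lo i s with hlo'
    have hhi'i : hi' i = s := Function.update_self ..
    have hlo'i : lo' i = s := Function.update_self ..
    have hhi'j : hi' (1 - i) = hi (1 - i) := Function.update_of_ne hne ..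
    have hlo'j : lo' (1 - i) = lo (1 - i) := Function.update_of_ne hne ..
    have hfa : ∀ P : Fin 2 → Prop, P i → P (1 - i) → ∀ k, P k := by
      intro P h1 h2 k
      fin_cases i <;> fin_cases k <;> assumption
    have hhile : hi' ≤ hi := hfa _ (by rw [hhi'i]; exact hhi.le) hhi'j.le
    have hlole : lo ≤ lo' := hfa _ (by rw [hlo'i]; exact hlo.le) hlo'j.ge
    have hsum2 : ∀ a b : Fin 2 → ℝ,
        (b 0 - a 0) + (b 1 - a 1) = (b i - a i) + (b (1 - i) - a (1 - i)) := by
      intro a b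
      have := sum_eq_add_other (fun k => b k - a k) i
      rwa [Fin.sum_univ_two] at this
    push_cast at hsum
    rw [hsum2] at hsum
    -- The cut is more than `η` away from both sides, so the half-perimeter of either part is
    -- smaller by more than `η`.
    obtain ⟨S₁, hS₁, hp₁, hl₁, hg₁⟩ := ih lo hi'
      (fun k => (sub_le_sub_right (hhile k) _).trans (hw1 k))
      (by rw [hsum2, hhi'i, hhi'j]; linarith)
    obtain ⟨S₂, hS₂, hp₂, hl₂, hg₂⟩ := ih lo' hi
      (fun k => (sub_le_sub_left (hlole k) _).trans (hw1 k))
      (by rw [hsum2, hlo'i, hlo'j]; linarith)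
    obtain ⟨B, hB, hpB, hlB, hgB⟩ := exists_bridge (m := m) hm hδ hdisj hlo hhi
      (by linarith [hw (1 - i)]) hgen
    have hin₁ : ∀ p ∈ interior (window lo hi'), p i < s := by
      intro p hp
      rw [interior_window] at hp
      exact (hp i).2.trans_eq hhi'i
    have hin₂ : ∀ p ∈ interior (window lo' hi), s < p i := by
      intro p hp
      rw [interior_window] at hp
      exact hlo'i.symm.trans_lt (hp i).1
    have hS₁i : ∀ e ∈ S₁, ∀ p ∈ segment ℝ e.1 e.2, p i < s := fun e he p hp =>
      hin₁ p ((hS₁ e he).2.2.2 hp)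
    have hS₂i : ∀ e ∈ S₂, ∀ p ∈ segment ℝ e.1 e.2, s < p i := fun e he p hp =>
      hin₂ p ((hS₂ e he).2.2.2 hp)
    have hBi : ∀ e ∈ B, ∀ p ∈ segment ℝ e.1 e.2, p i = s := fun e he p hp =>
      ((hB e he).2.2.2 hp).2
    refine ⟨B ++ (S₁ ++ S₂), ?_, ?_, ?_, ?_⟩
    · intro e he
      rw [List.mem_append, List.mem_append] at he
      rcases he with he | he | he
      · obtain ⟨h1, h2, h3, h4⟩ := hB e he
        exact ⟨⟨i, h1⟩, h2, h3, h4.trans inter_subset_left⟩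
      · obtain ⟨h1, h2, h3, h4⟩ := hS₁ e he
        exact ⟨h1, h2, h3, h4.trans (interior_window_mono le_rfl hhile)⟩
      · obtain ⟨h1, h2, h3, h4⟩ := hS₂ e he
        exact ⟨h1, h2, h3, h4.trans (interior_window_mono hlole le_rfl)⟩
    · rw [List.pairwise_append, List.pairwise_append]
      refine ⟨hpB, ⟨hp₁, hp₂, ?_⟩, ?_⟩
      · intro e he f hf
        exact disjoint_left.2 fun p hp hp' => lt_asymm (hS₁i e he p hp) (hS₂i f hf p hp')
      · intro e he f hf
        rw [disjoint_left]
        intro p hp hp'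
        have h0 := hBi e he p hp
        rcases List.mem_append.1 hf with hf | hf
        · exact (hS₁i f hf p hp').ne h0
        · exact (hS₂i f hf p hp').ne' h0
    · rw [List.map_append, List.map_append, List.sum_append, List.sum_append]
      -- The bridge costs at most the gain plus the excess. The drop of the potential, divided by
      -- `m`, covers the gain, and the drop of the squared area covers the excess.
      have hpot := windowPotential_cut hm hE hδ hdisj hfin hlo hhi hgen.1
      have harea := windowArea_sq_cut hlo hhi hε hδ hw
      have hdiv := ENNReal.div_le_div_right hpot m
      rw [ENNReal.add_div, ENNReal.add_div, mul_comm, ENNReal.mul_div_cancel_right hm0 hmt] at hdiv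
      refine (add_le_add (hlB.trans hcost) (add_le_add hl₁ hl₂)).trans ?_
      refine le_trans (le_of_eq ?_) (add_le_add hdiv harea)
      ring
    · intro F hF
      have hmem : ∀ p, (∃ e ∈ B ++ (S₁ ++ S₂), p ∈ segment ℝ e.1 e.2) ↔
          (∃ e ∈ B, p ∈ segment ℝ e.1 e.2) ∨ (∃ e ∈ S₁, p ∈ segment ℝ e.1 e.2) ∨
            ∃ e ∈ S₂, p ∈ segment ℝ e.1 e.2 := by
        intro p
        simp only [List.mem_append, or_and_right, exists_or]
      -- On the cut and in each open part, only the bridges belonging to that piece are visible.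
      -- This locality is why the statement allows any `F` with the prescribed trace on the open
      -- window.
      refine .split lo hi i s hlo hhi (hgB F ?_) (hg₁ F ?_) (hg₂ F ?_)
      · intro p hp hps
        rw [hF p hp, hmem]
        have n1 : ¬ ∃ e ∈ S₁, p ∈ segment ℝ e.1 e.2 := fun ⟨e, he, h⟩ => (hS₁i e he p h).ne hps
        have n2 : ¬ ∃ e ∈ S₂, p ∈ segment ℝ e.1 e.2 := fun ⟨e, he, h⟩ => (hS₂i e he p h).ne' hps
        simp only [n1, n2, or_false]
      · intro p hp
        have hps := hin₁ p hp
        rw [hF p (interior_window_mono le_rfl hhile hp), hmem]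
        have n1 : ¬ ∃ e ∈ B, p ∈ segment ℝ e.1 e.2 := fun ⟨e, he, h⟩ => hps.ne (hBi e he p h)
        have n2 : ¬ ∃ e ∈ S₂, p ∈ segment ℝ e.1 e.2 := fun ⟨e, he, h⟩ => lt_asymm hps (hS₂i e he p h)
        simp only [n1, n2, or_false, false_or]
      · intro p hp
        have hps := hin₂ p hp
        rw [hF p (interior_window_mono hlole le_rfl hp), hmem]
        have n1 : ¬ ∃ e ∈ B, p ∈ segment ℝ e.1 e.2 := fun ⟨e, he, h⟩ => hps.ne' (hBi e he p h)
        have n2 : ¬ ∃ e ∈ S₁, p ∈ segment ℝ e.1 e.2 := fun ⟨e, he, h⟩ => lt_asymm hps (hS₁i e he p h)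
        simp only [n1, n2, false_or]

/-! ### The initial potential and the conclusion. -/

theorem linePotential_succ_le {m n k : ℕ} (hm : 0 < m) (hk : 0 < k) :
    linePotential m n k + 1 ≤ n + k := by
  unfold linePotential
  split_ifs <;> omega

theorem linePotential_le (m n k : ℕ) : linePotential m n k ≤ n + k := by
  unfold linePotential
  omega

/-- The potential of a line is at most `n + k`, and at most `n + k - 1` on the lines, of measure
`2δ`, that hit a fixed disk `c₀`. Each disk is hit by lines of measure `2δ`. -/
theorem stripPotential_add_le {m : ℕ} (hm : 0 < m) {E : Set Plane} (D : Finset Plane) {δ : ℝ}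
    (hδ : 0 < δ) (hDB : ∀ c ∈ D, closedBall c δ ⊆ unitSquare) (hD : D.Nonempty) (i : Fin 2)
    (hfin : ∀ᵐ s, (slice i s E).Finite) :
    stripPotential m E D δ i 0 1 0 1 + ENNReal.ofReal (2 * δ) ≤
      (∫⁻ s, ((slice i s E).encard : ℝ≥0∞)) + D.card * ENNReal.ofReal (2 * δ) := by
  classical
  obtain ⟨c₀, hc₀⟩ := hD
  have hb : ∀ c ∈ D, ∀ k, δ ≤ c k ∧ c k + δ ≤ 1 := fun c hc k => by
    have := add_radius_le_of_subset_window hδ (hDB c hc) k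
    simpa using this
  let I : Plane → Set ℝ := fun c => Ioo (c i - δ) (c i + δ)
  have hvol : ∀ c, volume (I c) = ENNReal.ofReal (2 * δ) := fun c => by
    rw [Real.volume_Ioo]; congr 1; ring
  have hone : ENNReal.ofReal (2 * δ) = ∫⁻ s in Ioo (0 : ℝ) 1, (I c₀).indicator 1 s := by
    rw [lintegral_indicator_one measurableSet_Ioo, Measure.restrict_apply measurableSet_Ioo,
      inter_eq_left.2 (Ioo_subset_Ioo (by linarith [(hb c₀ hc₀ i).1]) (hb c₀ hc₀ i).2), hvol]
  have hsum : (D.card : ℝ≥0∞) * ENNReal.ofReal (2 * δ) = ∫⁻ s, ∑ c ∈ D, (I c).indicator 1 s := by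
    rw [lintegral_finsetSum _ fun c _ => measurable_one.indicator measurableSet_Ioo]
    simp only [lintegral_indicator_one (measurableSet_Ioo)]
    rw [Finset.sum_congr rfl fun c _ => hvol c, Finset.sum_const, nsmul_eq_mul]
  rw [hsum, stripPotential]
  rw [← lintegral_add_right _ (Finset.measurable_fun_sum _ fun c _ =>
    measurable_one.indicator measurableSet_Ioo), hone,
    ← lintegral_add_right _ (measurable_one.indicator measurableSet_Ioo)]
  refine le_trans (lintegral_mono_ae ?_) (setLIntegral_le_lintegral (Ioo 0 1) _)
  refine ae_restrict_of_ae ?_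
  filter_upwards [ae_isGenericLine hfin D δ 0 1] with s hs
  have hX : (slice i s E ∩ Ioo 0 1).ncard ≤ (slice i s E).ncard :=
    ncard_le_ncard inter_subset_left hs.1
  have hcard : (chordsHit D δ i s 0 1).card ≤ ∑ c ∈ D, (I c).indicator (1 : ℝ → ℕ) s := by
    rw [chordsHit, Finset.card_filter]
    refine Finset.sum_le_sum fun c hc => ?_
    split_ifs with h
    · have h1 := abs_lt.1 (lt_of_le_of_ne h.1 (hs.2 c hc).1)
      rw [indicator_of_mem (show s ∈ I c from ⟨by linarith [h1.1], by linarith [h1.2]⟩)]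
      rfl
    · exact Nat.zero_le _
  have hle : potentialOn m E D δ i s 0 1 + (I c₀).indicator (1 : ℝ → ℕ) s ≤
      (slice i s E).ncard + ∑ c ∈ D, (I c).indicator (1 : ℝ → ℕ) s := by
    refine le_trans ?_ (add_le_add hX hcard)
    unfold potentialOn
    by_cases hmem : s ∈ I c₀
    · rw [indicator_of_mem hmem, Pi.one_apply]
      refine linePotential_succ_le hm (Finset.card_pos.2 ⟨c₀, ?_⟩)
      rw [chordsHit, Finset.mem_filter]
      have hc := hb c₀ hc₀ (1 - i)
      have h0 := Real.sqrt_nonneg (δ ^ 2 - (s - c₀ i) ^ 2)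
      refine ⟨hc₀, abs_le.2 ⟨by linarith [hmem.1], by linarith [hmem.2]⟩, ?_, ?_⟩
      · unfold chordLow
        linarith
      · unfold chordHigh
        linarith
    · rw [indicator_of_notMem hmem, add_zero]
      exact linePotential_le _ _ _
  have hcast : ∀ c, (((I c).indicator (1 : ℝ → ℕ) s : ℕ) : ℝ≥0∞) = (I c).indicator 1 s := by
    intro c
    by_cases h : s ∈ I c
    · rw [indicator_of_mem h, indicator_of_mem h]; simp
    · rw [indicator_of_notMem h, indicator_of_notMem h]; simp
  have hle' : ((potentialOn m E D δ i s 0 1 + (I c₀).indicator (1 : ℝ → ℕ) s : ℕ) : ℝ≥0∞) ≤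
      (((slice i s E).ncard + ∑ c ∈ D, (I c).indicator (1 : ℝ → ℕ) s : ℕ) : ℝ≥0∞) := by
    exact_mod_cast hle
  rw [Nat.cast_add, Nat.cast_add, Nat.cast_sum, hcast, Finset.sum_congr rfl fun c _ => hcast c] at hle'
  rw [← hs.1.cast_ncard_eq, ENat.toENNReal_coe]
  exact hle'

theorem windowPotential_unitSquare_add_le {m : ℕ} (hm : 0 < m) (G : PlaneGraph) (L : ℝ≥0)
    (hL : G.length = L) (D : Finset Plane) {δ : ℝ} (hδ : 0 < δ)
    (hDB : ∀ c ∈ D, closedBall c δ ⊆ unitSquare) (hD : D.Nonempty) :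
    windowPotential m G.edgeSet D δ 0 1 + ENNReal.ofReal (4 * δ) ≤
      ENNReal.ofReal (Real.sqrt 2 * L + D.card * (4 * δ)) := by
  have hfin := ae_finite_slice G (hL ▸ ENNReal.coe_ne_top)
  have h0 := stripPotential_add_le hm D hδ hDB hD 0 (hfin 0)
  have h1 := stripPotential_add_le hm D hδ hDB hD 1 (hfin 1)
  have hs := sum_lintegral_encard_slice_le G
  have h4 : ENNReal.ofReal (4 * δ) = ENNReal.ofReal (2 * δ) + ENNReal.ofReal (2 * δ) := by
    rw [← ENNReal.ofReal_add (by positivity) (by positivity)]; congr 1; ring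
  rw [ENNReal.ofReal_add (by positivity) (by positivity), ENNReal.ofReal_mul (Real.sqrt_nonneg 2),
    ENNReal.ofReal_coe_nnreal, ← hL, ENNReal.ofReal_mul (p := (D.card : ℝ)) (by positivity), ENNReal.ofReal_natCast]
  rw [windowPotential, Fin.sum_univ_two, h4]
  simp only [Pi.zero_apply, Pi.one_apply]
  calc _ = (stripPotential m G.edgeSet D δ 0 0 1 0 1 + ENNReal.ofReal (2 * δ)) +
        (stripPotential m G.edgeSet D δ 1 0 1 0 1 + ENNReal.ofReal (2 * δ)) := by ring
    _ ≤ _ := add_le_add h0 h1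
    _ = ((∫⁻ s, ((slice 0 s G.edgeSet).encard : ℝ≥0∞)) +
        ∫⁻ s, ((slice 1 s G.edgeSet).encard : ℝ≥0∞)) +
        D.card * (ENNReal.ofReal (2 * δ) + ENNReal.ofReal (2 * δ)) := by ring
    _ ≤ _ := by gcongr

theorem exists_guillotine_graph (G : PlaneGraph) (hconn : G.toSimpleGraph.Connected)
    (L : ℝ≥0) (hL : G.length = (L : ℝ≥0∞))
    (δ : ℝ) (hδ : 0 < δ) (D : Finset Plane)
    (hdisj : (D : Set Plane).PairwiseDisjoint fun c => closedBall c δ)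
    (hmeet : ∀ c ∈ D, (closedBall c δ ∩ G.edgeSet).Nonempty)
    (hDB : ∀ c ∈ D, closedBall c δ ⊆ unitSquare) (m : ℕ) (hm : 0 < m) :
    ∃ G' : PlaneGraph,
      (∃ S : Finset (Plane × Plane), (∀ e ∈ S, ∃ i : Fin 2, e.1 i = e.2 i) ∧
        G'.edgeSet = G.edgeSet ∪ ⋃ e ∈ S, segment ℝ e.1 e.2) ∧
      IsGuillotine m G'.edgeSet D δ 0 1 ∧
      G'.length ≤ ENNReal.ofReal
        ((1 + (Real.sqrt 2 + 16 / Real.pi) / (m : ℝ)) * (L : ℝ) + 16 * δ / (m : ℝ)) := by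
  classical
  have hmR : (0 : ℝ) < m := by exact_mod_cast hm
  have hpi := Real.pi_pos
  rcases D.eq_empty_or_nonempty with rfl | hD
  · refine ⟨G, ⟨∅, by simp, by simp⟩, .noDisk _ _ (by simp), ?_⟩
    rw [hL, ← ENNReal.ofReal_coe_nnreal]
    apply ENNReal.ofReal_le_ofReal
    have h1 : 0 ≤ (Real.sqrt 2 + 16 / Real.pi) / (m : ℝ) * L := by positivity
    have h2 : 0 ≤ 16 * δ / (m : ℝ) := by positivity
    linarith
  have hE := G.isCompact_edgeSet
  have hfin := ae_finite_slice G (hL ▸ ENNReal.coe_ne_top)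
  -- The unit square has area `1`, so the area term contributes exactly `ε`. This is the saving `4δ`
  -- of `windowPotential_unitSquare_add_le` divided by `m`.
  set ε : ℝ := 4 * δ / m
  have hε : 0 < ε := by positivity
  set η : ℝ := min (δ / 4) (ε * δ ^ 5 / 2)
  have hη : 0 < η := by positivity
  have hη1 : η ≤ δ / 4 := min_le_left _ _
  have hη2 : η ≤ ε * δ ^ 5 / 2 := min_le_right _ _
  -- The half-perimeter of the unit square is `2`, so `n` levels of recursion suffice.
  obtain ⟨n, hn⟩ := exists_nat_ge (2 / η)
  rw [div_le_iff₀ hη] at hn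
  obtain ⟨S, hS, hpw, hlen, hguil⟩ := exists_bridges hm hE hδ hdisj hfin hε.le hη
    (by linarith) (by
      have : 0 < ε * δ ^ 5 := by positivity
      nlinarith) n 0 1 (by simp) (by simp; linarith)
  obtain ⟨G', hG'E, hG'L⟩ := G.exists_addSegments S (fun e he => (hS e he).2.1)
    (fun e he => (hS e he).2.2.1) hpw
  refine ⟨G', ⟨S.toFinset, fun e he => (hS e (List.mem_toFinset.1 he)).1, ?_⟩, ?_, ?_⟩
  · rw [hG'E]
    simp only [List.mem_toFinset]
  · refine hguil _ fun p _ => ?_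
    rw [hG'E]
    simp only [mem_union, mem_iUnion, exists_prop]
  · refine hG'L.trans ?_
    have hpot := ENNReal.div_le_div_right
      (windowPotential_unitSquare_add_le hm G L hL D hδ hDB hD) m
    rw [ENNReal.add_div, ← ENNReal.ofReal_natCast m, ← ENNReal.ofReal_div_of_pos hmR,
      ← ENNReal.ofReal_div_of_pos hmR] at hpot
    have hlen' : (S.map fun e => edist e.1 e.2).sum ≤
        ENNReal.ofReal ((Real.sqrt 2 * L + D.card * (4 * δ)) / m) := by
      refine hlen.trans (le_trans (le_of_eq ?_) hpot)
      rw [ENNReal.ofReal_natCast]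
      simp [windowArea, ε]
    rw [hL]
    refine (add_le_add le_rfl hlen').trans ?_
    rw [← ENNReal.ofReal_coe_nnreal, ← ENNReal.ofReal_add (by positivity) (by positivity)]
    apply ENNReal.ofReal_le_ofReal
    have hcard := G.card_disks_le hconn L hL δ hδ D hdisj hmeet
    have h1 : (D.card : ℝ) * (4 * δ) ≤ 16 / Real.pi * L + 16 * δ := by
      have h2 : Real.pi * ((D.card : ℝ) * (4 * δ)) ≤ Real.pi * (16 / Real.pi * L + 16 * δ) := by
        have h3 : Real.pi * (16 / Real.pi * L + 16 * δ) = 16 * L + 16 * (Real.pi * δ) := by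
          field_simp
        rw [h3]
        nlinarith
      exact le_of_mul_le_mul_left h2 hpi
    calc (L : ℝ) + (Real.sqrt 2 * L + D.card * (4 * δ)) / m
        ≤ L + (Real.sqrt 2 * L + (16 / Real.pi * L + 16 * δ)) / m := by gcongr
      _ = _ := by ring

end

theorem mainTheorem3 (G : PlaneGraph) (hconn : G.toSimpleGraph.Connected)
    (L : ℝ≥0) (hL : G.length = (L : ℝ≥0∞))
    (δ : ℝ) (hδ : 0 < δ) (D : Finset Plane)
    (hdisj : (D : Set Plane).PairwiseDisjoint fun c => closedBall c δ)
    (hmeet : ∀ c ∈ D, (closedBall c δ ∩ G.edgeSet).Nonempty)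
    (hGB : G.edgeSet ⊆ unitSquare) (hDB : ∀ c ∈ D, closedBall c δ ⊆ unitSquare)
    (m : ℕ) (hm : 0 < m) :
    ∃ G' : PlaneGraph,
      (∃ S : Finset (Plane × Plane), (∀ e ∈ S, ∃ i : Fin 2, e.1 i = e.2 i) ∧
        G'.edgeSet = G.edgeSet ∪ ⋃ e ∈ S, segment ℝ e.1 e.2) ∧
      IsGuillotine m G'.edgeSet D δ 0 1 ∧
      G'.length ≤ ENNReal.ofReal
        ((1 + (Real.sqrt 2 + 16 / Real.pi) / (m : ℝ)) * (L : ℝ) + 16 * δ / (m : ℝ)) :=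
  exists_guillotine_graph G hconn L hL δ hδ D hdisj hmeet hDB m hm
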